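/- Let $\Lambda>0$ and $H=\sqrt{\Lambda/3}$. For $(a,m)\in\mathbb{R}^2$ let $$g_{\mathcal K_{a,m}}=\frac{\rho^2}{\Delta_r}\,dr^2+\frac{\rho^2}{\Delta_\theta}\,d\theta^2+\sin^2\theta\,\frac{\Delta_\theta}{\rho^2}\Bigl(a\,dt-\frac{r^2+a^2}{\Delta_0}\,d\phi\Bigr)^2-\frac{\Delta_r}{\rho^2}\Bigl(dt-\frac{a\sin^2\theta}{\Delta_0}\,d\phi\Bigr)^2$$ be the Kerr–de Sitter metric, where $\rho^2=r^2+a^2\cos^2\theta$, $\Delta_r=(r^2+a^2)(1-\frac{\Lambda}{3}r^2)-2mr$, $\Delta_\theta=1+\frac{\Lambda}{3}a^2\cos^2\theta$, $\Delta_0=1+\frac{\Lambda}{3}a^2$, viewed with $r=e^{Hs}$ as a smooth tensor on $\mathcal M=[s_0,\infty)_s\times\mathbb{R}_t\times\mathbb{S}^2$ (it extends smoothly across the axis $\sin\theta=0$). Fix $s_0\in\mathbb{R}$ and a compact set $P\subset\mathbb{R}^2$ of parameters such that $\Delta_r<0$ for all $r\ge e^{Hs_0}$ and all $(a,m)\in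 P$, so that $\mathcal M$ lies in the cosmological region. Fix a smooth function $\chi:\mathbb{R}_t\times\mathbb{S}^2\to[0,1]$ (independent of $s$) with $\chi=0$ for $t\le-1$ and $\chi=1$ for $t\ge1$. For $(a_1,m_1),(a_2,m_2)\in P$ put $$\widetilde g=(1-\chi)\,g_{\mathcal K_{a_1,m_1}}+\chi\,g_{\mathcal K_{a_2,m_2}}.$$ Cover $\mathbb{S}^2$ by two systems of polar coordinates $(\theta,\phi)$, one about the axis of rotation and one about an axis orthogonal to it, each restricted to $|\theta-\frac{\pi}{2}|<\frac{\pi}{3}$. In each of the resulting charts write $(x^1,x^2,x^3)=(t,\theta,\phi)$; Latin indices refer to $x^1,x^2,x^3$. Then: (0) $\widetilde g$ is a smooth Lorentzian metric of the form $-\widetilde\Phi^2ds^2+\widetilde g_{ij}\,dx^i dx^j$ with $\widetilde\Phi>0$ and $\widetilde g_{ij}$ positive definite. Let $\widetilde{\mathrm{Ric}}$ be the Ricci tensor of $\widetilde g$, and write $\widetilde{\mathrm{Ric}}_{00}=\widetilde{\mathrm{Ric}}(E_0,E_0)$, $\widetilde{\mathrm{Ric}}_0{}^j=\widetilde g^{jk}\,\widetilde{\mathrm{Ric}}(E_0,\partial_k)$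 and $\widetilde{\mathrm{Ric}}_i{}^j=\widetilde g^{jk}\,\widetilde{\mathrm{Ric}}(\partial_i,\partial_k)$, where $E_0=\widetilde\Phi^{-1}\partial_s$. (1) For every multi-index $\alpha$ in the spatial coordinates there is a constant $C_\alpha$, depending only on $\alpha,\Lambda,s_0,P,\chi$, such that for all $(a_1,m_1),(a_2,m_2)\in P$ and every $\widetilde\varepsilon$ with $|a_1-a_2|+|m_1-m_2|<\widetilde\varepsilon$, in both charts, at all points with $s\ge s_0$ and $|t|<1$, and for all $i,j$, $$\bigl|\partial_x^\alpha(\widetilde{\mathrm{Ric}}_{00}+\Lambda)\bigr|\le C_\alpha\min(e^{-2Hs},\widetilde\varepsilon),\qquad \bigl|\partial_x^\alpha\widetilde{\mathrm{Ric}}_0{}^j\bigr|\le C_\alpha\min(e^{-4Hs},\widetilde\varepsilon),\qquad \bigl|\partial_x^\alpha(\widetilde{\mathrm{Ric}}_i{}^j-\Lambda\delta_i{}^j)\bigr|\le C_\alpha\min(e^{-2Hs},\widetilde\varepsilon).$$ (2) $\widetilde{\mathrm{Ric}}_{00}+\Lambda=\widetilde{\mathrm{Ric}}_0{}^j=\widetilde{\mathrm{Ric}}_i{}^j-\Lambda\delta_i{}^j=0$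 at all points with $s\ge s_0$ and $|t|\ge1$. -/

import Mathlib

open scoped ContDiff Manifold

noncomputable section

namespace KerrDeSitter

/-- The expansion rate `H = √(Λ/3)`. -/
def hubble (Λ : ℝ) : ℝ := Real.sqrt (Λ / 3)

/-- `Δ_r = (r² + a²)(1 - Λ r²/3) - 2 m r`. -/
def deltaR (Λ a m r : ℝ) : ℝ := (r ^ 2 + a ^ 2) * (1 - Λ / 3 * r ^ 2) - 2 * m * r

/-- `Δ_θ = 1 + (Λ/3) a² cos²θ`, as a function of `c = cos θ`. -/
def deltaTheta (Λ a c : ℝ) : ℝ := 1 + Λ / 3 * a ^ 2 * c ^ 2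

/-- `Δ_0 = 1 + (Λ/3) a²`. -/
def deltaZero (Λ a : ℝ) : ℝ := 1 + Λ / 3 * a ^ 2

/-- `ρ² = r² + a² cos²θ`, as a function of `r` and `c = cos θ`. -/
def rhoSq (a r c : ℝ) : ℝ := r ^ 2 + a ^ 2 * c ^ 2

/-! ### Charts of the space-time `ℝ × (ℝ × 𝕊²)` -/

/-- The round unit sphere `𝕊²`. -/
abbrev Sphere2 : Type := Metric.sphere (0 : EuclideanSpace ℝ (Fin 3)) 1

instance factFinrankThree : Fact (Module.finrank ℝ (EuclideanSpace ℝ (Fin 3)) = 2 + 1) :=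
  ⟨by simp⟩

/-- Coordinates `y = (s, t, θ, φ)` on a chart; index `0` is the time `s`. -/
abbrev Coord : Type := Fin 4 → ℝ

/-- The point of `𝕊²` with polar coordinates `(θ, φ)`. For `b = false` the polar axis is the
third coordinate axis (the axis of rotation of Kerr-de Sitter), for `b = true` it is the first
coordinate axis; the two charts differ by a cyclic permutation of the axes of `ℝ³`. -/
def polarPoint (b : Bool) (θ φ : ℝ) : EuclideanSpace ℝ (Fin 3) :=
  if b then
    !₂[Real.cos θ, Real.sin θ * Real.cos φ, Real.sin θ * Real.sin φ]
  else
    !₂[Real.sin θ * Real.cos φ, Real.sin θ * Real.sin φ, Real.cos θ]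

theorem polarPoint_mem (b : Bool) (θ φ : ℝ) :
    polarPoint b θ φ ∈ Metric.sphere (0 : EuclideanSpace ℝ (Fin 3)) 1 := by
  have h1 := Real.sin_sq_add_cos_sq θ
  have h2 := Real.sin_sq_add_cos_sq φ
  rw [mem_sphere_zero_iff_norm, EuclideanSpace.norm_eq, Real.sqrt_eq_one]
  cases b <;> simp [polarPoint, Fin.sum_univ_three] <;>
    linear_combination h1 + Real.sin θ ^ 2 * h2

/-- Polar coordinates as a map into the sphere. -/
def polar (b : Bool) (θ φ : ℝ) : Sphere2 := ⟨polarPoint b θ φ, polarPoint_mem b θ φ⟩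

/-- The domain of each of the two charts over `s ≥ s₀`: the polar coordinates are restricted to
`|θ - π/2| < π/3`, away from the coordinate poles; `φ` is read modulo `2π`. The two charts
together cover `[s₀, ∞) × ℝ × 𝕊²`. -/
def chartDomain (s₀ : ℝ) : Set Coord :=
  {y | s₀ ≤ y 0 ∧ |y 2 - Real.pi / 2| < Real.pi / 3}

/-- The coordinate partial derivative `∂_μ f`. -/
def pd (μ : Fin 4) (f : Coord → ℝ) : Coord → ℝ :=
  fun y => fderiv ℝ f y (Pi.single μ 1)

/-- The spatial derivative `∂_x^α = ∂_1^{α₁} ∂_2^{α₂} ∂_3^{α₃}`, with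
`(x¹, x², x³) = (t, θ, φ)`. -/
def spatialD (α : Fin 3 → ℕ) (f : Coord → ℝ) : Coord → ℝ :=
  (pd 1)^[α 0] ((pd 2)^[α 1] ((pd 3)^[α 2] f))

/-! ### Kerr-de Sitter metrics -/

/-- `r = e^{Hs}` as a function of the coordinates. -/
def radius (Λ : ℝ) : Coord → ℝ := fun y => Real.exp (hubble Λ * y 0)

/-- The components `ω₁, ω₂, ω₃` of the point of `𝕊² ⊂ ℝ³` as functions of the coordinates. -/
def omega (b : Bool) (k : Fin 3) : Coord → ℝ := fun y => polarPoint b (y 2) (y 3) k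

/-- The component along `∂_μ` of the one-form `dt`. -/
def dt (μ : Fin 4) : ℝ := if μ = 1 then 1 else 0

/-- The component along `∂_μ` of the smooth one-form `ω₁ dω₂ - ω₂ dω₁` on `𝕊²`, which in the
Boyer-Lindquist angles is `sin²θ dφ`. -/
def eta (b : Bool) (μ : Fin 4) (y : Coord) : ℝ :=
  omega b 0 y * pd μ (omega b 1) y - omega b 1 y * pd μ (omega b 0) y

/-- The components of the round metric `|dω|²` of `𝕊²` (in the Boyer-Lindquist angles:
`dθ² + sin²θ dφ²`). -/
def roundMetric (b : Bool) (μ ν : Fin 4) (y : Coord) : ℝ :=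
  ∑ k : Fin 3, pd μ (omega b k) y * pd ν (omega b k) y

/-- The coefficient `sin⁻²θ (Δ_θ (r² + a²)² / (ρ² Δ_0²) - ρ² / Δ_θ)`, with the factor `sin²θ`
cancelled, so that it is smooth across the axis of rotation. -/
def axisCoeff (Λ a r c : ℝ) : ℝ :=
  a ^ 2 * (1 - Λ / 3 * r ^ 2) *
      (deltaTheta Λ a c * (r ^ 2 + a ^ 2) + rhoSq a r c * deltaZero Λ a) /
    (rhoSq a r c * deltaZero Λ a ^ 2 * deltaTheta Λ a c)

/-- The components in the chart `b` of the Kerr-de Sitter metric with parameters `(a, m)`, as a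
tensor on all of `ℝ × ℝ × 𝕊²`, including the axis, with `r = e^{Hs}` and `cos θ = ω₃`, where `θ`
is the Boyer-Lindquist angle. It is the Boyer-Lindquist expression, rewritten through
`dt`, `sin²θ dφ` and the round metric; see `kerrDeSitter_eq_boyerLindquist`. -/
def kerrDeSitter (Λ a m : ℝ) (b : Bool) (y : Coord) : Matrix (Fin 4) (Fin 4) ℝ :=
  Matrix.of fun μ ν =>
    let r := radius Λ y
    let c := omega b 2 y
    let ρ2 := rhoSq a r c
    ρ2 / deltaR Λ a m r * (pd μ (radius Λ) y * pd ν (radius Λ) y)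
      + ρ2 / deltaTheta Λ a c * roundMetric b μ ν y
      + axisCoeff Λ a r c * (eta b μ y * eta b ν y)
      + deltaTheta Λ a c / ρ2 *
          (a ^ 2 * (1 - c ^ 2) * (dt μ * dt ν)
            - a * (r ^ 2 + a ^ 2) / deltaZero Λ a * (dt μ * eta b ν y + eta b μ y * dt ν))
      - deltaR Λ a m r / ρ2 *
          ((dt μ - a / deltaZero Λ a * eta b μ y) * (dt ν - a / deltaZero Λ a * eta b ν y))

/-- The components of the Kerr-de Sitter metric in Boyer-Lindquist coordinates, with
`r = e^{Hs}`:
`ρ²/Δ_r dr² + ρ²/Δ_θ dθ² + sin²θ (Δ_θ/ρ²) (a dt - (r²+a²)/Δ_0 dφ)²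
  - (Δ_r/ρ²) (dt - a sin²θ/Δ_0 dφ)²`. -/
def boyerLindquist (Λ a m : ℝ) (y : Coord) : Matrix (Fin 4) (Fin 4) ℝ :=
  Matrix.of fun μ ν =>
    let r := Real.exp (hubble Λ * y 0)
    let θ := y 2
    let ρ2 := rhoSq a r (Real.cos θ)
    let Δθ := deltaTheta Λ a (Real.cos θ)
    let dr : Fin 4 → ℝ := ![hubble Λ * r, 0, 0, 0]
    let dθ : Fin 4 → ℝ := ![0, 0, 1, 0]
    let u : Fin 4 → ℝ := ![0, a, 0, -((r ^ 2 + a ^ 2) / deltaZero Λ a)]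
    let v : Fin 4 → ℝ := ![0, 1, 0, -(a * Real.sin θ ^ 2 / deltaZero Λ a)]
    ρ2 / deltaR Λ a m r * (dr μ * dr ν) + ρ2 / Δθ * (dθ μ * dθ ν)
      + Real.sin θ ^ 2 * (Δθ / ρ2) * (u μ * u ν) - deltaR Λ a m r / ρ2 * (v μ * v ν)

/-! ### The partition of Kerr-de Sitter -/

/-- The reference metric `(1 - χ) g_{a₁,m₁} + χ g_{a₂,m₂}` in the chart `b`, where
`p₁ = (a₁, m₁)` and `p₂ = (a₂, m₂)`. -/
def partitionMetric (Λ : ℝ) (p₁ p₂ : ℝ × ℝ) (χ : ℝ × Sphere2 → ℝ) (b : Bool) (y : Coord) :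
    Matrix (Fin 4) (Fin 4) ℝ :=
  (1 - χ (y 1, polar b (y 2) (y 3))) • kerrDeSitter Λ p₁.1 p₁.2 b y
    + χ (y 1, polar b (y 2) (y 3)) • kerrDeSitter Λ p₂.1 p₂.2 b y

/-! ### Curvature in coordinates -/

/-- The Christoffel symbols `Γ^κ_{μν} = ½ g^{κλ} (∂_μ g_{νλ} + ∂_ν g_{μλ} - ∂_λ g_{μν})`. -/
def christoffel (g : Coord → Matrix (Fin 4) (Fin 4) ℝ) (κ μ ν : Fin 4) (y : Coord) : ℝ :=
  1 / 2 * ∑ l : Fin 4, (g y)⁻¹ κ l *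
    (pd μ (fun z => g z ν l) y + pd ν (fun z => g z μ l) y - pd l (fun z => g z μ ν) y)

/-- The Ricci curvature
`Ric_{μν} = ∂_κ Γ^κ_{νμ} - ∂_ν Γ^κ_{κμ} + Γ^κ_{κλ} Γ^λ_{νμ} - Γ^κ_{νλ} Γ^λ_{κμ}`. -/
def ricci (g : Coord → Matrix (Fin 4) (Fin 4) ℝ) (μ ν : Fin 4) (y : Coord) : ℝ :=
  (∑ κ : Fin 4, (pd κ (christoffel g κ ν μ) y - pd ν (christoffel g κ κ μ) y))
    + ∑ κ : Fin 4, ∑ l : Fin 4,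
        (christoffel g κ κ l y * christoffel g l ν μ y
          - christoffel g κ ν l y * christoffel g l κ μ y)

/-- The lapse `Φ`, for a metric of the form `-Φ² ds² + g_{ij} dxⁱ dxʲ`. -/
def lapse (g : Coord → Matrix (Fin 4) (Fin 4) ℝ) (y : Coord) : ℝ := Real.sqrt (-(g y 0 0))

/-- The induced metric `g_{ij}` on the level sets of `s`. -/
def spatial (g : Coord → Matrix (Fin 4) (Fin 4) ℝ) (y : Coord) : Matrix (Fin 3) (Fin 3) ℝ :=
  (g y).submatrix Fin.succ Fin.succ

/-- `Ric_{00} + Λ`, in the frame with `E_0 = Φ⁻¹ ∂_s`. -/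
def err00 (Λ : ℝ) (g : Coord → Matrix (Fin 4) (Fin 4) ℝ) (y : Coord) : ℝ :=
  ricci g 0 0 y / lapse g y ^ 2 + Λ

/-- `Ric_0^j = g^{jk} Ric(E_0, ∂_k)`, in the frame with `E_0 = Φ⁻¹ ∂_s`. -/
def err0 (g : Coord → Matrix (Fin 4) (Fin 4) ℝ) (j : Fin 3) (y : Coord) : ℝ :=
  ∑ k : Fin 3, (spatial g y)⁻¹ j k * (ricci g 0 k.succ y / lapse g y)

/-- `Ric_i^j - Λ δ_i^j`. -/
def errSpatial (Λ : ℝ) (g : Coord → Matrix (Fin 4) (Fin 4) ℝ) (i j : Fin 3) (y : Coord) : ℝ :=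
  (∑ k : Fin 3, (spatial g y)⁻¹ j k * ricci g i.succ k.succ y) - if i = j then Λ else 0

/-! ### Agreement with the Boyer-Lindquist form -/

theorem pd_radius (Λ : ℝ) (μ : Fin 4) (y : Coord) :
    pd μ (radius Λ) y = (![hubble Λ * Real.exp (hubble Λ * y 0), 0, 0, 0] : Fin 4 → ℝ) μ := by
  have h : HasFDerivAt (radius Λ) (Real.exp (hubble Λ * y 0) •
      (hubble Λ • (ContinuousLinearMap.proj 0 : Coord →L[ℝ] ℝ))) y :=
    (((ContinuousLinearMap.proj 0 : Coord →L[ℝ] ℝ).hasFDerivAt).const_mul (hubble Λ)).exp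
  rw [pd, h.fderiv]
  fin_cases μ <;> (simp; try ring)

theorem pd_omega_zero (μ : Fin 4) (y : Coord) :
    pd μ (omega false 0) y = (![0, 0, Real.cos (y 2) * Real.cos (y 3),
      -(Real.sin (y 2) * Real.sin (y 3))] : Fin 4 → ℝ) μ := by
  have h2 := (ContinuousLinearMap.proj 2 : Coord →L[ℝ] ℝ).hasFDerivAt (x := y)
  have h3 := (ContinuousLinearMap.proj 3 : Coord →L[ℝ] ℝ).hasFDerivAt (x := y)
  have h : HasFDerivAt (omega false 0) _ y := h2.sin.mul h3.cos
  rw [pd, h.fderiv]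
  fin_cases μ <;> (simp; try ring)

theorem pd_omega_one (μ : Fin 4) (y : Coord) :
    pd μ (omega false 1) y = (![0, 0, Real.cos (y 2) * Real.sin (y 3),
      Real.sin (y 2) * Real.cos (y 3)] : Fin 4 → ℝ) μ := by
  have h2 := (ContinuousLinearMap.proj 2 : Coord →L[ℝ] ℝ).hasFDerivAt (x := y)
  have h3 := (ContinuousLinearMap.proj 3 : Coord →L[ℝ] ℝ).hasFDerivAt (x := y)
  have h : HasFDerivAt (omega false 1) _ y := h2.sin.mul h3.sin
  rw [pd, h.fderiv]
  fin_cases μ <;> (simp; try ring)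

theorem pd_omega_two (μ : Fin 4) (y : Coord) :
    pd μ (omega false 2) y = (![0, 0, -Real.sin (y 2), 0] : Fin 4 → ℝ) μ := by
  have h2 := (ContinuousLinearMap.proj 2 : Coord →L[ℝ] ℝ).hasFDerivAt (x := y)
  have h : HasFDerivAt (omega false 2) _ y := h2.cos
  rw [pd, h.fderiv]
  fin_cases μ <;> simp

theorem eta_false (μ : Fin 4) (y : Coord) :
    eta false μ y = (![0, 0, 0, Real.sin (y 2) ^ 2] : Fin 4 → ℝ) μ := by
  have h := Real.sin_sq_add_cos_sq (y 3)
  rw [eta, pd_omega_zero, pd_omega_one]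
  fin_cases μ <;> simp [omega, polarPoint]
  · ring
  · linear_combination Real.sin (y 2) ^ 2 * h

theorem roundMetric_false (μ ν : Fin 4) (y : Coord) :
    roundMetric false μ ν y = (![0, 0, 1, 0] : Fin 4 → ℝ) μ * (![0, 0, 1, 0] : Fin 4 → ℝ) ν
      + Real.sin (y 2) ^ 2 *
        ((![0, 0, 0, 1] : Fin 4 → ℝ) μ * (![0, 0, 0, 1] : Fin 4 → ℝ) ν) := by
  have h := Real.sin_sq_add_cos_sq (y 3)
  have h' := Real.sin_sq_add_cos_sq (y 2)
  rw [roundMetric, Fin.sum_univ_three, pd_omega_zero, pd_omega_one, pd_omega_two, pd_omega_zero,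
    pd_omega_one, pd_omega_two]
  fin_cases μ <;> fin_cases ν <;> simp
  · linear_combination Real.cos (y 2) ^ 2 * h + h'
  · ring
  · ring
  · linear_combination Real.sin (y 2) ^ 2 * h

/-- In the chart whose polar axis is the axis of rotation, `kerrDeSitter` has exactly the
Boyer-Lindquist components. -/
theorem kerrDeSitter_eq_boyerLindquist {Λ : ℝ} (hΛ : 0 < Λ) (a m : ℝ) (y : Coord) :
    kerrDeSitter Λ a m false y = boyerLindquist Λ a m y := by
  have hr : 0 < Real.exp (hubble Λ * y 0) := Real.exp_pos _
  ext μ ν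
  simp only [kerrDeSitter, boyerLindquist, Matrix.of_apply, roundMetric_false, eta_false,
    pd_radius, radius]
  have hω : omega false 2 y = Real.cos (y 2) := by simp [omega, polarPoint]
  rw [hω]
  set r := Real.exp (hubble Λ * y 0)
  have hs : Real.sin (y 2) ^ 2 = 1 - Real.cos (y 2) ^ 2 := Real.sin_sq _
  rw [hs]
  set c := Real.cos (y 2)
  have h1 : rhoSq a r c ≠ 0 := by unfold rhoSq; positivity
  have h2 : deltaTheta Λ a c ≠ 0 := by unfold deltaTheta; positivity
  have h3 : deltaZero Λ a ≠ 0 := by unfold deltaZero; positivity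
  have key : ∀ x : ℝ, rhoSq a r c / deltaTheta Λ a c * x + axisCoeff Λ a r c * (x * x)
      = (deltaTheta Λ a c * (r ^ 2 + a ^ 2) ^ 2 / (rhoSq a r c * deltaZero Λ a ^ 2)) * x
        + axisCoeff Λ a r c * (x * (x - (1 - c ^ 2))) := by
    intro x
    unfold axisCoeff
    field_simp
    unfold rhoSq deltaTheta deltaZero
    ring
  generalize deltaR Λ a m r = Δ
  have k3 := key (1 - c ^ 2)
  rw [sub_self, mul_zero, mul_zero, add_zero] at k3
  fin_cases μ <;> fin_cases ν <;> simp [dt]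
  · field_simp
  · field_simp
  · field_simp
  · rw [k3]
    field_simp

end KerrDeSitter

end

/-!
Write `x = e^{-Hs}` for the inverse radius. In the coordinates `(s, t, θ, φ)` a Kerr-de Sitter metric
has the form `-Φ² ds² + x⁻² h_{ij} dxⁱ dxʲ`, where `Φ` and `h` are smooth functions of the parameters
`(a, m)`, of `x²` and `x³`, and of the point of the sphere, down to `x = 0`
(`kerrDeSitter_eq_conformalMetric`). By compactness of the parameter set, `Φ` and `h` are
nondegenerate uniformly in all of these (`exists_cosmological_margin`, `spatialProfile_coercive`),
and the interpolated metric inherits this form.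

The error terms are components of `E = Ric - Λ g`, raised with the spatial metric and normalized by
the lapse (`UniformSplit.errors`). To estimate `E`, the interpolated metric is compared with two
others for which `E` is known.

* The Kerr-de Sitter metric with the first pair of parameters has `E = 0`, and differs from the
  interpolation by `O(|a₁ - a₂| + |m₁ - m₂|)`.
* The asymptotic model `-ds² + x⁻² h|_{x = 0}` differs from the interpolation by relative order `x²`.
  For the model `E_{00}` and `E_{0i}` vanish, and `E_{ij}` is the Ricci tensor of the `s`-independent
  metric `h|_{x = 0}`, which is smaller than `g_{ij}` by the factor `x²`
  (`einstein_asymptoticModel`).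

The comparison itself is bookkeeping with weights. An `ExpSymbol` is a family of functions all of
whose coordinate derivatives are bounded by a fixed weight `e^{-kHs} δ`; such families are closed
under sums, products, derivatives and inverses, and so are pairs of families whose difference gains a
further factor `e^{-dHs} δ` (`ExpClose`). Since the Ricci tensor is built from the metric by these
operations, and the weights of metric, inverse metric and Christoffel symbols are compatible, the
difference of the tensors `E` gains the same factor as the difference of the metrics
(`CloseMetrics.einstein`). The gain of `e^{-4Hs}` in `Ric_0^j` consists of `x²` from `E` and `x²` from
the inverse spatial metric.

That Kerr-de Sitter is Einstein (`einstein_kerrDeSitter`) is verified off the axis of rotation by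
Cartan's structure equations in the Carter coframe, where the metric is diagonal
(`CartanFrame.ricci_eq`, `carter_einstein`); on the axis it follows by continuity. Continuity also
gives the vanishing of the errors for `|t| = 1`; for `|t| > 1` the interpolation is locally one of
the two Kerr-de Sitter metrics.
-/

noncomputable section

namespace KerrDeSitter

/-! ### Coordinate derivatives -/

section Calculus

variable {V : Set Coord} {f g : Coord → ℝ} {y : Coord}

theorem ContDiffOn.pd (hV : IsOpen V) (hf : ContDiffOn ℝ ∞ f V) (μ : Fin 4) :
    ContDiffOn ℝ ∞ (pd μ f) V :=
  (hf.fderiv_of_isOpen hV (by simp)).clm_apply contDiffOn_const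

theorem diffAt (hV : IsOpen V) (hf : ContDiffOn ℝ ∞ f V) (hy : y ∈ V) :
    DifferentiableAt ℝ f y :=
  (hf.contDiffAt (hV.mem_nhds hy)).differentiableAt (by simp)

theorem pd_eqOn (hV : IsOpen V) (h : Set.EqOn f g V) (μ : Fin 4) :
    Set.EqOn (pd μ f) (pd μ g) V := fun y hy => by
  rw [pd, pd, (Filter.eventuallyEq_of_mem (hV.mem_nhds hy) h).fderiv_eq]

theorem pd_add (hf : DifferentiableAt ℝ f y) (hg : DifferentiableAt ℝ g y) (μ : Fin 4) :
    pd μ (fun z => f z + g z) y = pd μ f y + pd μ g y := by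
  simp [pd, fderiv_fun_add hf hg]

theorem pd_sub (hf : DifferentiableAt ℝ f y) (hg : DifferentiableAt ℝ g y) (μ : Fin 4) :
    pd μ (fun z => f z - g z) y = pd μ f y - pd μ g y := by
  simp [pd, fderiv_fun_sub hf hg]

theorem pd_mul (hf : DifferentiableAt ℝ f y) (hg : DifferentiableAt ℝ g y) (μ : Fin 4) :
    pd μ (fun z => f z * g z) y = pd μ f y * g y + f y * pd μ g y := by
  simp [pd, fderiv_fun_mul hf hg]
  ring

theorem pd_const (c : ℝ) (μ : Fin 4) : pd μ (fun _ => c) y = 0 := by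
  simp [pd]

theorem pd_sum {ι : Type*} {s : Finset ι} {F : ι → Coord → ℝ}
    (hF : ∀ i ∈ s, DifferentiableAt ℝ (F i) y) (μ : Fin 4) :
    pd μ (fun z => ∑ i ∈ s, F i z) y = ∑ i ∈ s, pd μ (F i) y := by
  simp [pd, fderiv_fun_sum hF]

theorem pd_comm (hV : IsOpen V) (hf : ContDiffOn ℝ ∞ f V) (hy : y ∈ V) (μ ν : Fin 4) :
    pd μ (pd ν f) y = pd ν (pd μ f) y := by
  have hc := hf.contDiffAt (hV.mem_nhds hy)
  have h2 : DifferentiableAt ℝ (fderiv ℝ f) y :=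
    (hc.fderiv_right (m := ∞) (by simp)).differentiableAt (by simp)
  have hs : IsSymmSndFDerivAt ℝ f y := hc.isSymmSndFDerivAt (by
    simpa using WithTop.coe_le_coe.mpr (le_top : (2 : ℕ∞) ≤ ⊤))
  have key : ∀ α β : Fin 4, pd α (pd β f) y
      = fderiv ℝ (fderiv ℝ f) y (Pi.single α 1) (Pi.single β 1) := fun α β => by
    have : pd β f = fun z => fderiv ℝ f z (Pi.single β 1) := rfl
    rw [this, pd, fderiv_clm_apply h2 (by fun_prop)]
    simp
  rw [key, key]
  exact hs _ _

/-- Smoothness of the entries of the inverse of a smooth nonsingular matrix function. -/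
theorem contDiffOn_inv_entry {n : Type*} [Fintype n] [DecidableEq n]
    {M : Coord → Matrix n n ℝ}
    (hM : ∀ i j, ContDiffOn ℝ ∞ (fun z => M z i j) V) (hdet : ∀ z ∈ V, (M z).det ≠ 0) (i j : n) :
    ContDiffOn ℝ ∞ (fun z => (M z)⁻¹ i j) V := by
  have hd : ∀ N : Coord → Matrix n n ℝ, (∀ i j, ContDiffOn ℝ ∞ (fun z => N z i j) V) →
      ContDiffOn ℝ ∞ (fun z => (N z).det) V := fun N hN => by
    simp only [Matrix.det_apply']
    exact ContDiffOn.sum fun σ _ => contDiffOn_const.mul (contDiffOn_prod fun k _ => hN _ _)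
  have : ∀ z, (M z)⁻¹ i j = ((M z).det)⁻¹ * ((M z).updateRow j (Pi.single i 1)).det := fun z => by
    rw [Matrix.inv_def, Matrix.smul_apply, Matrix.adjugate_apply, Ring.inverse_eq_inv, smul_eq_mul]
  simp only [this]
  refine ((hd M hM).inv hdet).mul (hd _ fun k l => ?_)
  by_cases hk : k = j
  · subst hk; simpa using contDiffOn_const
  · simpa [Matrix.updateRow_ne hk] using hM k l

end Calculus

/-! ### Cartan's structure equations -/

/-- A moving coframe `J a = J a μ dx^μ` on the open set `V` in which the metric `g` is diagonal,
`g = ∑ h a (J a)²`, with connection coefficients `A a b c` (so that the connection forms are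
`∑ A a b c (J c)`), and with frame derivatives `DA a b c d` of `A a b c`. The fields are
compatibility with the metric, vanishing of the torsion, and the definition of `DA`. -/
structure CartanFrame (V : Set Coord) (g : Coord → Matrix (Fin 4) (Fin 4) ℝ)
    (J : Fin 4 → Fin 4 → Coord → ℝ) (h : Fin 4 → Coord → ℝ)
    (A : Coord → Fin 4 → Fin 4 → Fin 4 → ℝ) (DA : Coord → Fin 4 → Fin 4 → Fin 4 → Fin 4 → ℝ) :
    Prop where
  isOpen : IsOpen V
  smooth_J : ∀ a μ, ContDiffOn ℝ ∞ (J a μ) V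
  smooth_h : ∀ a, ContDiffOn ℝ ∞ (h a) V
  differentiable_A : ∀ a b c, ∀ y ∈ V, DifferentiableAt ℝ (fun z => A z a b c) y
  det_ne_zero : ∀ y ∈ V, (g y).det ≠ 0
  metric : ∀ y ∈ V, ∀ μ ν, g y μ ν = ∑ a, h a y * (J a μ y * J a ν y)
  pd_h : ∀ y ∈ V, ∀ a μ, pd μ (h a) y = ∑ c, 2 * h a y * A y a a c * J c μ y
  compat : ∀ y ∈ V, ∀ a b c, a ≠ b → h a y * A y a b c + h b y * A y b a c = 0
  torsion : ∀ y ∈ V, ∀ a μ ν, pd μ (J a ν) y - pd ν (J a μ) y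
    = ∑ b, ∑ c, A y a b c * (J c ν y * J b μ y - J c μ y * J b ν y)
  pd_A : ∀ y ∈ V, ∀ a b c μ, pd μ (fun z => A z a b c) y = ∑ d, DA y a b c d * J d μ y

/-- The component `F^a_b(d, e)` of the curvature two-form `dA + A ∧ A` in the coframe. -/
def frameCurvature (A : Fin 4 → Fin 4 → Fin 4 → ℝ) (DA : Fin 4 → Fin 4 → Fin 4 → Fin 4 → ℝ)
    (a b d e : Fin 4) : ℝ :=
  DA a b e d - DA a b d e - ∑ c, A a b c * (A c e d - A c d e)
    + ∑ f, (A a f d * A f b e - A a f e * A f b d)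

namespace CartanFrame

variable {V : Set Coord} {g : Coord → Matrix (Fin 4) (Fin 4) ℝ}
  {J : Fin 4 → Fin 4 → Coord → ℝ} {h : Fin 4 → Coord → ℝ}
  {A : Coord → Fin 4 → Fin 4 → Fin 4 → ℝ} {DA : Coord → Fin 4 → Fin 4 → Fin 4 → Fin 4 → ℝ}
  {y : Coord}

/-- The coframe as a matrix. -/
def mat (J : Fin 4 → Fin 4 → Coord → ℝ) (y : Coord) : Matrix (Fin 4) (Fin 4) ℝ :=
  Matrix.of fun a μ => J a μ y

/-- The component along `∂_μ` of the matrix of connection forms. -/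
def conn (A : Coord → Fin 4 → Fin 4 → Fin 4 → ℝ) (J : Fin 4 → Fin 4 → Coord → ℝ) (μ : Fin 4)
    (y : Coord) : Matrix (Fin 4) (Fin 4) ℝ :=
  Matrix.of fun a b => ∑ c, A y a b c * J c μ y

/-- The dual frame. -/
def dual (g : Coord → Matrix (Fin 4) (Fin 4) ℝ) (J : Fin 4 → Fin 4 → Coord → ℝ)
    (h : Fin 4 → Coord → ℝ) (y : Coord) : Matrix (Fin 4) (Fin 4) ℝ :=
  (g y)⁻¹ * (mat J y).transpose * Matrix.diagonal fun a => h a y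

theorem dual_mul_mat (F : CartanFrame V g J h A DA) (hy : y ∈ V) : dual g J h y * mat J y = 1 := by
  have hg : (mat J y).transpose * (Matrix.diagonal fun a => h a y) * mat J y = g y := by
    ext μ ν
    rw [F.metric y hy, Matrix.mul_apply]
    simp only [Matrix.mul_diagonal, mat, Matrix.transpose_apply, Matrix.of_apply]
    exact Finset.sum_congr rfl fun a _ => by ring
  rw [dual, Matrix.mul_assoc, Matrix.mul_assoc, ← Matrix.mul_assoc _ _ (mat J y), hg]
  exact Matrix.nonsing_inv_mul _ (isUnit_iff_ne_zero.mpr (F.det_ne_zero y hy))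

theorem mat_mul_dual (F : CartanFrame V g J h A DA) (hy : y ∈ V) : mat J y * dual g J h y = 1 :=
  mul_eq_one_comm.mp (F.dual_mul_mat hy)

theorem diffAt_J (F : CartanFrame V g J h A DA) (hy : y ∈ V) (a μ : Fin 4) :
    DifferentiableAt ℝ (J a μ) y :=
  diffAt F.isOpen (F.smooth_J a μ) hy

theorem conn_compat (F : CartanFrame V g J h A DA) (hy : y ∈ V) (a b μ : Fin 4) :
    h a y * conn A J μ y a b + h b y * conn A J μ y b a = if a = b then pd μ (h a) y else 0 := by
  simp only [conn, Matrix.of_apply, Finset.mul_sum, ← Finset.sum_add_distrib]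
  split_ifs with hab
  · subst hab
    rw [F.pd_h y hy]
    exact Finset.sum_congr rfl fun c _ => by ring
  · exact Finset.sum_eq_zero fun c _ => by linear_combination J c μ y * F.compat y hy a b c hab

/-- The covariant derivative `S a μ ν` of the coframe before lowering, i.e. `A_μ J + ∂_μ J`. -/
def covJ (A : Coord → Fin 4 → Fin 4 → Fin 4 → ℝ) (J : Fin 4 → Fin 4 → Coord → ℝ) (μ : Fin 4)
    (y : Coord) : Matrix (Fin 4) (Fin 4) ℝ :=
  conn A J μ y * mat J y + Matrix.of fun a ν => pd μ (J a ν) y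

theorem covJ_symm (F : CartanFrame V g J h A DA) (hy : y ∈ V) (a μ ν : Fin 4) :
    covJ A J μ y a ν = covJ A J ν y a μ := by
  have h1 := F.torsion y hy a μ ν
  simp only [covJ, conn, mat, Matrix.add_apply, Matrix.mul_apply, Matrix.of_apply]
  have h2 : ∑ b, ∑ c, A y a b c * (J c ν y * J b μ y - J c μ y * J b ν y)
      = ∑ b, (∑ c, A y a b c * J c ν y) * J b μ y - ∑ b, (∑ c, A y a b c * J c μ y) * J b ν y := by
    simp only [Finset.sum_mul, ← Finset.sum_sub_distrib]
    exact Finset.sum_congr rfl fun b _ => Finset.sum_congr rfl fun c _ => by ring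
  linear_combination h1 + h2

theorem pd_metric (F : CartanFrame V g J h A DA) (hy : y ∈ V) (μ ν l : Fin 4) :
    pd μ (fun z => g z ν l) y
      = ∑ a, h a y * (covJ A J μ y a ν * J a l y + J a ν y * covJ A J μ y a l) := by
  have hJ := F.diffAt_J hy
  have hh := fun a => diffAt F.isOpen (F.smooth_h a) hy
  rw [pd_eqOn F.isOpen (fun z hz => F.metric z hz ν l) μ hy,
    pd_sum (fun a _ => (hh a).fun_mul ((hJ a ν).fun_mul (hJ a l)))]
  have e1 : ∀ a, pd μ (fun z => h a z * (J a ν z * J a l z)) y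
      = pd μ (h a) y * (J a ν y * J a l y)
        + h a y * (pd μ (J a ν) y * J a l y + J a ν y * pd μ (J a l) y) := fun a => by
    rw [pd_mul (hh a) ((hJ a ν).fun_mul (hJ a l)), pd_mul (hJ a ν) (hJ a l)]
  have e2 : ∑ a, pd μ (h a) y * (J a ν y * J a l y)
      = ∑ a, ∑ b, (h a y * conn A J μ y a b + h b y * conn A J μ y b a)
          * (J b ν y * J a l y) := by
    refine Finset.sum_congr rfl fun a _ => ?_
    simp only [F.conn_compat hy, ite_mul, zero_mul, Finset.sum_ite_eq, Finset.mem_univ, if_true]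
  have e3 : ∑ a, ∑ b, h b y * conn A J μ y b a * (J b ν y * J a l y)
      = ∑ a, ∑ b, h a y * conn A J μ y a b * (J a ν y * J b l y) := Finset.sum_comm
  simp only [e1, Finset.sum_add_distrib, e2, add_mul, e3]
  simp only [covJ, mat, Matrix.add_apply, Matrix.mul_apply, Matrix.of_apply, add_mul, mul_add,
    Finset.sum_add_distrib, Finset.sum_mul, Finset.mul_sum]
  have e4 : ∀ f₁ f₂ f₁' f₂' f₃ f₄ : ℝ, f₁ = f₁' → f₂ = f₂' →
      f₁ + f₂ + (f₃ + f₄) = f₁' + f₃ + (f₂' + f₄) := by intros; subst_vars; ring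
  apply e4 <;>
  exact Finset.sum_congr rfl fun a _ => Finset.sum_congr rfl fun b _ => by ring

/-- The Levi-Civita connection of `g` is the one with connection forms `A` in the coframe `J`. -/
theorem mat_mul_christoffel (F : CartanFrame V g J h A DA) (hy : y ∈ V) (μ : Fin 4) :
    mat J y * Matrix.of (fun κ ν => christoffel g κ μ ν y) = covJ A J μ y := by
  have hS := F.covJ_symm hy
  have e1 : ∀ ν l, pd μ (fun z => g z ν l) y + pd ν (fun z => g z μ l) y
      - pd l (fun z => g z μ ν) y = 2 * ∑ a, J a l y * (h a y * covJ A J μ y a ν) := fun ν l => by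
    simp only [F.pd_metric hy, ← Finset.sum_add_distrib, ← Finset.sum_sub_distrib, Finset.mul_sum]
    refine Finset.sum_congr rfl fun a _ => ?_
    rw [hS a ν μ, hS a l μ, hS a l ν]
    ring
  have e2 : Matrix.of (fun κ ν => christoffel g κ μ ν y) = dual g J h y * covJ A J μ y := by
    ext κ ν
    rw [Matrix.of_apply, christoffel]
    simp only [e1]
    rw [dual, Matrix.mul_assoc, Matrix.mul_assoc, Matrix.mul_apply, Finset.mul_sum]
    refine Finset.sum_congr rfl fun l _ => ?_
    rw [Matrix.mul_apply]
    simp only [Matrix.diagonal_mul, Matrix.transpose_apply, mat, Matrix.of_apply]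
    ring
  rw [e2, ← Matrix.mul_assoc, F.mat_mul_dual hy, Matrix.one_mul]

theorem smooth_g (F : CartanFrame V g J h A DA) (μ ν : Fin 4) :
    ContDiffOn ℝ ∞ (fun z => g z μ ν) V :=
  (ContDiffOn.sum fun a _ => (F.smooth_h a).mul ((F.smooth_J a μ).mul (F.smooth_J a ν))).congr
    fun z hz => F.metric z hz μ ν

theorem contDiffOn_christoffel (F : CartanFrame V g J h A DA) (κ μ ν : Fin 4) :
    ContDiffOn ℝ ∞ (christoffel g κ μ ν) V :=
  contDiffOn_const.mul <| ContDiffOn.sum fun _ _ =>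
    (contDiffOn_inv_entry F.smooth_g F.det_ne_zero _ _).mul <|
      ((ContDiffOn.pd F.isOpen (F.smooth_g _ _) _).add
        (ContDiffOn.pd F.isOpen (F.smooth_g _ _) _)).sub
        (ContDiffOn.pd F.isOpen (F.smooth_g _ _) _)

/-- `∂_κ` of the connection form along `∂_ν`. -/
theorem pd_conn (F : CartanFrame V g J h A DA) (hy : y ∈ V) (κ ν a b : Fin 4) :
    pd κ (fun z => conn A J ν z a b) y
      = ∑ c, ((∑ d, DA y a b c d * J d κ y) * J c ν y + A y a b c * pd κ (J c ν) y) := by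
  have hA := fun c => F.differentiable_A a b c y hy
  have hJ := fun c => F.diffAt_J hy c ν
  change pd κ (fun z => ∑ c, A z a b c * J c ν z) y = _
  rw [pd_sum (fun c _ => (hA c).fun_mul (hJ c))]
  refine Finset.sum_congr rfl fun c _ => ?_
  rw [pd_mul (hA c) (hJ c), F.pd_A y hy]

/-- The derivative of `mat_mul_christoffel`. -/
theorem pd_mat_mul_christoffel (F : CartanFrame V g J h A DA) (hy : y ∈ V) (κ ν : Fin 4) :
    Matrix.of (fun a μ => pd κ (J a μ) y) * Matrix.of (fun ρ μ => christoffel g ρ ν μ y)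
      + mat J y * Matrix.of (fun ρ μ => pd κ (christoffel g ρ ν μ) y)
      = Matrix.of (fun a b => pd κ (fun z => conn A J ν z a b) y) * mat J y
        + conn A J ν y * Matrix.of (fun a μ => pd κ (J a μ) y)
        + Matrix.of (fun a μ => pd κ (pd ν (J a μ)) y) := by
  have hJ := F.diffAt_J hy
  have hΓ := fun ρ μ => diffAt F.isOpen (F.contDiffOn_christoffel ρ ν μ) hy
  have hc : ∀ a b, DifferentiableAt ℝ (fun z => conn A J ν z a b) y := fun a b => by
    change DifferentiableAt ℝ (fun z => ∑ c, A z a b c * J c ν z) y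
    exact DifferentiableAt.fun_sum fun c _ => (F.differentiable_A a b c y hy).fun_mul (hJ c ν)
  have hdJ := fun a μ => diffAt F.isOpen (ContDiffOn.pd F.isOpen (F.smooth_J a μ) ν) hy
  ext a μ
  have hE : Set.EqOn (fun z => ∑ ρ, J a ρ z * christoffel g ρ ν μ z)
      (fun z => (∑ b, conn A J ν z a b * J b μ z) + pd ν (J a μ) z) V := fun z hz => by
    have := congrFun (congrFun (F.mat_mul_christoffel hz ν) a) μ
    simpa [covJ, Matrix.mul_apply, mat] using this
  have hE' := pd_eqOn F.isOpen hE κ hy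
  rw [pd_sum (fun ρ _ => (hJ a ρ).fun_mul (hΓ ρ μ)),
    pd_add (DifferentiableAt.fun_sum fun b _ => (hc a b).fun_mul (hJ b μ)) (hdJ a μ),
    pd_sum (fun b _ => (hc a b).fun_mul (hJ b μ))] at hE'
  simp only [fun ρ => pd_mul (hJ a ρ) (hΓ ρ μ) κ, fun b => pd_mul (hc a b) (hJ b μ) κ,
    Finset.sum_add_distrib] at hE'
  simpa only [Matrix.add_apply, Matrix.mul_apply, Matrix.of_apply, mat] using hE'

/-- The coordinate components of the curvature form. -/
theorem curvature_eq (F : CartanFrame V g J h A DA) (hy : y ∈ V) (κ ν a b : Fin 4) :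
    pd κ (fun z => conn A J ν z a b) y - pd ν (fun z => conn A J κ z a b) y
      + (conn A J κ y * conn A J ν y - conn A J ν y * conn A J κ y) a b
      = ∑ d, ∑ e, frameCurvature (A y) (DA y) a b d e * (J d κ y * J e ν y) := by
  have e1 : pd κ (fun z => conn A J ν z a b) y - pd ν (fun z => conn A J κ z a b) y
      = (∑ d, ∑ e, (DA y a b e d - DA y a b d e) * (J d κ y * J e ν y))
        + ∑ c, A y a b c * (pd κ (J c ν) y - pd ν (J c κ) y) := by
    rw [F.pd_conn hy, F.pd_conn hy]
    have : ∑ d, ∑ e, DA y a b e d * (J d κ y * J e ν y)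
        = ∑ e, ∑ d, DA y a b e d * (J d κ y * J e ν y) := Finset.sum_comm
    simp only [sub_mul, Finset.sum_sub_distrib, mul_sub, Finset.sum_add_distrib, Finset.sum_mul,
      this]
    have : ∀ p q p' q' s t : ℝ, p = p' → q = q' → p + s - (q + t) = p' - q' + (s - t) := by
      intros; subst_vars; ring
    apply this <;>
    exact Finset.sum_congr rfl fun c _ => Finset.sum_congr rfl fun d _ => by ring
  have e2 : ∑ c, A y a b c * (pd κ (J c ν) y - pd ν (J c κ) y)
      = - ∑ d, ∑ e, (∑ c, A y a b c * (A y c e d - A y c d e)) * (J d κ y * J e ν y) := by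
    have e21 : ∀ c, pd κ (J c ν) y - pd ν (J c κ) y
        = ∑ d, ∑ e, (A y c d e - A y c e d) * (J d κ y * J e ν y) := fun c => by
      rw [F.torsion y hy]
      have : ∑ d, ∑ e, A y c d e * (J e κ y * J d ν y)
        = ∑ e, ∑ d, A y c d e * (J e κ y * J d ν y) := Finset.sum_comm
      simp only [mul_sub, sub_mul, Finset.sum_sub_distrib, this]
      congr 1
      exact Finset.sum_congr rfl fun c _ => Finset.sum_congr rfl fun d _ => by ring
    simp only [e21, Finset.sum_mul, ← Finset.sum_neg_distrib, Finset.mul_sum]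
    rw [Finset.sum_comm]
    refine Finset.sum_congr rfl fun d _ => ?_
    rw [Finset.sum_comm]
    exact Finset.sum_congr rfl fun e _ => Finset.sum_congr rfl fun c _ => by ring
  have e3 : (conn A J κ y * conn A J ν y - conn A J ν y * conn A J κ y) a b
      = ∑ d, ∑ e, (∑ f, (A y a f d * A y f b e - A y a f e * A y f b d))
          * (J d κ y * J e ν y) := by
    simp only [Matrix.sub_apply, Matrix.mul_apply, conn, Matrix.of_apply, Finset.sum_mul,
      Finset.mul_sum]
    have : ∑ d, ∑ e, ∑ f, (A y a f d * A y f b e - A y a f e * A y f b d) * (J d κ y * J e ν y)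
        = ∑ f, ∑ d, ∑ e, (A y a f d * A y f b e - A y a f e * A y f b d)
            * (J d κ y * J e ν y) :=
      (Finset.sum_congr rfl fun d _ => Finset.sum_comm).trans Finset.sum_comm
    rw [this, ← Finset.sum_sub_distrib]
    refine Finset.sum_congr rfl fun f _ => ?_
    have : ∑ e, ∑ d, A y a f d * J d κ y * (A y f b e * J e ν y)
        = ∑ d, ∑ e, A y a f d * J d κ y * (A y f b e * J e ν y) := Finset.sum_comm
    rw [this, ← Finset.sum_sub_distrib]
    refine Finset.sum_congr rfl fun d _ => ?_
    rw [← Finset.sum_sub_distrib]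
    exact Finset.sum_congr rfl fun e _ => by ring
  rw [e1, e2, e3, ← sub_eq_add_neg]
  simp only [← Finset.sum_sub_distrib, ← Finset.sum_add_distrib, ← sub_mul, ← add_mul]
  rfl

/-- The Ricci tensor from Cartan's second structure equation. -/
theorem ricci_eq (F : CartanFrame V g J h A DA) (hy : y ∈ V) (μ ν : Fin 4) :
    ricci g μ ν y = ∑ b, ∑ e,
      (∑ a, frameCurvature (A y) (DA y) a b a e) * (J b μ y * J e ν y) := by
  set Γ : Fin 4 → Matrix (Fin 4) (Fin 4) ℝ := fun ν =>
    Matrix.of fun ρ μ => christoffel g ρ ν μ y with hΓ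
  set dΓ : Fin 4 → Fin 4 → Matrix (Fin 4) (Fin 4) ℝ := fun κ ν =>
    Matrix.of fun ρ μ => pd κ (christoffel g ρ ν μ) y with hdΓ
  set R : Fin 4 → Matrix (Fin 4) (Fin 4) ℝ := fun κ =>
    dΓ κ ν - dΓ ν κ + Γ κ * Γ ν - Γ ν * Γ κ with hR
  set dA : Fin 4 → Fin 4 → Matrix (Fin 4) (Fin 4) ℝ := fun κ ν =>
    Matrix.of fun a b => pd κ (fun z => conn A J ν z a b) y with hdA
  set C : Fin 4 → Matrix (Fin 4) (Fin 4) ℝ := fun κ =>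
    dA κ ν - dA ν κ + (conn A J κ y * conn A J ν y - conn A J ν y * conn A J κ y) with hC
  have h1 : ricci g μ ν y = ∑ κ, R κ κ μ := by
    simp only [ricci, hR, hΓ, hdΓ, Matrix.sub_apply, Matrix.add_apply, Matrix.mul_apply,
      Matrix.of_apply, Finset.sum_sub_distrib, Finset.sum_add_distrib]
    ring
  have h2 : ∀ κ, mat J y * R κ = C κ * mat J y := fun κ => by
    have a1 := F.pd_mat_mul_christoffel hy κ ν
    have a2 := F.pd_mat_mul_christoffel hy ν κ
    have b1 := F.mat_mul_christoffel hy κ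
    have b2 := F.mat_mul_christoffel hy ν
    have hdd : Matrix.of (fun a μ => pd κ (pd ν (J a μ)) y)
        = Matrix.of (fun a μ => pd ν (pd κ (J a μ)) y) := by
      ext a μ
      exact pd_comm F.isOpen (F.smooth_J a μ) hy κ ν
    rw [hdd] at a1
    rw [covJ] at b1 b2
    change _ * Γ ν + _ * dΓ κ ν = dA κ ν * _ + _ + _ at a1
    change _ * Γ κ + _ * dΓ ν κ = dA ν κ * _ + _ + _ at a2
    change _ * Γ κ = _ at b1
    change _ * Γ ν = _ at b2
    generalize Matrix.of (fun a μ => pd κ (J a μ) y) = dJκ at *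
    generalize Matrix.of (fun a μ => pd ν (J a μ) y) = dJν at *
    generalize Matrix.of (fun a μ => pd ν (pd κ (J a μ)) y) = ddJ at *
    have c1 := eq_sub_of_add_eq' a1
    have c2 := eq_sub_of_add_eq' a2
    simp only [hR, hC, Matrix.mul_sub, Matrix.mul_add, c1, c2, ← Matrix.mul_assoc, b1, b2,
      Matrix.add_mul, Matrix.sub_mul]
    simp only [Matrix.mul_assoc, b1, b2]
    noncomm_ring
  have h3 : ∀ κ, R κ = dual g J h y * (C κ * mat J y) := fun κ => by
    rw [← h2, ← Matrix.mul_assoc, F.dual_mul_mat hy, Matrix.one_mul]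
  have h4 : ∀ κ a b, C κ a b
      = ∑ d, ∑ e, frameCurvature (A y) (DA y) a b d e * (J d κ y * J e ν y) :=
    fun κ a b => F.curvature_eq hy κ ν a b
  have h5 : ∀ a d, ∑ κ, J d κ y * dual g J h y κ a = if d = a then 1 else 0 := fun a d => by
    have := congrFun (congrFun (F.mat_mul_dual hy) d) a
    simpa [Matrix.mul_apply, mat, Matrix.one_apply] using this
  calc ricci g μ ν y
      = ∑ κ, ∑ a, dual g J h y κ a * ∑ b, (∑ d, ∑ e, frameCurvature (A y) (DA y) a b d e
          * (J d κ y * J e ν y)) * J b μ y := by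
        rw [h1]
        refine Finset.sum_congr rfl fun κ _ => ?_
        rw [h3, Matrix.mul_apply]
        refine Finset.sum_congr rfl fun a _ => ?_
        rw [Matrix.mul_apply]
        simp only [h4]
        rfl
    _ = ∑ a, ∑ b, ∑ d, ∑ e, frameCurvature (A y) (DA y) a b d e * (J e ν y * J b μ y)
          * ∑ κ, J d κ y * dual g J h y κ a := by
        simp only [Finset.mul_sum, Finset.sum_mul]
        rw [Finset.sum_comm]
        refine Finset.sum_congr rfl fun a _ => ?_
        rw [Finset.sum_comm]
        refine Finset.sum_congr rfl fun b _ => ?_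
        rw [Finset.sum_comm]
        refine Finset.sum_congr rfl fun d _ => ?_
        rw [Finset.sum_comm]
        exact Finset.sum_congr rfl fun e _ => Finset.sum_congr rfl fun κ _ => by ring
    _ = ∑ a, ∑ b, ∑ e, frameCurvature (A y) (DA y) a b a e * (J e ν y * J b μ y) := by
        refine Finset.sum_congr rfl fun a _ => Finset.sum_congr rfl fun b _ => ?_
        simp only [h5, mul_ite, mul_one, mul_zero]
        rw [Finset.sum_comm]
        simp
    _ = _ := by
        rw [Finset.sum_comm]
        refine Finset.sum_congr rfl fun b _ => ?_
        rw [Finset.sum_comm]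
        refine Finset.sum_congr rfl fun e _ => ?_
        rw [Finset.sum_mul]
        exact Finset.sum_congr rfl fun a _ => by ring

end CartanFrame

/-! ### The Carter coframe of Kerr-de Sitter -/

/-- The connection coefficients of the metric
`(S/R) dr² + (S/Q) dc² + (Q/S) e₂² - (R/S) e₃²` in the coframe `dr`, `dc`, `e₂`, `e₃`, where
`de₂ = (2r/S) dr ∧ (e₂ - a e₃)` and `de₃ = (2ac/S) dc ∧ (a e₃ - e₂)`, and where `R` is a function
of `r` with derivative `R1` and `Q` is a function of `c` with derivative `Q1`. -/
def carterConn (a r c R R1 Q Q1 S : ℝ) : Fin 4 → Fin 4 → Fin 4 → ℝ :=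
  ![![![r * S⁻¹ - 1/2 * R1 * R⁻¹, a ^ 2 * c * S⁻¹, 0, 0],
      ![a ^ 2 * c * S⁻¹, -(r * R * Q⁻¹ * S⁻¹), 0, 0],
      ![0, 0, -(r * R * Q * S⁻¹ ^ 3), a * r * R * Q * S⁻¹ ^ 3],
      ![0, 0, a * r * R * Q * S⁻¹ ^ 3, -(r * R ^ 2 * S⁻¹ ^ 3) + 1/2 * R * R1 * S⁻¹ ^ 2]],
    ![![-(a ^ 2 * c * Q * R⁻¹ * S⁻¹), r * S⁻¹, 0, 0],
      ![r * S⁻¹, a ^ 2 * c * S⁻¹ - 1/2 * Q1 * Q⁻¹, 0, 0],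
      ![0, 0, a ^ 2 * c * Q ^ 2 * S⁻¹ ^ 3 - 1/2 * Q * Q1 * S⁻¹ ^ 2, -(a * c * R * Q * S⁻¹ ^ 3)],
      ![0, 0, -(a * c * R * Q * S⁻¹ ^ 3), a ^ 2 * c * R * Q * S⁻¹ ^ 3]],
    ![![0, 0, r * S⁻¹, -(a * r * S⁻¹)],
      ![0, 0, -(a ^ 2 * c * S⁻¹) + 1/2 * Q1 * Q⁻¹, a * c * R * Q⁻¹ * S⁻¹],
      ![-(r * S⁻¹), -(a ^ 2 * c * S⁻¹) + 1/2 * Q1 * Q⁻¹, 0, 0],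
      ![a * r * S⁻¹, a * c * R * Q⁻¹ * S⁻¹, 0, 0]],
    ![![0, 0, a * r * Q * R⁻¹ * S⁻¹, -(r * S⁻¹) + 1/2 * R1 * R⁻¹],
      ![0, 0, -(a * c * S⁻¹), a ^ 2 * c * S⁻¹],
      ![a * r * Q * R⁻¹ * S⁻¹, a * c * S⁻¹, 0, 0],
      ![-(r * S⁻¹) + 1/2 * R1 * R⁻¹, -(a ^ 2 * c * S⁻¹), 0, 0]]]

/-- The `r`-derivatives of the coefficients `carterConn`, when `S = r² + a² c²`; here `R2` is the
second derivative of `R`. -/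
def carterConnR (a r c R R1 R2 Q Q1 S : ℝ) : Fin 4 → Fin 4 → Fin 4 → ℝ :=
  ![![![-(2 * r ^ 2 * S⁻¹ ^ 2) + S⁻¹ - 1/2 * R2 * R⁻¹ + 1/2 * R1 ^ 2 * R⁻¹ ^ 2,
        -(2 * a ^ 2 * r * c * S⁻¹ ^ 2), 0, 0],
      ![-(2 * a ^ 2 * r * c * S⁻¹ ^ 2), 2 * r ^ 2 * R * Q⁻¹ * S⁻¹ ^ 2 - r * R1 * Q⁻¹ * S⁻¹
          - R * Q⁻¹ * S⁻¹, 0, 0],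
      ![0, 0, 6 * r ^ 2 * R * Q * S⁻¹ ^ 4 - r * R1 * Q * S⁻¹ ^ 3 - R * Q * S⁻¹ ^ 3,
        -(6 * a * r ^ 2 * R * Q * S⁻¹ ^ 4) + a * r * R1 * Q * S⁻¹ ^ 3 + a * R * Q * S⁻¹ ^ 3],
      ![0, 0, -(6 * a * r ^ 2 * R * Q * S⁻¹ ^ 4) + a * r * R1 * Q * S⁻¹ ^ 3 + a * R * Q * S⁻¹ ^ 3,
        6 * r ^ 2 * R ^ 2 * S⁻¹ ^ 4 - 4 * r * R * R1 * S⁻¹ ^ 3 - R ^ 2 * S⁻¹ ^ 3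
          + 1/2 * R * R2 * S⁻¹ ^ 2 + 1/2 * R1 ^ 2 * S⁻¹ ^ 2]],
    ![![2 * a ^ 2 * r * c * Q * R⁻¹ * S⁻¹ ^ 2 + a ^ 2 * c * R1 * Q * R⁻¹ ^ 2 * S⁻¹,
        -(2 * r ^ 2 * S⁻¹ ^ 2) + S⁻¹, 0, 0],
      ![-(2 * r ^ 2 * S⁻¹ ^ 2) + S⁻¹, -(2 * a ^ 2 * r * c * S⁻¹ ^ 2), 0, 0],
      ![0, 0, -(6 * a ^ 2 * r * c * Q ^ 2 * S⁻¹ ^ 4) + 2 * r * Q * Q1 * S⁻¹ ^ 3,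
        6 * a * r * c * R * Q * S⁻¹ ^ 4 - a * c * R1 * Q * S⁻¹ ^ 3],
      ![0, 0, 6 * a * r * c * R * Q * S⁻¹ ^ 4 - a * c * R1 * Q * S⁻¹ ^ 3,
        -(6 * a ^ 2 * r * c * R * Q * S⁻¹ ^ 4) + a ^ 2 * c * R1 * Q * S⁻¹ ^ 3]],
    ![![0, 0, -(2 * r ^ 2 * S⁻¹ ^ 2) + S⁻¹, 2 * a * r ^ 2 * S⁻¹ ^ 2 - a * S⁻¹],
      ![0, 0, 2 * a ^ 2 * r * c * S⁻¹ ^ 2,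
        -(2 * a * r * c * R * Q⁻¹ * S⁻¹ ^ 2) + a * c * R1 * Q⁻¹ * S⁻¹],
      ![2 * r ^ 2 * S⁻¹ ^ 2 - S⁻¹, 2 * a ^ 2 * r * c * S⁻¹ ^ 2, 0, 0],
      ![-(2 * a * r ^ 2 * S⁻¹ ^ 2) + a * S⁻¹,
        -(2 * a * r * c * R * Q⁻¹ * S⁻¹ ^ 2) + a * c * R1 * Q⁻¹ * S⁻¹, 0, 0]],
    ![![0, 0, -(2 * a * r ^ 2 * Q * R⁻¹ * S⁻¹ ^ 2) - a * r * R1 * Q * R⁻¹ ^ 2 * S⁻¹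
          + a * Q * R⁻¹ * S⁻¹, 2 * r ^ 2 * S⁻¹ ^ 2 - S⁻¹ + 1/2 * R2 * R⁻¹ - 1/2 * R1 ^ 2 * R⁻¹ ^ 2],
      ![0, 0, 2 * a * r * c * S⁻¹ ^ 2, -(2 * a ^ 2 * r * c * S⁻¹ ^ 2)],
      ![-(2 * a * r ^ 2 * Q * R⁻¹ * S⁻¹ ^ 2) - a * r * R1 * Q * R⁻¹ ^ 2 * S⁻¹ + a * Q * R⁻¹ * S⁻¹,
        -(2 * a * r * c * S⁻¹ ^ 2), 0, 0],
      ![2 * r ^ 2 * S⁻¹ ^ 2 - S⁻¹ + 1/2 * R2 * R⁻¹ - 1/2 * R1 ^ 2 * R⁻¹ ^ 2,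
        2 * a ^ 2 * r * c * S⁻¹ ^ 2, 0, 0]]]

/-- The `c`-derivatives of the coefficients `carterConn`, when `S = r² + a² c²`; here `Q2` is the
second derivative of `Q`. -/
def carterConnC (a r c R R1 Q Q1 Q2 S : ℝ) : Fin 4 → Fin 4 → Fin 4 → ℝ :=
  ![![![-(2 * a ^ 2 * r * c * S⁻¹ ^ 2), -(2 * a ^ 4 * c ^ 2 * S⁻¹ ^ 2) + a ^ 2 * S⁻¹, 0, 0],
      ![-(2 * a ^ 4 * c ^ 2 * S⁻¹ ^ 2) + a ^ 2 * S⁻¹,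
        2 * a ^ 2 * r * c * R * Q⁻¹ * S⁻¹ ^ 2 + r * R * Q1 * Q⁻¹ ^ 2 * S⁻¹, 0, 0],
      ![0, 0, 6 * a ^ 2 * r * c * R * Q * S⁻¹ ^ 4 - r * R * Q1 * S⁻¹ ^ 3,
        -(6 * a ^ 3 * r * c * R * Q * S⁻¹ ^ 4) + a * r * R * Q1 * S⁻¹ ^ 3],
      ![0, 0, -(6 * a ^ 3 * r * c * R * Q * S⁻¹ ^ 4) + a * r * R * Q1 * S⁻¹ ^ 3,
        6 * a ^ 2 * r * c * R ^ 2 * S⁻¹ ^ 4 - 2 * a ^ 2 * c * R * R1 * S⁻¹ ^ 3]],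
    ![![2 * a ^ 4 * c ^ 2 * Q * R⁻¹ * S⁻¹ ^ 2 - a ^ 2 * c * Q1 * R⁻¹ * S⁻¹
          - a ^ 2 * Q * R⁻¹ * S⁻¹, -(2 * a ^ 2 * r * c * S⁻¹ ^ 2), 0, 0],
      ![-(2 * a ^ 2 * r * c * S⁻¹ ^ 2), -(2 * a ^ 4 * c ^ 2 * S⁻¹ ^ 2) + a ^ 2 * S⁻¹
          - 1/2 * Q2 * Q⁻¹ + 1/2 * Q1 ^ 2 * Q⁻¹ ^ 2, 0, 0],
      ![0, 0, -(6 * a ^ 4 * c ^ 2 * Q ^ 2 * S⁻¹ ^ 4) + 4 * a ^ 2 * c * Q * Q1 * S⁻¹ ^ 3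
          + a ^ 2 * Q ^ 2 * S⁻¹ ^ 3 - 1/2 * Q * Q2 * S⁻¹ ^ 2 - 1/2 * Q1 ^ 2 * S⁻¹ ^ 2,
        6 * a ^ 3 * c ^ 2 * R * Q * S⁻¹ ^ 4 - a * c * R * Q1 * S⁻¹ ^ 3 - a * R * Q * S⁻¹ ^ 3],
      ![0, 0, 6 * a ^ 3 * c ^ 2 * R * Q * S⁻¹ ^ 4 - a * c * R * Q1 * S⁻¹ ^ 3
          - a * R * Q * S⁻¹ ^ 3, -(6 * a ^ 4 * c ^ 2 * R * Q * S⁻¹ ^ 4)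
          + a ^ 2 * c * R * Q1 * S⁻¹ ^ 3 + a ^ 2 * R * Q * S⁻¹ ^ 3]],
    ![![0, 0, -(2 * a ^ 2 * r * c * S⁻¹ ^ 2), 2 * a ^ 3 * r * c * S⁻¹ ^ 2],
      ![0, 0, 2 * a ^ 4 * c ^ 2 * S⁻¹ ^ 2 - a ^ 2 * S⁻¹ + 1/2 * Q2 * Q⁻¹ - 1/2 * Q1 ^ 2 * Q⁻¹ ^ 2,
        -(2 * a ^ 3 * c ^ 2 * R * Q⁻¹ * S⁻¹ ^ 2) - a * c * R * Q1 * Q⁻¹ ^ 2 * S⁻¹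
          + a * R * Q⁻¹ * S⁻¹],
      ![2 * a ^ 2 * r * c * S⁻¹ ^ 2, 2 * a ^ 4 * c ^ 2 * S⁻¹ ^ 2 - a ^ 2 * S⁻¹ + 1/2 * Q2 * Q⁻¹
          - 1/2 * Q1 ^ 2 * Q⁻¹ ^ 2, 0, 0],
      ![-(2 * a ^ 3 * r * c * S⁻¹ ^ 2), -(2 * a ^ 3 * c ^ 2 * R * Q⁻¹ * S⁻¹ ^ 2)
          - a * c * R * Q1 * Q⁻¹ ^ 2 * S⁻¹ + a * R * Q⁻¹ * S⁻¹, 0, 0]],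
    ![![0, 0, -(2 * a ^ 3 * r * c * Q * R⁻¹ * S⁻¹ ^ 2) + a * r * Q1 * R⁻¹ * S⁻¹,
        2 * a ^ 2 * r * c * S⁻¹ ^ 2],
      ![0, 0, 2 * a ^ 3 * c ^ 2 * S⁻¹ ^ 2 - a * S⁻¹, -(2 * a ^ 4 * c ^ 2 * S⁻¹ ^ 2) + a ^ 2 * S⁻¹],
      ![-(2 * a ^ 3 * r * c * Q * R⁻¹ * S⁻¹ ^ 2) + a * r * Q1 * R⁻¹ * S⁻¹,
        -(2 * a ^ 3 * c ^ 2 * S⁻¹ ^ 2) + a * S⁻¹, 0, 0],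
      ![2 * a ^ 2 * r * c * S⁻¹ ^ 2, 2 * a ^ 4 * c ^ 2 * S⁻¹ ^ 2 - a ^ 2 * S⁻¹, 0, 0]]]

/-- The frame derivatives of `carterConn`. -/
def carterConnD (a r c R R1 R2 Q Q1 Q2 S : ℝ) (i j k : Fin 4) : Fin 4 → ℝ :=
  ![carterConnR a r c R R1 R2 Q Q1 S i j k, carterConnC a r c R R1 Q Q1 Q2 S i j k, 0, 0]

set_option maxHeartbeats 4000000 in
/-- The Einstein equation in the Carter coframe, as an algebraic identity: it holds for the quartic
polynomials `R` and `Q` of Kerr-de Sitter. -/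
theorem carter_einstein {L a m r c R R1 R2 Q Q1 Q2 S : ℝ}
    (hR : R = (r ^ 2 + a ^ 2) * (1 - L * r ^ 2) - 2 * m * r)
    (hR1 : R1 = 2 * r * (1 - L * r ^ 2) - 2 * L * r * (r ^ 2 + a ^ 2) - 2 * m)
    (hR2 : R2 = 2 - 2 * L * a ^ 2 - 12 * L * r ^ 2)
    (hQ : Q = (1 - c ^ 2) * (1 + L * a ^ 2 * c ^ 2))
    (hQ1 : Q1 = -2 * c + 2 * L * a ^ 2 * c - 4 * L * a ^ 2 * c ^ 3)
    (hQ2 : Q2 = -2 + 2 * L * a ^ 2 - 12 * L * a ^ 2 * c ^ 2)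
    (hS : S = r ^ 2 + a ^ 2 * c ^ 2) (hR0 : R ≠ 0) (hQ0 : Q ≠ 0) (hS0 : S ≠ 0) (b e : Fin 4) :
    ∑ i, frameCurvature (carterConn a r c R R1 Q Q1 S)
      (carterConnD a r c R R1 R2 Q Q1 Q2 S) i b i e
      = if b = e then 3 * L * (![S / R, S / Q, Q / S, -(R / S)] : Fin 4 → ℝ) b else 0 := by
  simp only [frameCurvature, Fin.sum_univ_four]
  fin_cases b <;> fin_cases e <;>
    simp [carterConn, carterConnD, carterConnR, carterConnC] <;>
    (field_simp; try (simp only [hQ2, hR2, hQ1, hR1, hQ, hR, hS]; ring))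

/-! ### The sphere in polar coordinates -/

theorem contDiff_radius (Λ : ℝ) : ContDiff ℝ ∞ (radius Λ) := by
  unfold radius
  fun_prop

theorem contDiff_omega (b : Bool) (k : Fin 3) : ContDiff ℝ ∞ (omega b k) := by
  unfold omega polarPoint
  cases b <;> fin_cases k <;> simp <;> fun_prop

theorem omega_sq_sum (b : Bool) (y : Coord) :
    omega b 0 y ^ 2 + omega b 1 y ^ 2 + omega b 2 y ^ 2 = 1 := by
  have h := polarPoint_mem b (y 2) (y 3)
  rw [mem_sphere_zero_iff_norm, EuclideanSpace.norm_eq, Real.sqrt_eq_one] at h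
  simpa [Fin.sum_univ_three, omega] using h

theorem diffAt_omega (b : Bool) (k : Fin 3) (y : Coord) : DifferentiableAt ℝ (omega b k) y :=
  (contDiff_omega b k).differentiable (by simp) y

theorem contDiff_pd {f : Coord → ℝ} (hf : ContDiff ℝ ∞ f) (μ : Fin 4) : ContDiff ℝ ∞ (pd μ f) :=
  contDiffOn_univ.mp (ContDiffOn.pd isOpen_univ hf.contDiffOn μ)

theorem omega_pd_sum (b : Bool) (μ : Fin 4) (y : Coord) :
    omega b 0 y * pd μ (omega b 0) y + omega b 1 y * pd μ (omega b 1) y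
      + omega b 2 y * pd μ (omega b 2) y = 0 := by
  have hd := fun k => diffAt_omega b k y
  have h : pd μ (fun z => omega b 0 z * omega b 0 z
      + (omega b 1 z * omega b 1 z + omega b 2 z * omega b 2 z)) y = pd μ (fun _ => 1) y := by
    congr 1
    ext z
    linear_combination omega_sq_sum b z
  rw [pd_const, pd_add ((hd 0).fun_mul (hd 0))
    (((hd 1).fun_mul (hd 1)).fun_add ((hd 2).fun_mul (hd 2))),
    pd_add ((hd 1).fun_mul (hd 1)) ((hd 2).fun_mul (hd 2)), pd_mul (hd 0) (hd 0),
    pd_mul (hd 1) (hd 1), pd_mul (hd 2) (hd 2)] at h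
  linear_combination h / 2

/-- On the sphere `(1 - c²) |dω|² = dc² + η²`, where `c = ω₃`. -/
theorem roundMetric_mul (b : Bool) (μ ν : Fin 4) (y : Coord) :
    (1 - omega b 2 y ^ 2) * roundMetric b μ ν y
      = pd μ (omega b 2) y * pd ν (omega b 2) y + eta b μ y * eta b ν y := by
  have h := omega_sq_sum b y
  have hμ := omega_pd_sum b μ y
  have hν := omega_pd_sum b ν y
  rw [roundMetric, Fin.sum_univ_three, eta, eta]
  have e : 1 - omega b 2 y ^ 2 = omega b 0 y ^ 2 + omega b 1 y ^ 2 := by linear_combination -h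
  have e2 : omega b 0 y * pd μ (omega b 0) y + omega b 1 y * pd μ (omega b 1) y
      = -(omega b 2 y * pd μ (omega b 2) y) := by linear_combination hμ
  have e3 : omega b 0 y * pd ν (omega b 0) y + omega b 1 y * pd ν (omega b 1) y
      = -(omega b 2 y * pd ν (omega b 2) y) := by linear_combination hν
  have e4 := congrArg₂ (· * ·) e2 e3
  rw [e]
  linear_combination e4 + pd μ (omega b 2) y * pd ν (omega b 2) y * h

theorem contDiff_eta (b : Bool) (μ : Fin 4) : ContDiff ℝ ∞ (eta b μ) :=
  ((contDiff_omega b 0).mul (contDiff_pd (contDiff_omega b 1) μ)).sub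
    ((contDiff_omega b 1).mul (contDiff_pd (contDiff_omega b 0) μ))

/-- On the sphere `(1 - c²) dη = -2c dc ∧ η`: off the axis, `η / (1 - c²)` is closed. -/
theorem pd_eta_antisymm (b : Bool) (μ ν : Fin 4) (y : Coord) :
    (1 - omega b 2 y ^ 2) * (pd μ (eta b ν) y - pd ν (eta b μ) y)
      = -2 * omega b 2 y * (pd μ (omega b 2) y * eta b ν y - pd ν (omega b 2) y * eta b μ y) := by
  have hd := fun k => diffAt_omega b k y
  have hdd := fun k ν => (contDiff_pd (contDiff_omega b k) ν).differentiable (by simp) y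
  have e : ∀ μ ν, pd μ (eta b ν) y
      = pd μ (omega b 0) y * pd ν (omega b 1) y + omega b 0 y * pd μ (pd ν (omega b 1)) y
        - (pd μ (omega b 1) y * pd ν (omega b 0) y
          + omega b 1 y * pd μ (pd ν (omega b 0)) y) := fun μ ν => by
    have : eta b ν = fun z => omega b 0 z * pd ν (omega b 1) z
      - omega b 1 z * pd ν (omega b 0) z := rfl
    rw [this, pd_sub ((hd 0).fun_mul (hdd 1 ν)) ((hd 1).fun_mul (hdd 0 ν)),
      pd_mul (hd 0) (hdd 1 ν), pd_mul (hd 1) (hdd 0 ν)]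
  have hs := omega_sq_sum b y
  have hμ := omega_pd_sum b μ y
  have hν := omega_pd_sum b ν y
  have e1 : 1 - omega b 2 y ^ 2 = omega b 0 y ^ 2 + omega b 1 y ^ 2 := by linear_combination -hs
  rw [e, e, pd_comm isOpen_univ (contDiff_omega b 0).contDiffOn (Set.mem_univ y) ν μ,
    pd_comm isOpen_univ (contDiff_omega b 1).contDiffOn (Set.mem_univ y) ν μ, e1, eta, eta]
  linear_combination 2 * (omega b 0 y * pd ν (omega b 1) y - omega b 1 y * pd ν (omega b 0) y) * hμ
    - 2 * (omega b 0 y * pd μ (omega b 1) y - omega b 1 y * pd μ (omega b 0) y) * hν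

/-! ### The Einstein equation off the axis -/

section Carter

variable {u v : Fin 4 → ℝ} {y : Coord} {f g : Coord → ℝ} {f0 f1 g0 g1 : ℝ}

/-- `df = f0 u + f1 v` at `y`. -/
def HasGrad (u v : Fin 4 → ℝ) (y : Coord) (f : Coord → ℝ) (f0 f1 : ℝ) : Prop :=
  DifferentiableAt ℝ f y ∧ ∀ μ, pd μ f y = f0 * u μ + f1 * v μ

theorem HasGrad.const (c : ℝ) : HasGrad u v y (fun _ => c) 0 0 :=
  ⟨by fun_prop, fun μ => by rw [pd_const]; ring⟩

theorem HasGrad.add (hf : HasGrad u v y f f0 f1) (hg : HasGrad u v y g g0 g1) :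
    HasGrad u v y (fun z => f z + g z) (f0 + g0) (f1 + g1) :=
  ⟨hf.1.fun_add hg.1, fun μ => by rw [pd_add hf.1 hg.1, hf.2, hg.2]; ring⟩

theorem HasGrad.sub (hf : HasGrad u v y f f0 f1) (hg : HasGrad u v y g g0 g1) :
    HasGrad u v y (fun z => f z - g z) (f0 - g0) (f1 - g1) :=
  ⟨hf.1.fun_sub hg.1, fun μ => by rw [pd_sub hf.1 hg.1, hf.2, hg.2]; ring⟩

theorem HasGrad.mul (hf : HasGrad u v y f f0 f1) (hg : HasGrad u v y g g0 g1) :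
    HasGrad u v y (fun z => f z * g z) (f0 * g y + f y * g0) (f1 * g y + f y * g1) :=
  ⟨hf.1.fun_mul hg.1, fun μ => by rw [pd_mul hf.1 hg.1, hf.2, hg.2]; ring⟩

theorem HasGrad.neg (hf : HasGrad u v y f f0 f1) :
    HasGrad u v y (fun z => -f z) (-f0) (-f1) :=
  ⟨hf.1.fun_neg, fun μ => by
    rw [pd, fderiv_fun_neg, neg_apply, ← pd, hf.2]
    ring⟩

theorem HasGrad.pow (hf : HasGrad u v y f f0 f1) (n : ℕ) :
    HasGrad u v y (fun z => f z ^ n) (n * f y ^ (n - 1) * f0) (n * f y ^ (n - 1) * f1) :=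
  ⟨hf.1.fun_pow n, fun μ => by
    rw [pd, fderiv_fun_pow n hf.1, smul_apply, ← pd, hf.2, smul_eq_mul]
    simp; ring⟩

theorem HasGrad.inv (hf : HasGrad u v y f f0 f1) (h : f y ≠ 0) :
    HasGrad u v y (fun z => (f z)⁻¹) (-f0 * (f y)⁻¹ ^ 2) (-f1 * (f y)⁻¹ ^ 2) :=
  ⟨hf.1.fun_inv h, fun μ => by
    have e : fderiv ℝ (fun z => (f z)⁻¹) y = _ :=
      ((hasDerivAt_inv h).comp_hasFDerivAt y hf.1.hasFDerivAt).fderiv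
    rw [pd, e, smul_apply, ← pd, hf.2]
    simp only [smul_eq_mul, inv_pow]
    ring⟩

theorem HasGrad.congr (hf : HasGrad u v y f f0 f1) (h0 : f0 = g0) (h1 : f1 = g1) :
    HasGrad u v y f g0 g1 := by
  rwa [← h0, ← h1]

set_option maxHeartbeats 4000000 in
/-- The tables `carterConnR` and `carterConnC` are the derivatives of `carterConn`. -/
theorem hasGrad_carterConn {r c R R1 Q Q1 S : Coord → ℝ} {a R2 Q2 : ℝ}
    (hr : HasGrad u v y r 1 0) (hc : HasGrad u v y c 0 1) (hR : HasGrad u v y R (R1 y) 0)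
    (hR1 : HasGrad u v y R1 R2 0) (hQ : HasGrad u v y Q 0 (Q1 y)) (hQ1 : HasGrad u v y Q1 0 Q2)
    (hS : HasGrad u v y S (2 * r y) (2 * a ^ 2 * c y)) (hR0 : R y ≠ 0) (hQ0 : Q y ≠ 0)
    (hS0 : S y ≠ 0) (i j k : Fin 4) :
    HasGrad u v y (fun z => carterConn a (r z) (c z) (R z) (R1 z) (Q z) (Q1 z) (S z) i j k)
      (carterConnR a (r y) (c y) (R y) (R1 y) R2 (Q y) (Q1 y) (S y) i j k)
      (carterConnC a (r y) (c y) (R y) (R1 y) (Q y) (Q1 y) Q2 (S y) i j k) := by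
  unfold carterConn carterConnR carterConnC
  fin_cases i <;> simp only [Fin.zero_eta, Fin.mk_one, Fin.reduceFinMk, Matrix.cons_val] <;>
  fin_cases j <;> simp only [Fin.zero_eta, Fin.mk_one, Fin.reduceFinMk, Matrix.cons_val] <;>
  fin_cases k <;> simp only [Fin.zero_eta, Fin.mk_one, Fin.reduceFinMk, Matrix.cons_val] <;>
    eapply HasGrad.congr
  all_goals
    first
    | (repeat' first
        | exact hr
        | exact hc
        | exact hR
        | exact hR1
        | exact hQ
        | exact hQ1
        | exact hS
        | assumption
        | exact HasGrad.const _
        | apply HasGrad.add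
        | apply HasGrad.sub
        | apply HasGrad.neg
        | apply HasGrad.pow
        | apply HasGrad.mul
        | apply HasGrad.inv); done
    | (norm_num; try ring)

end Carter

section Coframe

variable (Λ a m : ℝ) (b : Bool)

/-- `Δ_θ sin²θ` as a function of `c = cos θ`. -/
def deltaC (c : ℝ) : ℝ := (1 - c ^ 2) * deltaTheta Λ a c

/-- The closed one-form `dφ / Δ_0`, off the axis of rotation. -/
def dphi (μ : Fin 4) (y : Coord) : ℝ := eta b μ y / ((1 - omega b 2 y ^ 2) * deltaZero Λ a)

/-- The Carter coframe `dr`, `dc`, `a dt - (r² + a²) dφ / Δ_0`, `dt - a sin²θ dφ / Δ_0`. -/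
def carterCoframe : Fin 4 → Fin 4 → Coord → ℝ :=
  ![fun μ => pd μ (radius Λ), fun μ => pd μ (omega b 2),
    fun μ y => a * dt μ - (radius Λ y ^ 2 + a ^ 2) * dphi Λ a b μ y,
    fun μ y => dt μ - a * (1 - omega b 2 y ^ 2) * dphi Λ a b μ y]

/-- The squared lengths of the Carter coframe. -/
def carterNorm : Fin 4 → Coord → ℝ :=
  ![fun y => rhoSq a (radius Λ y) (omega b 2 y) / deltaR Λ a m (radius Λ y),
    fun y => rhoSq a (radius Λ y) (omega b 2 y) / deltaC Λ a (omega b 2 y),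
    fun y => deltaC Λ a (omega b 2 y) / rhoSq a (radius Λ y) (omega b 2 y),
    fun y => -(deltaR Λ a m (radius Λ y) / rhoSq a (radius Λ y) (omega b 2 y))]

/-- The region off the axis of rotation in which `Δ_r < 0`. -/
def offAxis : Set Coord := {y | deltaR Λ a m (radius Λ y) < 0 ∧ omega b 2 y ^ 2 < 1}

/-- The derivative of `Δ_r`. -/
def deltaR1 (r : ℝ) : ℝ :=
  2 * r * (1 - Λ / 3 * r ^ 2) - 2 * (Λ / 3) * r * (r ^ 2 + a ^ 2) - 2 * m

/-- The derivative of `deltaC`. -/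
def deltaC1 (c : ℝ) : ℝ := -2 * c + 2 * (Λ / 3) * a ^ 2 * c - 4 * (Λ / 3) * a ^ 2 * c ^ 3

end Coframe

variable {Λ : ℝ}

theorem radius_pos (y : Coord) : 0 < radius Λ y := Real.exp_pos _

theorem rhoSq_pos {a r c : ℝ} (hr : 0 < r) : 0 < rhoSq a r c := by unfold rhoSq; positivity

theorem deltaTheta_pos (hΛ : 0 < Λ) (a c : ℝ) : 0 < deltaTheta Λ a c := by
  unfold deltaTheta; positivity

theorem deltaZero_pos (hΛ : 0 < Λ) (a : ℝ) : 0 < deltaZero Λ a := by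
  unfold deltaZero; positivity

theorem isOpen_offAxis (a m : ℝ) (b : Bool) : IsOpen (offAxis Λ a m b) := by
  have h1 := (contDiff_radius Λ).continuous
  have h2 := (contDiff_omega b 2).continuous
  have h3 : Continuous fun y => deltaR Λ a m (radius Λ y) := by
    unfold deltaR
    fun_prop
  exact (isOpen_lt h3 continuous_const).inter (isOpen_lt (h2.pow 2) continuous_const)

theorem deltaC_pos (hΛ : 0 < Λ) (a : ℝ) {c : ℝ} (hc : c ^ 2 < 1) : 0 < deltaC Λ a c :=
  mul_pos (by linarith) (deltaTheta_pos hΛ a c)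

theorem contDiffOn_dphi (hΛ : 0 < Λ) (a m : ℝ) (b : Bool) (μ : Fin 4) :
    ContDiffOn ℝ ∞ (dphi Λ a b μ) (offAxis Λ a m b) := by
  refine (contDiff_eta b μ).contDiffOn.div (ContDiff.contDiffOn ?_) fun y hy => ?_
  · exact (contDiff_const.sub ((contDiff_omega b 2).pow 2)).mul contDiff_const
  · exact mul_ne_zero (by have := hy.2; linarith) (deltaZero_pos hΛ a).ne'

theorem contDiffOn_carterCoframe (hΛ : 0 < Λ) (a m : ℝ) (b : Bool) (i μ : Fin 4) :
    ContDiffOn ℝ ∞ (carterCoframe Λ a b i μ) (offAxis Λ a m b) := by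
  have h1 := (contDiff_radius Λ).contDiffOn (s := offAxis Λ a m b)
  have h2 := (contDiff_omega b 2).contDiffOn (s := offAxis Λ a m b)
  have h3 := contDiffOn_dphi hΛ a m b μ
  fin_cases i
  · exact (contDiff_pd (contDiff_radius Λ) μ).contDiffOn
  · exact (contDiff_pd (contDiff_omega b 2) μ).contDiffOn
  · change ContDiffOn ℝ ∞ (fun y => a * dt μ - (radius Λ y ^ 2 + a ^ 2) * dphi Λ a b μ y) _
    fun_prop
  · change ContDiffOn ℝ ∞ (fun y => dt μ - a * (1 - omega b 2 y ^ 2) * dphi Λ a b μ y) _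
    fun_prop

theorem contDiffOn_carterNorm (hΛ : 0 < Λ) (a m : ℝ) (b : Bool) (i : Fin 4) :
    ContDiffOn ℝ ∞ (carterNorm Λ a m b i) (offAxis Λ a m b) := by
  have h1 := (contDiff_radius Λ).contDiffOn (s := offAxis Λ a m b)
  have h2 := (contDiff_omega b 2).contDiffOn (s := offAxis Λ a m b)
  have hS : ContDiffOn ℝ ∞ (fun y => rhoSq a (radius Λ y) (omega b 2 y)) (offAxis Λ a m b) := by
    unfold rhoSq; fun_prop
  have hR : ContDiffOn ℝ ∞ (fun y => deltaR Λ a m (radius Λ y)) (offAxis Λ a m b) := by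
    unfold deltaR; fun_prop
  have hQ : ContDiffOn ℝ ∞ (fun y => deltaC Λ a (omega b 2 y)) (offAxis Λ a m b) := by
    unfold deltaC deltaTheta; fun_prop
  have hS0 : ∀ y ∈ offAxis Λ a m b, rhoSq a (radius Λ y) (omega b 2 y) ≠ 0 :=
    fun y _ => (rhoSq_pos (radius_pos y)).ne'
  fin_cases i
  · exact hS.div hR fun y hy => hy.1.ne
  · exact hS.div hQ fun y hy => (deltaC_pos hΛ a hy.2).ne'
  · exact hQ.div hS hS0
  · exact (hR.div hS hS0).neg

/-- Off the axis, the Kerr-de Sitter metric is diagonal in the Carter coframe. -/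
theorem kerrDeSitter_eq_sum (hΛ : 0 < Λ) (a m : ℝ) (b : Bool) {y : Coord}
    (hy : y ∈ offAxis Λ a m b) (μ ν : Fin 4) :
    kerrDeSitter Λ a m b y μ ν
      = ∑ i, carterNorm Λ a m b i y * (carterCoframe Λ a b i μ y * carterCoframe Λ a b i ν y) := by
  have hS := (rhoSq_pos (a := a) (c := omega b 2 y) (radius_pos (Λ := Λ) y)).ne'
  have hT := (deltaTheta_pos hΛ a (omega b 2 y)).ne'
  have hZ := (deltaZero_pos hΛ a).ne'
  have hR := hy.1.ne
  have hc : 1 - omega b 2 y ^ 2 ≠ 0 := by have := hy.2; linarith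
  have hround : roundMetric b μ ν y = (pd μ (omega b 2) y * pd ν (omega b 2) y
      + eta b μ y * eta b ν y) / (1 - omega b 2 y ^ 2) := by
    rw [← roundMetric_mul]
    field_simp
  simp only [kerrDeSitter, Matrix.of_apply, Fin.sum_univ_four, carterNorm, carterCoframe, dphi,
    deltaC, axisCoeff, Matrix.cons_val, hround]
  have e1 : rhoSq a (radius Λ y) (omega b 2 y) = radius Λ y ^ 2 + a ^ 2 * omega b 2 y ^ 2 := rfl
  have e2 : deltaTheta Λ a (omega b 2 y) = 1 + Λ / 3 * a ^ 2 * omega b 2 y ^ 2 := rfl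
  have e3 : deltaZero Λ a = 1 + Λ / 3 * a ^ 2 := rfl
  generalize radius Λ y = r at *
  generalize deltaR Λ a m r = R at *
  generalize omega b 2 y = c at *
  generalize eta b μ y = ημ at *
  generalize eta b ν y = ην at *
  generalize pd μ (omega b 2) y = cμ at *
  generalize pd ν (omega b 2) y = cν at *
  generalize pd μ (radius Λ) y = rμ at *
  generalize pd ν (radius Λ) y = rν at *
  generalize dt μ = tμ at *
  generalize dt ν = tν at *
  field_simp
  rw [e1, e2, e3]
  ring

section Grad

variable (a m : ℝ) (b : Bool) (y : Coord)

theorem hasGrad_radius : HasGrad (fun μ => carterCoframe Λ a b 0 μ y)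
    (fun μ => carterCoframe Λ a b 1 μ y) y (radius Λ) 1 0 :=
  ⟨(contDiff_radius Λ).differentiable (by simp) y, fun μ => by simp [carterCoframe]⟩

theorem hasGrad_omega : HasGrad (fun μ => carterCoframe Λ a b 0 μ y)
    (fun μ => carterCoframe Λ a b 1 μ y) y (omega b 2) 0 1 :=
  ⟨diffAt_omega b 2 y, fun μ => by simp [carterCoframe]⟩

theorem hasGrad_rhoSq : HasGrad (fun μ => carterCoframe Λ a b 0 μ y)
    (fun μ => carterCoframe Λ a b 1 μ y) y (fun z => rhoSq a (radius Λ z) (omega b 2 z))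
    (2 * radius Λ y) (2 * a ^ 2 * omega b 2 y) :=
  (((hasGrad_radius a b y).pow 2).add ((HasGrad.const (a ^ 2)).mul
    ((hasGrad_omega a b y).pow 2))).congr (by norm_num) (by norm_num; ring)

theorem hasGrad_deltaR : HasGrad (fun μ => carterCoframe Λ a b 0 μ y)
    (fun μ => carterCoframe Λ a b 1 μ y) y (fun z => deltaR Λ a m (radius Λ z))
    (deltaR1 Λ a m (radius Λ y)) 0 :=
  have hr := hasGrad_radius (Λ := Λ) a b y
  ((((hr.pow 2).add (HasGrad.const (a ^ 2))).mul
    ((HasGrad.const 1).sub ((HasGrad.const (Λ / 3)).mul (hr.pow 2)))).sub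
      ((HasGrad.const (2 * m)).mul hr)).congr (by norm_num [deltaR1]; ring) (by norm_num)

theorem hasGrad_deltaR1 : HasGrad (fun μ => carterCoframe Λ a b 0 μ y)
    (fun μ => carterCoframe Λ a b 1 μ y) y (fun z => deltaR1 Λ a m (radius Λ z))
    (2 - 2 * (Λ / 3) * a ^ 2 - 12 * (Λ / 3) * radius Λ y ^ 2) 0 :=
  have hr := hasGrad_radius (Λ := Λ) a b y
  (((((HasGrad.const 2).mul hr).mul
    ((HasGrad.const 1).sub ((HasGrad.const (Λ / 3)).mul (hr.pow 2)))).sub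
      (((HasGrad.const (2 * (Λ / 3))).mul hr).mul ((hr.pow 2).add (HasGrad.const (a ^ 2))))).sub
        (HasGrad.const (2 * m))).congr (by norm_num; ring) (by norm_num)

theorem hasGrad_deltaC : HasGrad (fun μ => carterCoframe Λ a b 0 μ y)
    (fun μ => carterCoframe Λ a b 1 μ y) y (fun z => deltaC Λ a (omega b 2 z))
    0 (deltaC1 Λ a (omega b 2 y)) :=
  have hc := hasGrad_omega (Λ := Λ) a b y
  (((HasGrad.const 1).sub (hc.pow 2)).mul ((HasGrad.const 1).add
    ((HasGrad.const (Λ / 3 * a ^ 2)).mul (hc.pow 2)))).congr (by norm_num)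
      (by norm_num [deltaC1]; ring)

theorem hasGrad_deltaC1 : HasGrad (fun μ => carterCoframe Λ a b 0 μ y)
    (fun μ => carterCoframe Λ a b 1 μ y) y (fun z => deltaC1 Λ a (omega b 2 z))
    0 (-2 + 2 * (Λ / 3) * a ^ 2 - 12 * (Λ / 3) * a ^ 2 * omega b 2 y ^ 2) :=
  have hc := hasGrad_omega (Λ := Λ) a b y
  ((((HasGrad.const (-2)).mul hc).add ((HasGrad.const (2 * (Λ / 3) * a ^ 2)).mul hc)).sub
    ((HasGrad.const (4 * (Λ / 3) * a ^ 2)).mul (hc.pow 3))).congr (by norm_num)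
      (by norm_num; ring)

end Grad

theorem pd_dphi_symm (hΛ : 0 < Λ) (a m : ℝ) (b : Bool) {y : Coord} (hy : y ∈ offAxis Λ a m b)
    (μ ν : Fin 4) : pd μ (dphi Λ a b ν) y = pd ν (dphi Λ a b μ) y := by
  have hV := isOpen_offAxis (Λ := Λ) a m b
  have hZ := (deltaZero_pos hΛ a).ne'
  have hc : 1 - omega b 2 y ^ 2 ≠ 0 := by have := hy.2; linarith
  have hd := fun ν => diffAt hV (contDiffOn_dphi hΛ a m b ν) hy
  have ho := diffAt_omega b 2 y
  have key : ∀ μ ν, pd μ (eta b ν) y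
      = (-(2 * omega b 2 y * pd μ (omega b 2) y) * deltaZero Λ a) * dphi Λ a b ν y
        + ((1 - omega b 2 y ^ 2) * deltaZero Λ a) * pd μ (dphi Λ a b ν) y := fun μ ν => by
    have he : Set.EqOn (eta b ν)
        (fun z => ((1 - omega b 2 z * omega b 2 z) * deltaZero Λ a) * dphi Λ a b ν z)
        (offAxis Λ a m b) := fun z hz => by
      have : 1 - omega b 2 z ^ 2 ≠ 0 := by have := hz.2; linarith
      simp only [dphi, ← sq]
      field_simp
    have h1 : DifferentiableAt ℝ (fun z => 1 - omega b 2 z * omega b 2 z) y := by fun_prop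
    rw [pd_eqOn hV he μ hy, pd_mul (h1.fun_mul (differentiableAt_const _)) (hd ν),
      pd_mul h1 (differentiableAt_const _), pd_sub (differentiableAt_const _) (ho.fun_mul ho),
      pd_mul ho ho, pd_const, pd_const]
    ring
  have h := pd_eta_antisymm b μ ν y
  have hη : ∀ ν, eta b ν y = (1 - omega b 2 y ^ 2) * deltaZero Λ a * dphi Λ a b ν y := fun ν => by
    simp only [dphi]
    field_simp
  rw [key μ ν, key ν μ, hη, hη] at h
  have h2 : (1 - omega b 2 y ^ 2) ^ 2 * deltaZero Λ a *
      (pd μ (dphi Λ a b ν) y - pd ν (dphi Λ a b μ) y) = 0 := by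
    linear_combination h
  have := (mul_eq_zero.mp h2).resolve_left (mul_ne_zero (pow_ne_zero 2 hc) hZ)
  linarith

/-- The connection of Kerr-de Sitter in the Carter coframe. -/
theorem carterCoframe_frame (hΛ : 0 < Λ) (a m : ℝ) (b : Bool) {V : Set Coord} (hV : IsOpen V)
    (hVo : V ⊆ offAxis Λ a m b) (hdet : ∀ y ∈ V, (kerrDeSitter Λ a m b y).det ≠ 0) :
    CartanFrame V (kerrDeSitter Λ a m b) (carterCoframe Λ a b) (carterNorm Λ a m b)
      (fun y => carterConn a (radius Λ y) (omega b 2 y) (deltaR Λ a m (radius Λ y))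
        (deltaR1 Λ a m (radius Λ y)) (deltaC Λ a (omega b 2 y)) (deltaC1 Λ a (omega b 2 y))
        (rhoSq a (radius Λ y) (omega b 2 y)))
      (fun y => carterConnD a (radius Λ y) (omega b 2 y) (deltaR Λ a m (radius Λ y))
        (deltaR1 Λ a m (radius Λ y)) (2 - 2 * (Λ / 3) * a ^ 2 - 12 * (Λ / 3) * radius Λ y ^ 2)
        (deltaC Λ a (omega b 2 y)) (deltaC1 Λ a (omega b 2 y))
        (-2 + 2 * (Λ / 3) * a ^ 2 - 12 * (Λ / 3) * a ^ 2 * omega b 2 y ^ 2)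
        (rhoSq a (radius Λ y) (omega b 2 y))) := by
  have hconn := fun y (hy : y ∈ V) => hasGrad_carterConn (hasGrad_radius (Λ := Λ) a b y)
    (hasGrad_omega a b y) (hasGrad_deltaR a m b y) (hasGrad_deltaR1 a m b y)
    (hasGrad_deltaC a b y) (hasGrad_deltaC1 a b y) (hasGrad_rhoSq a b y) (hVo hy).1.ne
    (deltaC_pos hΛ a (hVo hy).2).ne' (rhoSq_pos (radius_pos y)).ne'
  refine ⟨hV, fun i μ => (contDiffOn_carterCoframe hΛ a m b i μ).mono hVo,
    fun i => (contDiffOn_carterNorm hΛ a m b i).mono hVo, fun i j k y hy => (hconn y hy i j k).1,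
    hdet, fun y hy => kerrDeSitter_eq_sum hΛ a m b (hVo hy), ?_, ?_, ?_, ?_⟩
  -- the derivatives of the squared lengths
  · intro y hy i μ
    have hS0 := (rhoSq_pos (a := a) (c := omega b 2 y) (radius_pos (Λ := Λ) y)).ne'
    have hQ0 := (deltaC_pos hΛ a (hVo hy).2).ne'
    have hR0 := (hVo hy).1.ne
    have hS := hasGrad_rhoSq (Λ := Λ) a b y
    have hR := hasGrad_deltaR (Λ := Λ) a m b y
    have hQ := hasGrad_deltaC (Λ := Λ) a b y
    rw [Fin.sum_univ_four]
    fin_cases i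
    · have e : carterNorm Λ a m b 0 = fun z =>
          rhoSq a (radius Λ z) (omega b 2 z) * (deltaR Λ a m (radius Λ z))⁻¹ :=
        funext fun z => div_eq_mul_inv _ _
      refine (congrArg (pd μ · y) e).trans (((hS.mul (hR.inv hR0)).2 μ).trans ?_)
      simp [carterNorm, carterConn]
      field_simp
      ring
    · have e : carterNorm Λ a m b 1 = fun z =>
          rhoSq a (radius Λ z) (omega b 2 z) * (deltaC Λ a (omega b 2 z))⁻¹ :=
        funext fun z => div_eq_mul_inv _ _
      refine (congrArg (pd μ · y) e).trans (((hS.mul (hQ.inv hQ0)).2 μ).trans ?_)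
      simp [carterNorm, carterConn]
      field_simp
      ring
    · have e : carterNorm Λ a m b 2 = fun z =>
          deltaC Λ a (omega b 2 z) * (rhoSq a (radius Λ z) (omega b 2 z))⁻¹ :=
        funext fun z => div_eq_mul_inv _ _
      refine (congrArg (pd μ · y) e).trans (((hQ.mul (hS.inv hS0)).2 μ).trans ?_)
      simp [carterNorm, carterConn]
      field_simp
      ring
    · have e : carterNorm Λ a m b 3 = fun z =>
          -(deltaR Λ a m (radius Λ z) * (rhoSq a (radius Λ z) (omega b 2 z))⁻¹) :=
        funext fun z => congrArg Neg.neg (div_eq_mul_inv _ _)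
      refine (congrArg (pd μ · y) e).trans (((hR.mul (hS.inv hS0)).neg.2 μ).trans ?_)
      simp [carterNorm, carterConn]
      field_simp
      ring
  -- compatibility with the metric
  · intro y hy i j k hij
    have hS0 := (rhoSq_pos (a := a) (c := omega b 2 y) (radius_pos (Λ := Λ) y)).ne'
    have hQ0 := (deltaC_pos hΛ a (hVo hy).2).ne'
    have hR0 := (hVo hy).1.ne
    fin_cases i <;> fin_cases j <;> first | exact absurd rfl hij | skip
    all_goals
      fin_cases k <;> simp [carterNorm, carterConn] <;> field_simp <;> ring
  -- vanishing of the torsion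
  · intro y hy i μ ν
    have hS0 := (rhoSq_pos (a := a) (c := omega b 2 y) (radius_pos (Λ := Λ) y)).ne'
    have hQ0 := (deltaC_pos hΛ a (hVo hy).2).ne'
    have hR0 := (hVo hy).1.ne
    have hφ := fun ν => diffAt (isOpen_offAxis (Λ := Λ) a m b) (contDiffOn_dphi hΛ a m b ν) (hVo hy)
    have hsymm := pd_dphi_symm hΛ a m b (hVo hy) μ ν
    have hr := (((hasGrad_radius (Λ := Λ) a b y).pow 2).add (HasGrad.const (a ^ 2)))
    have hc := ((HasGrad.const a).mul
      ((HasGrad.const 1).sub ((hasGrad_omega (Λ := Λ) a b y).pow 2)))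
    have hdφ : ∀ ν, dphi Λ a b ν y = (a * carterCoframe Λ a b 3 ν y - carterCoframe Λ a b 2 ν y)
        / rhoSq a (radius Λ y) (omega b 2 y) := fun ν => by
      rw [eq_div_iff hS0]
      simp only [carterCoframe, Matrix.cons_val, rhoSq]
      ring
    have e2 : ∀ μ ν, pd μ (carterCoframe Λ a b 2 ν) y
        = -(2 * radius Λ y * carterCoframe Λ a b 0 μ y * dphi Λ a b ν y
          + (radius Λ y ^ 2 + a ^ 2) * pd μ (dphi Λ a b ν) y) := fun μ ν => by
      change pd μ (fun y => a * dt ν - (radius Λ y ^ 2 + a ^ 2) * dphi Λ a b ν y) y = _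
      rw [pd_sub (differentiableAt_const _) (hr.1.fun_mul (hφ ν)), pd_const,
        pd_mul hr.1 (hφ ν), hr.2]
      norm_num
    have e3 : ∀ μ ν, pd μ (carterCoframe Λ a b 3 ν) y
        = 2 * a * omega b 2 y * carterCoframe Λ a b 1 μ y * dphi Λ a b ν y
          - a * (1 - omega b 2 y ^ 2) * pd μ (dphi Λ a b ν) y := fun μ ν => by
      change pd μ (fun y => dt ν - a * (1 - omega b 2 y ^ 2) * dphi Λ a b ν y) y = _
      rw [pd_sub (differentiableAt_const _) (hc.1.fun_mul (hφ ν)), pd_const,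
        pd_mul hc.1 (hφ ν), hc.2]
      norm_num
      ring
    simp only [Fin.sum_univ_four]
    fin_cases i
    · have h := pd_comm isOpen_univ (contDiff_radius Λ).contDiffOn (Set.mem_univ y) μ ν
      change pd μ (pd ν (radius Λ)) y - pd ν (pd μ (radius Λ)) y = _
      rw [h]
      simp [carterConn]
      ring
    · have h := pd_comm isOpen_univ (contDiff_omega b 2).contDiffOn (Set.mem_univ y) μ ν
      change pd μ (pd ν (omega b 2)) y - pd ν (pd μ (omega b 2)) y = _
      rw [h]
      simp [carterConn]
      ring
    · change pd μ (carterCoframe Λ a b 2 ν) y - pd ν (carterCoframe Λ a b 2 μ) y = _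
      rw [e2, e2, hsymm, hdφ, hdφ]
      simp [carterConn]
      field_simp
      ring
    · change pd μ (carterCoframe Λ a b 3 ν) y - pd ν (carterCoframe Λ a b 3 μ) y = _
      rw [e3, e3, hsymm, hdφ, hdφ]
      simp [carterConn]
      field_simp
      ring
  -- the derivatives of the connection coefficients
  · intro y hy i j k μ
    have := (hconn y hy i j k).2 μ
    simpa [Fin.sum_univ_four, carterConnD] using this

/-- Kerr-de Sitter solves the Einstein equation off the axis of rotation. -/
theorem ricci_kerrDeSitter_of_offAxis (hΛ : 0 < Λ) (a m : ℝ) (b : Bool) {V : Set Coord}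
    (hV : IsOpen V) (hVo : V ⊆ offAxis Λ a m b)
    (hdet : ∀ y ∈ V, (kerrDeSitter Λ a m b y).det ≠ 0) {y : Coord} (hy : y ∈ V) (μ ν : Fin 4) :
    ricci (kerrDeSitter Λ a m b) μ ν y = Λ * kerrDeSitter Λ a m b y μ ν := by
  rw [(carterCoframe_frame hΛ a m b hV hVo hdet).ricci_eq hy,
    kerrDeSitter_eq_sum hΛ a m b (hVo hy), Finset.mul_sum]
  have key := carter_einstein (L := Λ / 3) (a := a) (m := m) (r := radius Λ y) (c := omega b 2 y)
    (R := deltaR Λ a m (radius Λ y)) (R1 := deltaR1 Λ a m (radius Λ y))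
    (Q := deltaC Λ a (omega b 2 y)) (Q1 := deltaC1 Λ a (omega b 2 y))
    (S := rhoSq a (radius Λ y) (omega b 2 y))
    rfl rfl rfl rfl rfl rfl rfl (hVo hy).1.ne (deltaC_pos hΛ a (hVo hy).2).ne'
    (rhoSq_pos (radius_pos y)).ne'
  refine Finset.sum_congr rfl fun i _ => ?_
  simp only [key, ite_mul, zero_mul, Finset.sum_ite_eq, Finset.mem_univ, if_true]
  fin_cases i <;> simp [carterNorm] <;> ring

/-! ### Families of functions with uniform exponential bounds on all derivatives -/

section Symbols

open TopologicalSpace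

variable {ι ι' : Type*}

/-- A uniform bound `|f i| ≤ C e^{-kHs} δ i` on `Ω` for the members `f i` of a family. -/
def ExpBound (Ω : Opens Coord) (H : ℝ) (k : ℤ) (δ : ι → ℝ) (f : ι → Coord → ℝ) : Prop :=
  ∃ C : ℝ, ∀ i, ∀ y ∈ Ω, |f i y| ≤ C * (Real.exp (-k * H * y 0) * δ i)

/-- The bound `ExpBound` for all coordinate derivatives of order at most `n`. -/
def ExpBounds (Ω : Opens Coord) (H : ℝ) (k : ℤ) (δ : ι → ℝ) : ℕ → (ι → Coord → ℝ) → Prop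
  | 0, f => ExpBound Ω H k δ f
  | n + 1, f => ExpBound Ω H k δ f ∧ ∀ μ, ExpBounds Ω H k δ n fun i => pd μ (f i)

/-- The family `f` is smooth on `Ω`, and all coordinate derivatives, of any order, are bounded by
a constant multiple of `e^{-kHs} δ i`, uniformly on `Ω` and in the index `i`. -/
structure ExpSymbol (Ω : Opens Coord) (H : ℝ) (k : ℤ) (δ : ι → ℝ) (f : ι → Coord → ℝ) : Prop where
  smooth : ∀ i, ContDiffOn ℝ ∞ (f i) Ω
  bounds : ∀ n, ExpBounds Ω H k δ n f

variable {Ω : Opens Coord} {H : ℝ} {k l : ℤ} {δ δ' : ι → ℝ} {f g : ι → Coord → ℝ} {n : ℕ}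

theorem ExpBound.congr (hf : ExpBound Ω H k δ f) (h : ∀ i, Set.EqOn (g i) (f i) Ω) :
    ExpBound Ω H k δ g := by
  obtain ⟨C, hC⟩ := hf
  exact ⟨C, fun i y hy => by rw [h i hy]; exact hC i y hy⟩

theorem ExpBound.add (hf : ExpBound Ω H k δ f) (hg : ExpBound Ω H k δ g) :
    ExpBound Ω H k δ fun i y => f i y + g i y := by
  obtain ⟨C, hC⟩ := hf
  obtain ⟨D, hD⟩ := hg
  refine ⟨C + D, fun i y hy => (abs_add_le _ _).trans ?_⟩
  rw [add_mul]
  exact add_le_add (hC i y hy) (hD i y hy)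

theorem ExpBound.mul (hf : ExpBound Ω H k δ f) (hg : ExpBound Ω H l δ' g) :
    ExpBound Ω H (k + l) (fun i => δ i * δ' i) fun i y => f i y * g i y := by
  obtain ⟨C, hC⟩ := hf
  obtain ⟨D, hD⟩ := hg
  refine ⟨C * D, fun i y hy => ?_⟩
  have he : Real.exp (-((k + l : ℤ) : ℝ) * H * y 0)
      = Real.exp (-k * H * y 0) * Real.exp (-l * H * y 0) := by
    rw [← Real.exp_add]
    push_cast
    ring_nf
  rw [abs_mul, he]
  refine (mul_le_mul (hC i y hy) (hD i y hy) (abs_nonneg _)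
    ((abs_nonneg _).trans (hC i y hy))).trans_eq ?_
  ring

theorem ExpBounds.of_succ : ∀ {n : ℕ} {f : ι → Coord → ℝ},
    ExpBounds Ω H k δ (n + 1) f → ExpBounds Ω H k δ n f
  | 0, _, hf => hf.1
  | _ + 1, _, hf => ⟨hf.1, fun μ => (hf.2 μ).of_succ⟩

theorem ExpBounds.congr : ∀ {n : ℕ} {f g : ι → Coord → ℝ}, ExpBounds Ω H k δ n f →
    (∀ i, Set.EqOn (g i) (f i) Ω) → ExpBounds Ω H k δ n g
  | 0, _, _, hf, h => ExpBound.congr hf h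
  | _ + 1, _, _, hf, h => ⟨hf.1.congr h, fun μ => (hf.2 μ).congr fun i => pd_eqOn Ω.isOpen (h i) μ⟩

theorem ExpBounds.add (hf : ∀ i, ContDiffOn ℝ ∞ (f i) Ω) (hg : ∀ i, ContDiffOn ℝ ∞ (g i) Ω)
    (hfb : ExpBounds Ω H k δ n f) (hgb : ExpBounds Ω H k δ n g) :
    ExpBounds Ω H k δ n fun i y => f i y + g i y := by
  induction n generalizing f g with
  | zero => exact ExpBound.add hfb hgb
  | succ n ih =>
    refine ⟨hfb.1.add hgb.1, fun μ => (ih (fun i => ContDiffOn.pd Ω.isOpen (hf i) μ)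
      (fun i => ContDiffOn.pd Ω.isOpen (hg i) μ) (hfb.2 μ) (hgb.2 μ)).congr fun i y hy => ?_⟩
    exact pd_add (diffAt Ω.isOpen (hf i) hy) (diffAt Ω.isOpen (hg i) hy) μ

theorem ExpBounds.mul (hf : ∀ i, ContDiffOn ℝ ∞ (f i) Ω) (hg : ∀ i, ContDiffOn ℝ ∞ (g i) Ω)
    (hfb : ExpBounds Ω H k δ n f) (hgb : ExpBounds Ω H l δ' n g) :
    ExpBounds Ω H (k + l) (fun i => δ i * δ' i) n fun i y => f i y * g i y := by
  induction n generalizing f g with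
  | zero => exact ExpBound.mul hfb hgb
  | succ n ih =>
    have hf' := fun μ i => ContDiffOn.pd Ω.isOpen (hf i) μ
    have hg' := fun μ i => ContDiffOn.pd Ω.isOpen (hg i) μ
    refine ⟨hfb.1.mul hgb.1, fun μ => (ExpBounds.add (fun i => (hf' μ i).mul (hg i))
      (fun i => (hf i).mul (hg' μ i)) (ih (hf' μ) hg (hfb.2 μ) hgb.of_succ)
      (ih hf (hg' μ) hfb.of_succ (hgb.2 μ))).congr fun i y hy => ?_⟩
    exact pd_mul (diffAt Ω.isOpen (hf i) hy) (diffAt Ω.isOpen (hg i) hy) μ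

theorem ExpBound.mono {s₁ : ℝ} (hH : 0 ≤ H) (hs : ∀ y ∈ Ω, s₁ ≤ y 0) (hδ : ∀ i, 0 ≤ δ i)
    (hkl : l ≤ k) (hf : ExpBound Ω H k δ f) : ExpBound Ω H l δ f := by
  obtain ⟨C, hC⟩ := hf
  refine ⟨|C| * Real.exp (-(k - l) * H * s₁), fun i y hy => (hC i y hy).trans ?_⟩
  rw [mul_assoc |C|]
  refine (mul_le_mul_of_nonneg_right (le_abs_self C)
    (mul_nonneg (Real.exp_pos _).le (hδ i))).trans
    (mul_le_mul_of_nonneg_left ?_ (abs_nonneg C))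
  rw [← mul_assoc, ← Real.exp_add]
  refine mul_le_mul_of_nonneg_right (Real.exp_le_exp.mpr ?_) (hδ i)
  have h1 : (0 : ℝ) ≤ k - l := by exact_mod_cast sub_nonneg.mpr hkl
  have := mul_le_mul_of_nonneg_left (hs y hy) (mul_nonneg h1 hH)
  linarith

theorem ExpBounds.mono {s₁ : ℝ} (hH : 0 ≤ H) (hs : ∀ y ∈ Ω, s₁ ≤ y 0) (hδ : ∀ i, 0 ≤ δ i)
    (hkl : l ≤ k) : ∀ {n : ℕ} {f : ι → Coord → ℝ}, ExpBounds Ω H k δ n f → ExpBounds Ω H l δ n f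
  | 0, _, hf => ExpBound.mono hH hs hδ hkl hf
  | _ + 1, _, hf => ⟨ExpBound.mono hH hs hδ hkl hf.1, fun μ => (hf.2 μ).mono hH hs hδ hkl⟩

theorem ExpBounds.comp (r : ι' → ι) : ∀ {n : ℕ} {f : ι → Coord → ℝ}, ExpBounds Ω H k δ n f →
    ExpBounds Ω H k (fun i => δ (r i)) n fun i => f (r i)
  | 0, _, ⟨C, hC⟩ => ⟨C, fun i => hC (r i)⟩
  | _ + 1, _, hf => ⟨ExpBounds.comp (n := 0) r hf.1, fun μ => (hf.2 μ).comp r⟩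

namespace ExpSymbol

theorem diffAt (hf : ExpSymbol Ω H k δ f) (i : ι) {y : Coord} (hy : y ∈ Ω) :
    DifferentiableAt ℝ (f i) y :=
  KerrDeSitter.diffAt Ω.isOpen (hf.smooth i) hy

theorem congr (hf : ExpSymbol Ω H k δ f) (h : ∀ i, Set.EqOn (g i) (f i) Ω) :
    ExpSymbol Ω H k δ g :=
  ⟨fun i => (hf.smooth i).congr (h i), fun n => (hf.bounds n).congr h⟩

theorem pd (hf : ExpSymbol Ω H k δ f) (μ : Fin 4) : ExpSymbol Ω H k δ fun i => pd μ (f i) :=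
  ⟨fun i => ContDiffOn.pd Ω.isOpen (hf.smooth i) μ, fun n => (hf.bounds (n + 1)).2 μ⟩

theorem add (hf : ExpSymbol Ω H k δ f) (hg : ExpSymbol Ω H k δ g) :
    ExpSymbol Ω H k δ fun i y => f i y + g i y :=
  ⟨fun i => (hf.smooth i).add (hg.smooth i),
    fun n => (hf.bounds n).add hf.smooth hg.smooth (hg.bounds n)⟩

theorem mul' (hf : ExpSymbol Ω H k δ f) (hg : ExpSymbol Ω H l δ' g) :
    ExpSymbol Ω H (k + l) (fun i => δ i * δ' i) fun i y => f i y * g i y :=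
  ⟨fun i => (hf.smooth i).mul (hg.smooth i),
    fun n => (hf.bounds n).mul hf.smooth hg.smooth (hg.bounds n)⟩

theorem mul (hf : ExpSymbol Ω H k δ f) (hg : ExpSymbol Ω H l (fun _ => 1) g) :
    ExpSymbol Ω H (k + l) δ fun i y => f i y * g i y := by
  simpa using hf.mul' hg

theorem mul_left (hf : ExpSymbol Ω H k (fun _ => 1) f) (hg : ExpSymbol Ω H l δ g) :
    ExpSymbol Ω H (k + l) δ fun i y => f i y * g i y := by
  simpa using hf.mul' hg

theorem mono {s₁ : ℝ} (hH : 0 ≤ H) (hs : ∀ y ∈ Ω, s₁ ≤ y 0) (hδ : ∀ i, 0 ≤ δ i) (hkl : l ≤ k)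
    (hf : ExpSymbol Ω H k δ f) : ExpSymbol Ω H l δ f :=
  ⟨hf.smooth, fun n => (hf.bounds n).mono hH hs hδ hkl⟩

theorem comp (r : ι' → ι) (hf : ExpSymbol Ω H k δ f) :
    ExpSymbol Ω H k (fun i => δ (r i)) fun i => f (r i) :=
  ⟨fun i => hf.smooth (r i), fun n => (hf.bounds n).comp r⟩

theorem zero : ExpSymbol Ω H k δ fun _ _ => 0 := by
  refine ⟨fun i => contDiffOn_const, fun n => ?_⟩
  have h0 : ExpBound Ω H k δ fun _ _ => 0 := ⟨0, fun i y _ => by simp⟩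
  induction n with
  | zero => exact h0
  | succ n ih => exact ⟨h0, fun μ => ih.congr fun i y _ => pd_const 0 μ⟩

/-- Constants with values bounded by `δ`. -/
theorem const {c : ι → ℝ} (hc : ∃ C, ∀ i, |c i| ≤ C * δ i) :
    ExpSymbol Ω H 0 δ fun i _ => c i := by
  refine ⟨fun i => contDiffOn_const, fun n => ?_⟩
  have h0 : ExpBound Ω H 0 δ fun i _ => c i := by
    obtain ⟨C, hC⟩ := hc
    exact ⟨C, fun i y _ => by simpa using hC i⟩
  cases n with
  | zero => exact h0
  | succ n => exact ⟨h0, fun μ => (zero.bounds n).congr fun i y _ => pd_const (c i) μ⟩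

theorem const_one (c : ℝ) : ExpSymbol (ι := ι) Ω H 0 (fun _ => 1) fun _ _ => c :=
  const ⟨|c|, fun i => by simp⟩

theorem const_mul (c : ℝ) (hf : ExpSymbol Ω H k δ f) : ExpSymbol Ω H k δ fun i y => c * f i y := by
  simpa using (const_one c).mul_left hf

theorem neg (hf : ExpSymbol Ω H k δ f) : ExpSymbol Ω H k δ fun i y => -f i y := by
  simpa using hf.const_mul (-1)

theorem sub (hf : ExpSymbol Ω H k δ f) (hg : ExpSymbol Ω H k δ g) :
    ExpSymbol Ω H k δ fun i y => f i y - g i y := by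
  simpa [sub_eq_add_neg] using hf.add hg.neg

theorem sum {κ : Type*} {s : Finset κ} {F : κ → ι → Coord → ℝ}
    (hF : ∀ j ∈ s, ExpSymbol Ω H k δ (F j)) : ExpSymbol Ω H k δ fun i y => ∑ j ∈ s, F j i y := by
  classical
  induction s using Finset.induction_on with
  | empty => simpa using zero
  | insert a s ha ih =>
    simp only [Finset.sum_insert ha]
    exact (hF a (Finset.mem_insert_self a s)).add
      (ih fun j hj => hF j (Finset.mem_insert_of_mem hj))

/-- The functions `e^{-kHs}`. -/
theorem exp (k : ℤ) : ExpSymbol (ι := ι) Ω H k (fun _ => 1) fun _ y => Real.exp (-k * H * y 0) := by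
  have hs : ContDiff ℝ ∞ fun y : Coord => Real.exp (-k * H * y 0) := by fun_prop
  have hpd : ∀ (c : ℝ) (μ : Fin 4) (y : Coord), KerrDeSitter.pd μ
      (fun y => c * Real.exp (-k * H * y 0)) y
      = (if μ = 0 then c * (-k * H) else 0) * Real.exp (-k * H * y 0) := fun c μ y => by
    have h : HasFDerivAt (fun y : Coord => c * Real.exp (-k * H * y 0)) (c •
        (Real.exp (-k * H * y 0) •
          ((-k * H : ℝ) • (ContinuousLinearMap.proj 0 : Coord →L[ℝ] ℝ)))) y :=
      (((ContinuousLinearMap.proj 0 : Coord →L[ℝ] ℝ).hasFDerivAt).const_mul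
        (-k * H : ℝ)).exp.const_mul c
    rw [KerrDeSitter.pd, h.fderiv]
    by_cases hμ : μ = 0
    · subst hμ; simp; ring
    · simp [hμ, Ne.symm hμ]
  have key : ∀ n (c : ℝ), ExpBounds (ι := ι) Ω H k (fun _ => 1) n
      fun _ y => c * Real.exp (-k * H * y 0) := fun n => by
    have h0 : ∀ c : ℝ, ExpBound (ι := ι) Ω H k (fun _ => 1)
        fun _ y => c * Real.exp (-k * H * y 0) := fun c =>
      ⟨|c|, fun i y _ => by rw [abs_mul, Real.abs_exp, mul_one]⟩
    induction n with
    | zero => exact h0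
    | succ n ih => exact fun c => ⟨h0 c, fun μ => (ih _).congr fun i y _ => hpd c μ y⟩
  exact ⟨fun i => hs.contDiffOn, fun n => by simpa using key n 1⟩

/-- Families closed under a differential identity `∂_μ f = F μ` with `F μ` controlled by the
derivatives of `f` of lower order. -/
theorem of_pd (hs : ∀ i, ContDiffOn ℝ ∞ (f i) Ω) (h0 : ExpBound Ω H k δ f)
    (hstep : ∀ n, ExpBounds Ω H k δ n f →
      ∀ μ, ExpBounds Ω H k δ n fun i => KerrDeSitter.pd μ (f i)) :
    ExpSymbol Ω H k δ f := by
  refine ⟨hs, fun n => ?_⟩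
  induction n with
  | zero => exact h0
  | succ n ih => exact ⟨h0, hstep n ih⟩

/-- Reciprocals of families bounded away from zero. -/
theorem inv (hf : ExpSymbol Ω H 0 (fun _ => 1) f) {c : ℝ} (hc : 0 < c)
    (hfc : ∀ i, ∀ y ∈ Ω, c ≤ |f i y|) : ExpSymbol Ω H 0 (fun _ => 1) fun i y => (f i y)⁻¹ := by
  have hne : ∀ i, ∀ y ∈ Ω, f i y ≠ 0 := fun i y hy =>
    abs_pos.mp (hc.trans_le (hfc i y hy))
  have hs : ∀ i, ContDiffOn ℝ ∞ (fun y => (f i y)⁻¹) Ω := fun i => (hf.smooth i).inv (hne i)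
  refine of_pd hs ⟨c⁻¹, fun i y hy => ?_⟩ fun n hn μ => ?_
  · rw [abs_inv]
    simpa using inv_anti₀ hc (hfc i y hy)
  · have h := ((hf.pd μ).neg.bounds n).mul (hf.pd μ).neg.smooth
      (fun i => (hs i).mul (hs i)) (hn.mul hs hs hn)
    simp only [add_zero, mul_one] at h
    refine h.congr fun i y hy => ?_
    have hg : HasFDerivAt (fun y => (f i y)⁻¹) _ y :=
      (hasDerivAt_inv (hne i y hy)).comp_hasFDerivAt y (hf.diffAt i hy).hasFDerivAt
    rw [KerrDeSitter.pd, hg.fderiv, smul_apply, ← KerrDeSitter.pd, smul_eq_mul]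
    field_simp

/-- Reciprocal square roots of families bounded below by a positive constant. -/
theorem inv_sqrt (hf : ExpSymbol Ω H 0 (fun _ => 1) f) {c : ℝ} (hc : 0 < c)
    (hfc : ∀ i, ∀ y ∈ Ω, c ≤ f i y) :
    ExpSymbol Ω H 0 (fun _ => 1) fun i y => (Real.sqrt (f i y))⁻¹ := by
  have hpos : ∀ i, ∀ y ∈ Ω, 0 < f i y := fun i y hy => hc.trans_le (hfc i y hy)
  have hsq : ∀ i, ∀ y ∈ Ω, 0 < Real.sqrt (f i y) := fun i y hy => Real.sqrt_pos.mpr (hpos i y hy)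
  have hs : ∀ i, ContDiffOn ℝ ∞ (fun y => (Real.sqrt (f i y))⁻¹) Ω := fun i =>
    ((hf.smooth i).sqrt fun y hy => (hpos i y hy).ne').inv fun y hy => (hsq i y hy).ne'
  refine of_pd hs ⟨(Real.sqrt c)⁻¹, fun i y hy => ?_⟩ fun n hn μ => ?_
  · rw [abs_of_nonneg (inv_nonneg.mpr (hsq i y hy).le)]
    simpa using inv_anti₀ (Real.sqrt_pos.mpr hc) (Real.sqrt_le_sqrt (hfc i y hy))
  · have hp := (hf.pd μ).const_mul (-1 / 2)
    have h := (hp.bounds n).mul hp.smooth (fun i => (hs i).mul ((hs i).mul (hs i)))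
      (hn.mul hs (fun i => (hs i).mul (hs i)) (hn.mul hs hs hn))
    simp only [add_zero, mul_one] at h
    refine h.congr fun i y hy => ?_
    have hg : HasFDerivAt (fun y => (Real.sqrt (f i y))⁻¹) _ y :=
      ((hasDerivAt_inv (hsq i y hy).ne').comp _
        (Real.hasDerivAt_sqrt (hpos i y hy).ne')).comp_hasFDerivAt y (hf.diffAt i hy).hasFDerivAt
    rw [KerrDeSitter.pd, hg.fderiv, smul_apply, ← KerrDeSitter.pd, smul_eq_mul]
    have := (hsq i y hy).ne'
    field_simp

/-- Inverses of matrix families, when the inverse is bounded. -/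
theorem matrix_inv {m : Type*} [Fintype m] [DecidableEq m] {M : ι → Coord → Matrix m m ℝ}
    (hM : ∀ p q, ExpSymbol Ω H 0 (fun _ => 1) fun i y => M i y p q)
    (hdet : ∀ i, ∀ y ∈ Ω, (M i y).det ≠ 0)
    (hb : ∀ p q, ExpBound Ω H 0 (fun _ => 1) fun i y => (M i y)⁻¹ p q) (p q : m) :
    ExpSymbol Ω H 0 (fun _ => 1) fun i y => (M i y)⁻¹ p q := by
  have hs : ∀ p q i, ContDiffOn ℝ ∞ (fun y => (M i y)⁻¹ p q) Ω := fun p q i =>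
    contDiffOn_inv_entry (fun p q => (hM p q).smooth i) (hdet i) p q
  have hpd : ∀ μ p q i, ∀ y ∈ Ω, KerrDeSitter.pd μ (fun y => (M i y)⁻¹ p q) y
      = ∑ k, ∑ l, -KerrDeSitter.pd μ (fun y => M i y k l) y
        * ((M i y)⁻¹ p k * (M i y)⁻¹ l q) := by
    intro μ p q i y hy
    have hMd := fun k l => (hM k l).diffAt i hy
    have hId := fun k l => KerrDeSitter.diffAt Ω.isOpen (hs k l i) hy
    -- differentiate `M⁻¹ M = 1`
    have h1 : ∀ r, ∑ k, KerrDeSitter.pd μ (fun y => (M i y)⁻¹ p k) y * M i y k r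
        = -∑ k, (M i y)⁻¹ p k * KerrDeSitter.pd μ (fun y => M i y k r) y := fun r => by
      have he : Set.EqOn (fun y => ∑ k, (M i y)⁻¹ p k * M i y k r)
          (fun _ => (1 : Matrix m m ℝ) p r) Ω := fun z hz => by
        simp only [← Matrix.mul_apply]
        rw [Matrix.nonsing_inv_mul _ (isUnit_iff_ne_zero.mpr (hdet i z hz))]
      have := pd_eqOn Ω.isOpen he μ hy
      rw [pd_const, pd_sum fun k _ => (hId p k).fun_mul (hMd k r)] at this
      simp only [fun k => pd_mul (hId p k) (hMd k r) μ, Finset.sum_add_distrib] at this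
      linarith
    have h2 : ∀ k, ∑ r, M i y k r * (M i y)⁻¹ r q = (1 : Matrix m m ℝ) k q := fun k => by
      rw [← Matrix.mul_apply, Matrix.mul_nonsing_inv _ (isUnit_iff_ne_zero.mpr (hdet i y hy))]
    calc KerrDeSitter.pd μ (fun y => (M i y)⁻¹ p q) y
        = ∑ k, KerrDeSitter.pd μ (fun y => (M i y)⁻¹ p k) y
            * ∑ r, M i y k r * (M i y)⁻¹ r q := by
          simp [h2, Matrix.one_apply]
      _ = ∑ r, (∑ k, KerrDeSitter.pd μ (fun y => (M i y)⁻¹ p k) y * M i y k r)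
            * (M i y)⁻¹ r q := by
          simp only [Finset.mul_sum, Finset.sum_mul]
          rw [Finset.sum_comm]
          exact Finset.sum_congr rfl fun r _ => Finset.sum_congr rfl fun k _ => by ring
      _ = _ := by
          simp only [h1, ← Finset.sum_neg_distrib, Finset.sum_mul]
          rw [Finset.sum_comm]
          exact Finset.sum_congr rfl fun r _ => Finset.sum_congr rfl fun k _ => by ring
  have key : ∀ n p q, ExpBounds Ω H 0 (fun _ => 1) n fun i y => (M i y)⁻¹ p q := by
    intro n
    induction n with
    | zero => exact hb
    | succ n ih =>
      refine fun p q => ⟨hb p q, fun μ => ?_⟩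
      have hsum : ∀ (s : Finset m) (F : m → ι → Coord → ℝ),
          (∀ k i, ContDiffOn ℝ ∞ (F k i) Ω) → (∀ k, ExpBounds Ω H 0 (fun _ => 1) n (F k)) →
          ExpBounds Ω H 0 (fun _ => 1) n fun i y => ∑ k ∈ s, F k i y := by
        intro s F hF hFb
        induction s using Finset.induction_on with
        | empty => simpa using zero.bounds n
        | insert a s ha ihs =>
          simp only [Finset.sum_insert ha]
          exact (hFb a).add (hF a) (fun i => ContDiffOn.sum fun k _ => hF k i) ihs
      have hterm : ∀ k l i, ContDiffOn ℝ ∞ (fun y => -KerrDeSitter.pd μ (fun y => M i y k l) y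
          * ((M i y)⁻¹ p k * (M i y)⁻¹ l q)) Ω := fun k l i =>
        (((hM k l).pd μ).neg.smooth i).mul ((hs p k i).mul (hs l q i))
      refine (hsum Finset.univ _ (fun k i => ContDiffOn.sum fun l _ => hterm k l i) fun k =>
        hsum Finset.univ _ (fun l i => hterm k l i) fun l => ?_).congr
          fun i y hy => hpd μ p q i y hy
      have h := (((hM k l).pd μ).neg.bounds n).mul ((hM k l).pd μ).neg.smooth
        (fun i => (hs p k i).mul (hs l q i)) ((ih p k).mul (hs p k) (hs l q) (ih l q))
      simpa only [add_zero, mul_one] using h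
  exact ⟨hs p q, fun n => key n p q⟩

theorem iterate_pd (hf : ExpSymbol Ω H k δ f) (μ : Fin 4) (n : ℕ) :
    ExpSymbol Ω H k δ fun i => (KerrDeSitter.pd μ)^[n] (f i) := by
  induction n with
  | zero => exact hf
  | succ n ih =>
    simp only [Function.iterate_succ_apply']
    exact ih.pd μ

theorem spatialD (hf : ExpSymbol Ω H k δ f) (α : Fin 3 → ℕ) :
    ExpSymbol Ω H k δ fun i => spatialD α (f i) :=
  ((hf.iterate_pd 3 (α 2)).iterate_pd 2 (α 1)).iterate_pd 1 (α 0)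

end ExpSymbol

end Symbols

/-! ### Comparison of the curvatures of two metrics -/

section Comparison

open TopologicalSpace

variable {ι : Type*} {Ω : Opens Coord} {H : ℝ} {d : ℤ} {δ : ι → ℝ} {k l : ℤ}
  {f f' g g' : ι → Coord → ℝ}

/-- Two families of size `e^{-kHs}` whose difference is of size `e^{-(k+d)Hs} δ`. -/
structure ExpClose (Ω : Opens Coord) (H : ℝ) (d : ℤ) (δ : ι → ℝ) (k : ℤ) (f f' : ι → Coord → ℝ) :
    Prop where
  left : ExpSymbol Ω H k (fun _ => 1) f
  right : ExpSymbol Ω H k (fun _ => 1) f'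
  diff : ExpSymbol Ω H (k + d) δ fun i y => f i y - f' i y

namespace ExpClose

theorem refl (hf : ExpSymbol Ω H k (fun _ => 1) f) : ExpClose Ω H d δ k f f :=
  ⟨hf, hf, by simpa using ExpSymbol.zero⟩

theorem add (hf : ExpClose Ω H d δ k f f') (hg : ExpClose Ω H d δ k g g') :
    ExpClose Ω H d δ k (fun i y => f i y + g i y) fun i y => f' i y + g' i y :=
  ⟨hf.left.add hg.left, hf.right.add hg.right,
    (hf.diff.add hg.diff).congr fun i y _ => by ring⟩

theorem neg (hf : ExpClose Ω H d δ k f f') :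
    ExpClose Ω H d δ k (fun i y => -f i y) fun i y => -f' i y :=
  ⟨hf.left.neg, hf.right.neg, hf.diff.neg.congr fun i y _ => by ring⟩

theorem sub (hf : ExpClose Ω H d δ k f f') (hg : ExpClose Ω H d δ k g g') :
    ExpClose Ω H d δ k (fun i y => f i y - g i y) fun i y => f' i y - g' i y := by
  simpa only [sub_eq_add_neg] using hf.add hg.neg

theorem mul (hf : ExpClose Ω H d δ k f f') (hg : ExpClose Ω H d δ l g g') :
    ExpClose Ω H d δ (k + l) (fun i y => f i y * g i y) fun i y => f' i y * g' i y := by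
  refine ⟨hf.left.mul hg.left, hf.right.mul hg.right, ?_⟩
  have h1 := hf.diff.mul hg.left
  have h2 := hf.right.mul_left hg.diff
  rw [show k + d + l = k + l + d by ring] at h1
  rw [← add_assoc] at h2
  exact (h1.add h2).congr fun i y _ => by ring

theorem const_mul (c : ℝ) (hf : ExpClose Ω H d δ k f f') :
    ExpClose Ω H d δ k (fun i y => c * f i y) fun i y => c * f' i y := by
  simpa using (refl (ExpSymbol.const_one c)).mul hf

theorem pd (hf : ExpClose Ω H d δ k f f') (μ : Fin 4) :
    ExpClose Ω H d δ k (fun i => pd μ (f i)) fun i => pd μ (f' i) :=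
  ⟨hf.left.pd μ, hf.right.pd μ, (hf.diff.pd μ).congr fun i _ hy =>
    (pd_sub (hf.left.diffAt i hy) (hf.right.diffAt i hy) μ).symm⟩

theorem sum {κ : Type*} {s : Finset κ} {F F' : κ → ι → Coord → ℝ}
    (hF : ∀ j ∈ s, ExpClose Ω H d δ k (F j) (F' j)) :
    ExpClose Ω H d δ k (fun i y => ∑ j ∈ s, F j i y) fun i y => ∑ j ∈ s, F' j i y :=
  ⟨.sum fun j hj => (hF j hj).left, .sum fun j hj => (hF j hj).right,
    (ExpSymbol.sum fun j hj => (hF j hj).diff).congr fun i y _ => by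
      simp [Finset.sum_sub_distrib]⟩

theorem mono {s₁ : ℝ} (hH : 0 ≤ H) (hs : ∀ y ∈ Ω, s₁ ≤ y 0) (hδ : ∀ i, 0 ≤ δ i) (hkl : l ≤ k)
    (hf : ExpClose Ω H d δ k f f') : ExpClose Ω H d δ l f f' :=
  ⟨hf.left.mono hH hs (fun _ => zero_le_one) hkl, hf.right.mono hH hs (fun _ => zero_le_one) hkl,
    hf.diff.mono hH hs hδ (by linarith)⟩

theorem inv (hf : ExpClose Ω H d δ 0 f f') {c : ℝ} (hc : 0 < c)
    (hfc : ∀ i, ∀ y ∈ Ω, c ≤ |f i y|) (hfc' : ∀ i, ∀ y ∈ Ω, c ≤ |f' i y|) :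
    ExpClose Ω H d δ 0 (fun i y => (f i y)⁻¹) fun i y => (f' i y)⁻¹ := by
  have h1 := hf.left.inv hc hfc
  have h2 := hf.right.inv hc hfc'
  have h3 := (hf.diff.neg.mul h1).mul h2
  rw [add_zero, add_zero] at h3
  refine ⟨h1, h2, h3.congr fun i y hy => ?_⟩
  have e1 : f i y ≠ 0 := abs_pos.mp (hc.trans_le (hfc i y hy))
  have e2 : f' i y ≠ 0 := abs_pos.mp (hc.trans_le (hfc' i y hy))
  field_simp
  ring

end ExpClose

/-- The decay exponents of the components of a metric `-Φ² ds² + e^{2Hs} h_{ij} dxⁱ dxʲ`. -/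
def metricExp (μ ν : Fin 4) : ℤ := if μ = 0 ∨ ν = 0 then 0 else -2

/-- The decay exponents of the components of the inverse metric. -/
def inverseExp (μ ν : Fin 4) : ℤ := if μ = 0 ∧ ν = 0 then 0 else 2

/-- The decay exponents of the Christoffel symbols. -/
def christoffelExp (κ μ ν : Fin 4) : ℤ :=
  if κ = 0 then metricExp μ ν else if μ = 0 ∧ ν = 0 then 2 else 0

/-- A family of metrics of the form `-Φ² ds² + e^{2Hs} h_{ij} dxⁱ dxʲ` with `Φ`, `h` and their
inverses uniformly bounded with all derivatives. -/
structure MetricFamily (Ω : Opens Coord) (H : ℝ) (g : ι → Coord → Matrix (Fin 4) (Fin 4) ℝ) :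
    Prop where
  entry : ∀ μ ν, ExpSymbol Ω H (metricExp μ ν) (fun _ => 1) fun i y => g i y μ ν
  inv_entry : ∀ μ ν, ExpSymbol Ω H (inverseExp μ ν) (fun _ => 1) fun i y => (g i y)⁻¹ μ ν
  det_ne_zero : ∀ i, ∀ y ∈ Ω, (g i y).det ≠ 0

/-- Two such families whose difference is smaller by the factor `e^{-dHs} δ`. -/
structure CloseMetrics (Ω : Opens Coord) (H : ℝ) (d : ℤ) (δ : ι → ℝ)
    (g g' : ι → Coord → Matrix (Fin 4) (Fin 4) ℝ) : Prop where
  left : MetricFamily Ω H g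
  right : MetricFamily Ω H g'
  diff : ∀ μ ν, ExpSymbol Ω H (metricExp μ ν + d) δ fun i y => g i y μ ν - g' i y μ ν

namespace CloseMetrics

variable {g g' : ι → Coord → Matrix (Fin 4) (Fin 4) ℝ} {s₁ : ℝ}

theorem entry (hg : CloseMetrics Ω H d δ g g') (μ ν : Fin 4) :
    ExpClose Ω H d δ (metricExp μ ν) (fun i y => g i y μ ν) fun i y => g' i y μ ν :=
  ⟨hg.left.entry μ ν, hg.right.entry μ ν, hg.diff μ ν⟩

theorem inv_entry (hg : CloseMetrics Ω H d δ g g') (hH : 0 ≤ H) (hs : ∀ y ∈ Ω, s₁ ≤ y 0)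
    (hδ : ∀ i, 0 ≤ δ i) (κ l : Fin 4) :
    ExpClose Ω H d δ (inverseExp κ l) (fun i y => (g i y)⁻¹ κ l) fun i y => (g' i y)⁻¹ κ l := by
  refine ⟨hg.left.inv_entry κ l, hg.right.inv_entry κ l, ?_⟩
  have hexp : ∀ κ l p q : Fin 4,
      inverseExp κ l ≤ inverseExp κ p + metricExp p q + inverseExp q l := by decide
  -- `g⁻¹ - g'⁻¹ = g⁻¹ (g' - g) g'⁻¹`
  have h : ExpSymbol Ω H (inverseExp κ l + d) δ fun i y => ∑ p, ∑ q,
      (g i y)⁻¹ κ p * -(g i y p q - g' i y p q) * (g' i y)⁻¹ q l := by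
    refine ExpSymbol.sum fun p _ => ExpSymbol.sum fun q _ => ?_
    refine (((hg.left.inv_entry κ p).mul_left (hg.diff p q).neg).mul
      (hg.right.inv_entry q l)).mono hH hs hδ ?_
    linarith [hexp κ l p q]
  refine h.congr fun i y hy => ?_
  have e : (g i y)⁻¹ - (g' i y)⁻¹ = (g i y)⁻¹ * -(g i y - g' i y) * (g' i y)⁻¹ := by
    rw [neg_sub, Matrix.mul_sub, Matrix.sub_mul,
      Matrix.nonsing_inv_mul _ (isUnit_iff_ne_zero.mpr (hg.left.det_ne_zero i y hy)),
      Matrix.one_mul, Matrix.mul_assoc,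
      Matrix.mul_nonsing_inv _ (isUnit_iff_ne_zero.mpr (hg.right.det_ne_zero i y hy)),
      Matrix.mul_one]
  have := congrFun (congrFun e κ) l
  simp only [Matrix.sub_apply, Matrix.mul_apply, Matrix.neg_apply, Finset.sum_mul] at this
  rw [Finset.sum_comm] at this
  exact this

theorem christoffel (hg : CloseMetrics Ω H d δ g g') (hH : 0 ≤ H) (hs : ∀ y ∈ Ω, s₁ ≤ y 0)
    (hδ : ∀ i, 0 ≤ δ i) (κ μ ν : Fin 4) :
    ExpClose Ω H d δ (christoffelExp κ μ ν) (fun i => christoffel (g i) κ μ ν)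
      fun i => KerrDeSitter.christoffel (g' i) κ μ ν := by
  have hexp : ∀ κ μ ν l : Fin 4, christoffelExp κ μ ν ≤ inverseExp κ l + metricExp ν l ∧
      christoffelExp κ μ ν ≤ inverseExp κ l + metricExp μ l ∧
      christoffelExp κ μ ν ≤ inverseExp κ l + metricExp μ ν := by decide
  refine ExpClose.const_mul (1 / 2) (ExpClose.sum fun l _ => ?_)
  obtain ⟨h1, h2, h3⟩ := hexp κ μ ν l
  have hi := hg.inv_entry hH hs hδ κ l
  simp only [mul_sub, mul_add]
  exact (((hi.mul ((hg.entry ν l).pd μ)).mono hH hs hδ h1).add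
    ((hi.mul ((hg.entry μ l).pd ν)).mono hH hs hδ h2)).sub
    ((hi.mul ((hg.entry μ ν).pd l)).mono hH hs hδ h3)

theorem ricci (hg : CloseMetrics Ω H d δ g g') (hH : 0 ≤ H) (hs : ∀ y ∈ Ω, s₁ ≤ y 0)
    (hδ : ∀ i, 0 ≤ δ i) (μ ν : Fin 4) :
    ExpClose Ω H d δ (metricExp μ ν) (fun i => ricci (g i) μ ν)
      fun i => KerrDeSitter.ricci (g' i) μ ν := by
  have hexp : ∀ κ μ ν l : Fin 4, metricExp μ ν ≤ christoffelExp κ ν μ ∧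
      metricExp μ ν ≤ christoffelExp κ κ μ ∧
      metricExp μ ν ≤ christoffelExp κ κ l + christoffelExp l ν μ ∧
      metricExp μ ν ≤ christoffelExp κ ν l + christoffelExp l κ μ := by decide
  have hΓ := fun κ μ ν => hg.christoffel hH hs hδ κ μ ν
  refine (ExpClose.sum fun κ _ => ?_).add (ExpClose.sum fun κ _ => ExpClose.sum fun l _ => ?_)
  · obtain ⟨h1, h2, -⟩ := hexp κ μ ν 0
    exact (((hΓ κ ν μ).pd κ).mono hH hs hδ h1).sub (((hΓ κ κ μ).pd ν).mono hH hs hδ h2)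
  · obtain ⟨-, -, h1, h2⟩ := hexp κ μ ν l
    exact (((hΓ κ κ l).mul (hΓ l ν μ)).mono hH hs hδ h1).sub
      (((hΓ κ ν l).mul (hΓ l κ μ)).mono hH hs hδ h2)

end CloseMetrics

theorem MetricFamily.refl {g : ι → Coord → Matrix (Fin 4) (Fin 4) ℝ} (hg : MetricFamily Ω H g) :
    CloseMetrics Ω H d δ g g :=
  ⟨hg, hg, fun _ _ => by simpa using ExpSymbol.zero⟩

/-- The deviation `Ric - Λ g` from a solution of the Einstein equation. -/
def einstein (Λ : ℝ) (g : Coord → Matrix (Fin 4) (Fin 4) ℝ) (μ ν : Fin 4) (y : Coord) : ℝ :=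
  ricci g μ ν y - Λ * g y μ ν

theorem CloseMetrics.einstein {g g' : ι → Coord → Matrix (Fin 4) (Fin 4) ℝ} {s₁ : ℝ} (Λ : ℝ)
    (hg : CloseMetrics Ω H d δ g g') (hH : 0 ≤ H) (hs : ∀ y ∈ Ω, s₁ ≤ y 0) (hδ : ∀ i, 0 ≤ δ i)
    (μ ν : Fin 4) : ExpClose Ω H d δ (metricExp μ ν) (fun i => einstein Λ (g i) μ ν)
      fun i => KerrDeSitter.einstein Λ (g' i) μ ν :=
  (hg.ricci hH hs hδ μ ν).sub ((hg.entry μ ν).const_mul Λ)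

end Comparison

/-! ### Asymptotic models -/

section Model

/-- A metric of the form `-ds² + e^{2Hs} h_{ij} dxⁱ dxʲ` with `h` independent of `s`. -/
structure IsAsymptoticModel (Ω : Set Coord) (H : ℝ) (g : Coord → Matrix (Fin 4) (Fin 4) ℝ) :
    Prop where
  isOpen : IsOpen Ω
  zero_zero : ∀ y ∈ Ω, g y 0 0 = -1
  zero_succ : ∀ y ∈ Ω, ∀ i : Fin 3, g y 0 i.succ = 0
  symm : ∀ y ∈ Ω, ∀ μ ν, g y μ ν = g y ν μ
  pd_zero : ∀ y ∈ Ω, ∀ i j : Fin 3, pd 0 (fun z => g z i.succ j.succ) y = 2 * H * g y i.succ j.succ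
  det_ne_zero : ∀ y ∈ Ω, (g y).det ≠ 0

namespace IsAsymptoticModel

variable {Ω : Set Coord} {H : ℝ} {g : Coord → Matrix (Fin 4) (Fin 4) ℝ}

theorem succ_zero (M : IsAsymptoticModel Ω H g) {y : Coord} (hy : y ∈ Ω) (i : Fin 3) :
    g y i.succ 0 = 0 := by
  rw [M.symm y hy, M.zero_succ y hy]

theorem inv_mul (M : IsAsymptoticModel Ω H g) {y : Coord} (hy : y ∈ Ω) (μ ν : Fin 4) :
    ∑ l, (g y)⁻¹ μ l * g y l ν = if μ = ν then 1 else 0 := by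
  rw [← Matrix.mul_apply, Matrix.nonsing_inv_mul _ (isUnit_iff_ne_zero.mpr (M.det_ne_zero y hy)),
    Matrix.one_apply]

theorem mul_inv (M : IsAsymptoticModel Ω H g) {y : Coord} (hy : y ∈ Ω) (μ ν : Fin 4) :
    ∑ l, g y μ l * (g y)⁻¹ l ν = if μ = ν then 1 else 0 := by
  rw [← Matrix.mul_apply, Matrix.mul_nonsing_inv _ (isUnit_iff_ne_zero.mpr (M.det_ne_zero y hy)),
    Matrix.one_apply]

theorem inv_zero_zero (M : IsAsymptoticModel Ω H g) {y : Coord} (hy : y ∈ Ω) :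
    (g y)⁻¹ 0 0 = -1 := by
  have h := M.mul_inv hy 0 0
  simp only [Fin.sum_univ_succ (n := 3), M.zero_zero y hy, M.zero_succ y hy, zero_mul,
    Finset.sum_const_zero, if_true] at h
  linarith

theorem inv_zero_succ (M : IsAsymptoticModel Ω H g) {y : Coord} (hy : y ∈ Ω) (i : Fin 3) :
    (g y)⁻¹ 0 i.succ = 0 := by
  have h := M.mul_inv hy 0 i.succ
  rw [if_neg (Fin.succ_ne_zero i).symm] at h
  simp only [Fin.sum_univ_succ (n := 3), M.zero_zero y hy, M.zero_succ y hy, zero_mul,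
    Finset.sum_const_zero] at h
  linarith

theorem inv_succ_zero (M : IsAsymptoticModel Ω H g) {y : Coord} (hy : y ∈ Ω) (i : Fin 3) :
    (g y)⁻¹ i.succ 0 = 0 := by
  have h := M.inv_mul hy i.succ 0
  rw [if_neg (Fin.succ_ne_zero i)] at h
  simp only [Fin.sum_univ_succ (n := 3), M.zero_zero y hy, M.succ_zero hy, mul_zero,
    Finset.sum_const_zero] at h
  linarith

theorem pd_zero_zero (M : IsAsymptoticModel Ω H g) {y : Coord} (hy : y ∈ Ω) (μ : Fin 4) :
    pd μ (fun z => g z 0 0) y = 0 := by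
  rw [pd_eqOn M.isOpen (fun z hz => M.zero_zero z hz) μ hy, pd_const]

theorem pd_zero_succ (M : IsAsymptoticModel Ω H g) {y : Coord} (hy : y ∈ Ω) (μ : Fin 4)
    (i : Fin 3) :
    pd μ (fun z => g z 0 i.succ) y = 0 := by
  rw [pd_eqOn M.isOpen (fun z hz => M.zero_succ z hz i) μ hy, pd_const]

theorem pd_succ_zero (M : IsAsymptoticModel Ω H g) {y : Coord} (hy : y ∈ Ω) (μ : Fin 4)
    (i : Fin 3) :
    pd μ (fun z => g z i.succ 0) y = 0 := by
  rw [pd_eqOn M.isOpen (fun z hz => M.succ_zero hz i) μ hy, pd_const]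

theorem christoffel_zero_zero (M : IsAsymptoticModel Ω H g) (κ : Fin 4) :
    Set.EqOn (christoffel g κ 0 0) (fun _ => 0) Ω :=
  fun y hy => by
    simp [christoffel, Fin.sum_univ_succ (n := 3), M.pd_zero_zero hy, M.pd_zero_succ hy]

theorem christoffel_zero_zero_succ (M : IsAsymptoticModel Ω H g) (j : Fin 3) :
    Set.EqOn (christoffel g 0 0 j.succ) (fun _ => 0) Ω := fun y hy => by
  simp [christoffel, Fin.sum_univ_succ (n := 3), M.pd_zero_zero hy, M.pd_zero_succ hy,
    M.pd_succ_zero hy, M.inv_zero_succ hy]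

theorem christoffel_zero_succ_zero (M : IsAsymptoticModel Ω H g) (j : Fin 3) :
    Set.EqOn (christoffel g 0 j.succ 0) (fun _ => 0) Ω := fun y hy => by
  simp [christoffel, Fin.sum_univ_succ (n := 3), M.pd_zero_zero hy, M.pd_zero_succ hy,
    M.pd_succ_zero hy, M.inv_zero_succ hy]

theorem christoffel_zero_succ_succ (M : IsAsymptoticModel Ω H g) (i j : Fin 3) :
    Set.EqOn (christoffel g 0 i.succ j.succ) (fun y => H * g y i.succ j.succ) Ω := fun y hy => by
  simp only [christoffel, Fin.sum_univ_succ (n := 3), M.pd_succ_zero hy, M.inv_zero_succ hy,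
    M.inv_zero_zero hy, M.pd_zero y hy, zero_mul, Finset.sum_const_zero]
  ring

theorem christoffel_succ_succ_zero (M : IsAsymptoticModel Ω H g) (i j : Fin 3) :
    Set.EqOn (christoffel g i.succ j.succ 0) (fun _ => if i = j then H else 0) Ω := fun y hy => by
  have h := M.inv_mul hy i.succ j.succ
  simp only [Fin.sum_univ_succ (n := 3), M.inv_succ_zero hy, zero_mul, zero_add,
    Fin.succ_inj] at h
  simp only [christoffel, Fin.sum_univ_succ (n := 3), M.pd_zero_succ hy, M.inv_succ_zero hy,
    M.pd_succ_zero hy, M.pd_zero y hy, zero_mul, zero_add, sub_zero,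
    M.symm y hy j.succ]
  have e : ∀ l : Fin 3, (g y)⁻¹ i.succ l.succ * (2 * H * g y l.succ j.succ)
      = 2 * H * ((g y)⁻¹ i.succ l.succ * g y l.succ j.succ) := fun l => by ring
  simp only [e, ← Finset.mul_sum, h]
  split_ifs <;> ring

theorem christoffel_comm (M : IsAsymptoticModel Ω H g) {y : Coord} (hy : y ∈ Ω) (κ μ ν : Fin 4) :
    christoffel g κ μ ν y = christoffel g κ ν μ y := by
  have hsym : ∀ μ ν l, pd l (fun z => g z μ ν) y = pd l (fun z => g z ν μ) y := fun μ ν l =>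
    pd_eqOn M.isOpen (fun z hz => M.symm z hz μ ν) l hy
  simp only [christoffel, hsym μ ν]
  congr 1
  exact Finset.sum_congr rfl fun l _ => by ring

theorem christoffel_succ_zero_succ (M : IsAsymptoticModel Ω H g) (i j : Fin 3) :
    Set.EqOn (christoffel g i.succ 0 j.succ) (fun _ => if i = j then H else 0) Ω := fun y hy => by
  rw [← M.christoffel_succ_succ_zero i j hy, M.christoffel_comm hy]

theorem einstein_zero_zero (M : IsAsymptoticModel Ω H g) {y : Coord} (hy : y ∈ Ω) :
    einstein (3 * H ^ 2) g 0 0 y = 0 := by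
  have hp : ∀ {f : Coord → ℝ} {c : ℝ} (μ : Fin 4), Set.EqOn f (fun _ => c) Ω → pd μ f y = 0 :=
    fun μ h => by rw [pd_eqOn M.isOpen h μ hy, pd_const]
  simp only [einstein, ricci, Fin.sum_univ_succ (n := 3), hp _ (M.christoffel_zero_zero _),
    hp _ (M.christoffel_succ_succ_zero _ _), M.christoffel_zero_zero _ hy,
    M.christoffel_zero_zero_succ _ hy, M.christoffel_zero_succ_zero _ hy,
    M.christoffel_succ_succ_zero _ _ hy, M.christoffel_succ_zero_succ _ _ hy, M.zero_zero y hy]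
  simp
  ring

theorem einstein_zero_succ (M : IsAsymptoticModel Ω H g) {y : Coord} (hy : y ∈ Ω) (k : Fin 3) :
    einstein (3 * H ^ 2) g 0 k.succ y = 0 := by
  have hp : ∀ {f : Coord → ℝ} {c : ℝ} (μ : Fin 4), Set.EqOn f (fun _ => c) Ω → pd μ f y = 0 :=
    fun μ h => by rw [pd_eqOn M.isOpen h μ hy, pd_const]
  simp only [einstein, ricci, Fin.sum_univ_succ (n := 3), hp _ (M.christoffel_zero_zero _),
    hp _ (M.christoffel_succ_succ_zero _ _), M.christoffel_zero_zero _ hy,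
    hp _ (M.christoffel_zero_succ_zero _),
    M.christoffel_zero_zero_succ _ hy, M.christoffel_zero_succ_zero _ hy,
    M.christoffel_succ_succ_zero _ _ hy, M.zero_succ y hy]
  simp [M.christoffel_comm hy _ k.succ]

/-- The spatial components of `Ric - 3H² g` only involve the spatial Christoffel symbols: they
are the Ricci curvature of the metric `h` of the model. -/
theorem einstein_succ_succ (M : IsAsymptoticModel Ω H g)
    (hsm : ∀ i j : Fin 3, ContDiffOn ℝ ∞ (fun z => g z i.succ j.succ) Ω)
    {y : Coord} (hy : y ∈ Ω) (i j : Fin 3) :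
    einstein (3 * H ^ 2) g i.succ j.succ y
      = (∑ k : Fin 3, (pd k.succ (christoffel g k.succ j.succ i.succ) y
          - pd j.succ (christoffel g k.succ k.succ i.succ) y))
        + ∑ k : Fin 3, ∑ l : Fin 3,
          (christoffel g k.succ k.succ l.succ y * christoffel g l.succ j.succ i.succ y
            - christoffel g k.succ j.succ l.succ y * christoffel g l.succ k.succ i.succ y) := by
  have hp : ∀ {f : Coord → ℝ} {c : ℝ} (μ : Fin 4), Set.EqOn f (fun _ => c) Ω → pd μ f y = 0 :=
    fun μ h => by rw [pd_eqOn M.isOpen h μ hy, pd_const]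
  have h0 : pd 0 (christoffel g 0 j.succ i.succ) y = 2 * H ^ 2 * g y j.succ i.succ := by
    rw [pd_eqOn M.isOpen (M.christoffel_zero_succ_succ j i) 0 hy,
      pd_mul (differentiableAt_const _) (diffAt M.isOpen (hsm j i) hy), pd_const,
      M.pd_zero y hy]
    ring
  simp only [einstein, ricci, Fin.sum_univ_succ (n := 3), h0,
    hp _ (M.christoffel_zero_zero_succ _), M.christoffel_zero_zero _ hy,
    M.christoffel_zero_zero_succ _ hy, M.christoffel_zero_succ_zero _ hy,
    M.christoffel_zero_succ_succ _ _ hy,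
    M.christoffel_succ_succ_zero _ _ hy, M.christoffel_succ_zero_succ _ _ hy,
    M.symm y hy j.succ i.succ]
  simp [Finset.sum_add_distrib]
  simp only [M.symm y hy _ i.succ]
  ring

end IsAsymptoticModel

end Model

/-! ### Metrics without shift -/

section Split

open TopologicalSpace

/-- A Lorentzian scalar product of the form `-Φ² ds² + g_{ij} dxⁱ dxʲ`. -/
structure SplitLorentz (G : Matrix (Fin 4) (Fin 4) ℝ) : Prop where
  zero_zero : G 0 0 < 0
  zero_succ : ∀ i : Fin 3, G 0 i.succ = 0
  succ_zero : ∀ i : Fin 3, G i.succ 0 = 0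
  posDef : (G.submatrix Fin.succ Fin.succ : Matrix (Fin 3) (Fin 3) ℝ).PosDef

namespace SplitLorentz

variable {G : Matrix (Fin 4) (Fin 4) ℝ}

theorem det_spatial_ne_zero (h : SplitLorentz G) :
    (G.submatrix Fin.succ Fin.succ : Matrix (Fin 3) (Fin 3) ℝ).det ≠ 0 :=
  h.posDef.det_pos.ne'

/-- The inverse in block form. -/
theorem blockInv_mul (h : SplitLorentz G) :
    (Matrix.of (Fin.cons (Fin.cons (G 0 0)⁻¹ fun _ => 0) fun i : Fin 3 =>
      Fin.cons 0 ((G.submatrix Fin.succ Fin.succ)⁻¹ i)) : Matrix (Fin 4) (Fin 4) ℝ) * G = 1 := by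
  have hS := Matrix.nonsing_inv_mul _ (isUnit_iff_ne_zero.mpr h.det_spatial_ne_zero)
  ext μ ν
  rw [Matrix.mul_apply, Fin.sum_univ_succ]
  refine Fin.cases ?_ (fun i => ?_) μ <;> refine Fin.cases ?_ (fun j => ?_) ν
  · simp [h.zero_zero.ne]
  · simp [h.zero_succ, (Fin.succ_ne_zero j).symm]
  · simp [h.succ_zero]
  · have := congrFun (congrFun hS i) j
    rw [Matrix.mul_apply] at this
    simpa [h.zero_succ, Matrix.one_apply] using this

theorem inv_eq (h : SplitLorentz G) : G⁻¹
    = Matrix.of (Fin.cons (Fin.cons (G 0 0)⁻¹ fun _ => 0) fun i : Fin 3 =>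
      Fin.cons 0 ((G.submatrix Fin.succ Fin.succ)⁻¹ i)) :=
  Matrix.inv_eq_left_inv h.blockInv_mul

theorem det_ne_zero (h : SplitLorentz G) : G.det ≠ 0 :=
  fun h0 => by
    have := congrArg Matrix.det h.blockInv_mul
    rw [Matrix.det_mul, h0, mul_zero, Matrix.det_one] at this
    exact zero_ne_one this

theorem inv_zero_zero (h : SplitLorentz G) : G⁻¹ 0 0 = (G 0 0)⁻¹ := by rw [h.inv_eq]; rfl

theorem inv_zero_succ (h : SplitLorentz G) (i : Fin 3) : G⁻¹ 0 i.succ = 0 := by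
  rw [h.inv_eq]; rfl

theorem inv_succ_zero (h : SplitLorentz G) (i : Fin 3) : G⁻¹ i.succ 0 = 0 := by
  rw [h.inv_eq]; rfl

theorem inv_succ_succ (h : SplitLorentz G) (i j : Fin 3) :
    G⁻¹ i.succ j.succ = (G.submatrix Fin.succ Fin.succ)⁻¹ i j := by
  rw [h.inv_eq]; rfl

theorem symm (h : SplitLorentz G) (i j : Fin 3) : G i.succ j.succ = G j.succ i.succ := by
  have := h.posDef.isHermitian.apply j i
  simpa using this

end SplitLorentz

section Errors

variable {Λ : ℝ} {g : Coord → Matrix (Fin 4) (Fin 4) ℝ} {y : Coord}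

theorem err00_eq (h : SplitLorentz (g y)) :
    err00 Λ g y = einstein Λ g 0 0 y * ((Real.sqrt (-g y 0 0))⁻¹ * (Real.sqrt (-g y 0 0))⁻¹) := by
  have h0 := h.zero_zero
  rw [err00, lapse, Real.sq_sqrt (by linarith), ← mul_inv, Real.mul_self_sqrt (by linarith),
    einstein]
  have h1 := h0.ne
  field_simp
  ring

theorem err0_eq (h : SplitLorentz (g y)) (j : Fin 3) :
    err0 g j y = ∑ k : Fin 3, (g y)⁻¹ j.succ k.succ
      * (einstein Λ g 0 k.succ y * (Real.sqrt (-g y 0 0))⁻¹) := by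
  simp only [err0, lapse, einstein, h.zero_succ, mul_zero, sub_zero, h.inv_succ_succ, spatial,
    div_eq_mul_inv]

theorem errSpatial_eq (h : SplitLorentz (g y)) (i j : Fin 3) :
    errSpatial Λ g i j y = ∑ k : Fin 3, (g y)⁻¹ j.succ k.succ * einstein Λ g i.succ k.succ y := by
  have hS := congrFun (congrFun
    (Matrix.nonsing_inv_mul _ (isUnit_iff_ne_zero.mpr h.det_spatial_ne_zero)) j) i
  rw [Matrix.mul_apply, Matrix.one_apply] at hS
  simp only [Matrix.submatrix_apply] at hS
  have e : ∑ k : Fin 3, (g y)⁻¹ j.succ k.succ * (Λ * g y i.succ k.succ)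
      = if i = j then Λ else 0 := by
    calc _ = Λ * ∑ k : Fin 3, ((g y).submatrix Fin.succ Fin.succ)⁻¹ j k * g y k.succ i.succ := by
          rw [Finset.mul_sum]
          refine Finset.sum_congr rfl fun k _ => ?_
          rw [h.inv_succ_succ, h.symm i k]
          ring
      _ = _ := by
          rw [hS]
          by_cases hij : i = j <;> simp [hij, eq_comm]
  simp only [errSpatial, einstein, mul_sub, Finset.sum_sub_distrib, e, spatial, ← h.inv_succ_succ]

/-- A solution of the Einstein equation has no error terms. -/
theorem errors_eq_zero (h : SplitLorentz (g y)) (hE : ∀ μ ν, einstein Λ g μ ν y = 0) :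
    err00 Λ g y = 0 ∧ (∀ j, err0 g j y = 0) ∧ ∀ i j, errSpatial Λ g i j y = 0 :=
  ⟨by rw [err00_eq h, hE, zero_mul], fun j => by simp [err0_eq (Λ := Λ) h, hE],
    fun i j => by simp [errSpatial_eq h, hE]⟩

end Errors

variable {ι : Type*} {Ω : Opens Coord} {H : ℝ} {d : ℤ} {δ : ι → ℝ}
  {g : ι → Coord → Matrix (Fin 4) (Fin 4) ℝ}

/-- A family of metrics `-Φ² ds² + e^{2Hs} h_{ij} dxⁱ dxʲ` with uniform bounds on `Φ`, `h` and
their derivatives, with `Φ²` and `h` bounded below by `c`. -/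
structure UniformSplit (Ω : Opens Coord) (H c : ℝ) (g : ι → Coord → Matrix (Fin 4) (Fin 4) ℝ) :
    Prop where
  pos : 0 < c
  entry : ∀ μ ν, ExpSymbol Ω H (metricExp μ ν) (fun _ => 1) fun i y => g i y μ ν
  symm : ∀ i, ∀ y ∈ Ω, ∀ μ ν, g i y μ ν = g i y ν μ
  zero_succ : ∀ i, ∀ y ∈ Ω, ∀ j : Fin 3, g i y 0 j.succ = 0
  lapse_le : ∀ i, ∀ y ∈ Ω, g i y 0 0 ≤ -c
  coercive : ∀ i, ∀ y ∈ Ω, ∀ v : Fin 3 → ℝ, c * ∑ p, v p ^ 2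
    ≤ ∑ p, ∑ q, v p * v q * (Real.exp (-(2 : ℤ) * H * y 0) * g i y p.succ q.succ)

namespace UniformSplit

variable {c : ℝ}

theorem splitLorentz (h : UniformSplit Ω H c g) (i : ι) {y : Coord} (hy : y ∈ Ω) :
    SplitLorentz (g i y) := by
  refine ⟨(h.lapse_le i y hy).trans_lt (neg_neg_of_pos h.pos), h.zero_succ i y hy,
    fun j => by rw [h.symm i y hy, h.zero_succ i y hy], ?_⟩
  refine Matrix.PosDef.of_dotProduct_mulVec_pos ?_ fun v hv => ?_
  · ext p q
    simp [h.symm i y hy p.succ q.succ]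
  · have h1 := h.coercive i y hy v
    have h2 : 0 < ∑ p, v p ^ 2 := by
      obtain ⟨p, hp⟩ := Function.ne_iff.mp hv
      exact Finset.sum_pos' (fun p _ => sq_nonneg (v p))
        ⟨p, Finset.mem_univ p, sq_pos_of_ne_zero hp⟩
    have h3 := (mul_pos h.pos h2).trans_le h1
    have h4 : ∑ p, ∑ q, v p * v q * (Real.exp (-(2 : ℤ) * H * y 0) * g i y p.succ q.succ)
        = Real.exp (-(2 : ℤ) * H * y 0) * (star v ⬝ᵥ
          ((g i y).submatrix Fin.succ Fin.succ : Matrix (Fin 3) (Fin 3) ℝ).mulVec v) := by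
      simp only [dotProduct, Matrix.mulVec, Finset.mul_sum, Matrix.submatrix_apply, star_trivial]
      exact Finset.sum_congr rfl fun p _ => Finset.sum_congr rfl fun q _ => by ring
    rw [h4] at h3
    exact (mul_pos_iff_of_pos_left (Real.exp_pos _)).mp h3

/-- The rescaled spatial metric. -/
theorem scaled_inv (h : UniformSplit Ω H c g) (i : ι) {y : Coord} (hy : y ∈ Ω) :
    (Real.exp (-(2 : ℤ) * H * y 0) • (g i y).submatrix Fin.succ Fin.succ :
      Matrix (Fin 3) (Fin 3) ℝ)⁻¹
      = (Real.exp (-(2 : ℤ) * H * y 0))⁻¹ • ((g i y).submatrix Fin.succ Fin.succ)⁻¹ := by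
  have hS := Matrix.nonsing_inv_mul _
    (isUnit_iff_ne_zero.mpr (h.splitLorentz i hy).det_spatial_ne_zero)
  refine Matrix.inv_eq_left_inv ?_
  rw [Matrix.smul_mul, Matrix.mul_smul, hS, smul_smul,
    inv_mul_cancel₀ (Real.exp_pos _).ne', one_smul]

theorem abs_scaled_inv_le (h : UniformSplit Ω H c g) (i : ι) {y : Coord} (hy : y ∈ Ω)
    (p q : Fin 3) : |(Real.exp (-(2 : ℤ) * H * y 0) •
      (g i y).submatrix Fin.succ Fin.succ : Matrix (Fin 3) (Fin 3) ℝ)⁻¹ p q| ≤ c⁻¹ := by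
  set S : Matrix (Fin 3) (Fin 3) ℝ := Real.exp (-(2 : ℤ) * H * y 0) •
      (g i y).submatrix Fin.succ Fin.succ with hSdef
  have hdet : S.det ≠ 0 := by
    rw [hSdef, Matrix.det_smul]
    exact mul_ne_zero (pow_ne_zero _ (Real.exp_pos _).ne')
      (h.splitLorentz i hy).det_spatial_ne_zero
  have hS := Matrix.mul_nonsing_inv S (isUnit_iff_ne_zero.mpr hdet)
  have hc := h.pos
  -- test coercivity with the column `q` of the inverse
  have h1 := h.coercive i y hy fun p => S⁻¹ p q
  have h2 : ∑ p, ∑ r, S⁻¹ p q * S⁻¹ r q * (Real.exp (-(2 : ℤ) * H * y 0) * g i y p.succ r.succ)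
      = S⁻¹ q q := by
    have : ∀ p, ∑ r, S⁻¹ p q * S⁻¹ r q * (Real.exp (-(2 : ℤ) * H * y 0) * g i y p.succ r.succ)
        = S⁻¹ p q * (S * S⁻¹) p q := fun p => by
      rw [Matrix.mul_apply, Finset.mul_sum]
      refine Finset.sum_congr rfl fun r _ => ?_
      simp only [hSdef, Matrix.smul_apply, Matrix.submatrix_apply, smul_eq_mul]
      ring
    simp only [this, hS, Matrix.one_apply, mul_ite, mul_one, mul_zero, Finset.sum_ite_eq',
      Finset.mem_univ, if_true]
  rw [h2] at h1
  have h3 : ∀ r, c * S⁻¹ r q ^ 2 ≤ S⁻¹ q q := fun r => le_trans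
    (mul_le_mul_of_nonneg_left (Finset.single_le_sum (f := fun p => S⁻¹ p q ^ 2)
      (fun p _ => sq_nonneg _) (Finset.mem_univ r)) hc.le) h1
  have h4 : S⁻¹ q q ≤ c⁻¹ := by
    rw [← one_div c, le_div_iff₀ hc]
    nlinarith [h3 q, sq_nonneg (S⁻¹ q q * c - 1)]
  refine abs_le_of_sq_le_sq ?_ (inv_pos.mpr hc).le
  have h5 := (h3 p).trans h4
  rw [inv_pow, ← one_div (c ^ 2), le_div_iff₀ (by positivity)]
  calc S⁻¹ p q ^ 2 * c ^ 2 = c * (c * S⁻¹ p q ^ 2) := by ring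
    _ ≤ c * c⁻¹ := mul_le_mul_of_nonneg_left h5 hc.le
    _ = 1 := mul_inv_cancel₀ hc.ne'

theorem metricFamily (h : UniformSplit Ω H c g) : MetricFamily Ω H g := by
  have hG := fun i y (hy : y ∈ Ω) => h.splitLorentz i hy
  refine ⟨h.entry, fun μ ν => ?_, fun i y hy => (hG i y hy).det_ne_zero⟩
  refine Fin.cases ?_ (fun p => ?_) μ <;> refine Fin.cases ?_ (fun q => ?_) ν
  · refine ((h.entry 0 0).inv h.pos fun i y hy => ?_).congr fun i y hy => (hG i y hy).inv_zero_zero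
    have := h.lapse_le i y hy
    rw [abs_of_neg (by linarith [h.pos])]
    linarith
  · exact ExpSymbol.zero.congr fun i y hy => (hG i y hy).inv_zero_succ q
  · exact ExpSymbol.zero.congr fun i y hy => (hG i y hy).inv_succ_zero p
  · have hexp := ExpSymbol.exp (ι := ι) (Ω := Ω) (H := H) 2
    have hM : ∀ p q : Fin 3, ExpSymbol Ω H 0 (fun _ => 1) fun i y =>
        (Real.exp (-(2 : ℤ) * H * y 0) • (g i y).submatrix Fin.succ Fin.succ :
          Matrix (Fin 3) (Fin 3) ℝ) p q := fun p q => hexp.mul (h.entry p.succ q.succ)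
    have hinv := ExpSymbol.matrix_inv hM (fun i y hy => by
        rw [Matrix.det_smul]
        exact mul_ne_zero (pow_ne_zero _ (Real.exp_pos _).ne') (hG i y hy).det_spatial_ne_zero)
      (fun p q => ⟨c⁻¹, fun i y hy => by simpa using h.abs_scaled_inv_le i hy p q⟩) p q
    refine (hexp.mul hinv).congr fun i y hy => ?_
    beta_reduce
    rw [(hG i y hy).inv_succ_succ, h.scaled_inv i hy, Matrix.smul_apply, smul_eq_mul,
      mul_inv_cancel_left₀ (Real.exp_pos _).ne']

/-- Bounds on `Ric - Λ g` are bounds on the error terms. -/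
theorem errors (h : UniformSplit Ω H c g) {Λ : ℝ}
    (hE : ∀ μ ν, (μ = 0 ∨ ν ≠ 0) →
      ExpSymbol Ω H (metricExp μ ν + d) δ fun i => einstein Λ (g i) μ ν) :
    (ExpSymbol Ω H d δ fun i => err00 Λ (g i)) ∧
    (∀ j, ExpSymbol Ω H (2 + d) δ fun i => err0 (g i) j) ∧
    ∀ p q, ExpSymbol Ω H d δ fun i => errSpatial Λ (g i) p q := by
  have hG := fun i y (hy : y ∈ Ω) => h.splitLorentz i hy
  have hM := h.metricFamily
  have hl : ExpSymbol Ω H 0 (fun _ => 1) fun i y => (Real.sqrt (-g i y 0 0))⁻¹ :=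
    (h.entry 0 0).neg.inv_sqrt h.pos fun i y hy => by linarith [h.lapse_le i y hy]
  refine ⟨?_, fun j => ?_, fun p q => ?_⟩
  · have := (hE 0 0 (Or.inl rfl)).mul (hl.mul hl)
    simp only [metricExp, true_or, if_true, zero_add, add_zero] at this
    exact this.congr fun i y hy => err00_eq (hG i y hy)
  · refine (ExpSymbol.sum (s := Finset.univ) fun k _ => ?_).congr
      fun i y hy => err0_eq (Λ := Λ) (hG i y hy) j
    have := (hM.inv_entry j.succ k.succ).mul_left ((hE 0 k.succ (Or.inl rfl)).mul hl)
    simpa [metricExp, inverseExp] using this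
  · refine (ExpSymbol.sum (s := Finset.univ) fun k _ => ?_).congr
      fun i y hy => errSpatial_eq (hG i y hy) p q
    have := (hM.inv_entry q.succ k.succ).mul_left (hE p.succ k.succ (Or.inr k.succ_ne_zero))
    simpa [metricExp, inverseExp] using this

end UniformSplit

/-- For an asymptotic model, `Ric - 3H² g` is of lower order by the factor `e^{-2Hs}`. -/
theorem einstein_asymptoticModel {s₁ : ℝ} (hH : 0 ≤ H) (hs : ∀ y ∈ Ω, s₁ ≤ y 0)
    (hg : MetricFamily Ω H g) (hM : ∀ i, IsAsymptoticModel Ω H (g i)) (μ ν : Fin 4)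
    (hμν : μ = 0 ∨ ν ≠ 0) :
    ExpSymbol Ω H (metricExp μ ν + 2) (fun _ => 1) fun i => einstein (3 * H ^ 2) (g i) μ ν := by
  have hcl : CloseMetrics Ω H 0 (fun _ => 1) g g := hg.refl
  have hmain : ∀ k j : Fin 3, ExpSymbol Ω H (metricExp k.succ j.succ + 2) (fun _ => 1)
      fun i => einstein (3 * H ^ 2) (g i) k.succ j.succ := fun p q => by
    have hΓ : ∀ k i j : Fin 3, ExpSymbol Ω H 0 (fun _ => 1)
        fun n => christoffel (g n) k.succ i.succ j.succ := fun k i j =>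
      (hcl.christoffel hH hs (fun _ => zero_le_one) k.succ i.succ j.succ).left
    refine ((ExpSymbol.sum (s := Finset.univ) fun k _ =>
      ((hΓ k q p).pd k.succ).sub ((hΓ k k p).pd q.succ)).add
      (ExpSymbol.sum (s := Finset.univ) fun k _ => ExpSymbol.sum (s := Finset.univ) fun l _ =>
        ((hΓ k k l).mul (hΓ l q p)).sub ((hΓ k q l).mul (hΓ l k p)))).congr fun i y hy => ?_
    exact (hM i).einstein_succ_succ (fun i' j' => (hg.entry i'.succ j'.succ).smooth i) hy p q
  revert hμν
  refine Fin.cases ?_ (fun p => ?_) μ <;> refine Fin.cases ?_ (fun q => ?_) ν <;> intro hμν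
  · exact ExpSymbol.zero.congr fun i y hy => (hM i).einstein_zero_zero hy
  · exact ExpSymbol.zero.congr fun i y hy => (hM i).einstein_zero_succ hy q
  · simp at hμν
  · exact hmain p q

end Split

/-! ### Kerr-de Sitter at large radii -/

section Profile

/-- `-r⁻⁴ Δ_r` as a function of `x = r⁻¹`. -/
def deltaX (Λ a m x : ℝ) : ℝ :=
  Λ / 3 - (1 - Λ / 3 * a ^ 2) * x ^ 2 + 2 * m * x ^ 3 - a ^ 2 * x ^ 4

/-- The square of the lapse of Kerr-de Sitter as a function of `x = r⁻¹` and `c = cos θ`. -/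
def lapseProfile (Λ a m x c : ℝ) : ℝ := Λ / 3 * (1 + a ^ 2 * c ^ 2 * x ^ 2) * (deltaX Λ a m x)⁻¹

/-- The quadratic form `r⁻² g_{ij}` of Kerr-de Sitter as a function of `x = r⁻¹`, `c = cos θ`, and
of the values `N` of the round metric, `e, e'` of the one-form `η` and `t, t'` of `dt` on two
vectors. -/
def spatialProfile (Λ a m x c N e e' t t' : ℝ) : ℝ :=
  (1 + a ^ 2 * c ^ 2 * x ^ 2) * (deltaTheta Λ a c)⁻¹ * N
    + a ^ 2 * (x ^ 2 - Λ / 3) * (deltaTheta Λ a c * (1 + a ^ 2 * x ^ 2)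
        + (1 + a ^ 2 * c ^ 2 * x ^ 2) * deltaZero Λ a)
      * ((1 + a ^ 2 * c ^ 2 * x ^ 2)⁻¹ * ((deltaZero Λ a)⁻¹ * (deltaZero Λ a)⁻¹)
        * (deltaTheta Λ a c)⁻¹) * (e * e')
    + deltaTheta Λ a c * (1 + a ^ 2 * c ^ 2 * x ^ 2)⁻¹
      * (a ^ 2 * (1 - c ^ 2) * (x ^ 2 * x ^ 2) * (t * t')
        - a * (1 + a ^ 2 * x ^ 2) * x ^ 2 * (deltaZero Λ a)⁻¹ * (t * e' + e * t'))
    + deltaX Λ a m x * (1 + a ^ 2 * c ^ 2 * x ^ 2)⁻¹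
      * ((t - a * (deltaZero Λ a)⁻¹ * e) * (t' - a * (deltaZero Λ a)⁻¹ * e'))

/-- The metric `-Φ² ds² + e^{2Hs} h_{ij} dxⁱ dxʲ` with the lapse `Φ` and the form `h` of
Kerr-de Sitter at `r = x⁻¹`. For `x = e^{-Hs}` this is Kerr-de Sitter, for `x = 0` its asymptotic
model. -/
def conformalMetric (Λ a m : ℝ) (x : Coord → ℝ) (b : Bool) (y : Coord) :
    Matrix (Fin 4) (Fin 4) ℝ :=
  Matrix.of fun μ ν =>
    if μ = 0 ∨ ν = 0 then if μ = 0 ∧ ν = 0 then -lapseProfile Λ a m (x y) (omega b 2 y) else 0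
    else Real.exp (-(-2 : ℤ) * hubble Λ * y 0) * spatialProfile Λ a m (x y) (omega b 2 y)
      (roundMetric b μ ν y) (eta b μ y) (eta b ν y) (dt μ) (dt ν)

variable {Λ : ℝ}

theorem omega_true_zero : omega true 0 = omega false 2 := by
  ext y; simp [omega, polarPoint]

theorem omega_true_one : omega true 1 = omega false 0 := by
  ext y; simp [omega, polarPoint]

theorem omega_true_two : omega true 2 = omega false 1 := by
  ext y; simp [omega, polarPoint]

/-- The functions `ω` do not depend on `s` and `t`. -/
theorem pd_omega_eq_zero (b : Bool) (k : Fin 3) {μ : Fin 4} (hμ : μ = 0 ∨ μ = 1) (y : Coord) :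
    pd μ (omega b k) y = 0 := by
  have h : ∀ k, pd μ (omega false k) y = 0 := fun k => by
    fin_cases k <;> simp only [Fin.zero_eta, Fin.mk_one, Fin.reduceFinMk, pd_omega_zero,
      pd_omega_one, pd_omega_two] <;> rcases hμ with rfl | rfl <;> rfl
  cases b
  · exact h k
  · fin_cases k
    · exact omega_true_zero ▸ h 2
    · exact omega_true_one ▸ h 0
    · exact omega_true_two ▸ h 1

theorem eta_eq_zero (b : Bool) {μ : Fin 4} (hμ : μ = 0 ∨ μ = 1) (y : Coord) : eta b μ y = 0 := by
  simp [eta, pd_omega_eq_zero b _ hμ]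

theorem roundMetric_comm (b : Bool) (μ ν : Fin 4) (y : Coord) :
    roundMetric b μ ν y = roundMetric b ν μ y := by
  simp only [roundMetric, mul_comm]

theorem roundMetric_eq_false (b : Bool) (μ ν : Fin 4) (y : Coord) :
    roundMetric b μ ν y = roundMetric false μ ν y := by
  cases b
  · rfl
  · simp only [roundMetric, Fin.sum_univ_three, omega_true_zero, omega_true_one, omega_true_two]
    ring

theorem hubble_sq (hΛ : 0 < Λ) : hubble Λ ^ 2 = Λ / 3 := Real.sq_sqrt (by positivity)

theorem hubble_pos (hΛ : 0 < Λ) : 0 < hubble Λ := Real.sqrt_pos.mpr (by positivity)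

theorem deltaR_eq (a m x : ℝ) (hx : x ≠ 0) : deltaR Λ a m x⁻¹ = -(x⁻¹ ^ 4 * deltaX Λ a m x) := by
  unfold deltaR deltaX
  field_simp
  ring

/-- The inverse radius. -/
def invRadius (Λ : ℝ) (y : Coord) : ℝ := Real.exp (-(1 : ℤ) * hubble Λ * y 0)

theorem invRadius_pos (y : Coord) : 0 < invRadius Λ y := Real.exp_pos _

theorem radius_eq_inv (y : Coord) : radius Λ y = (invRadius Λ y)⁻¹ := by
  rw [radius, invRadius, ← Real.exp_neg]
  congr 1
  push_cast
  ring

theorem exp_two_eq (y : Coord) : Real.exp (-(-2 : ℤ) * hubble Λ * y 0) = (invRadius Λ y)⁻¹ ^ 2 := by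
  rw [invRadius, ← Real.exp_neg, ← Real.exp_nat_mul]
  congr 1
  push_cast
  ring

theorem kerrDeSitter_eq_conformalMetric (hΛ : 0 < Λ) (a m : ℝ) (b : Bool) {y : Coord}
    (hD : deltaX Λ a m (invRadius Λ y) ≠ 0) :
    kerrDeSitter Λ a m b y = conformalMetric Λ a m (invRadius Λ) b y := by
  have hx := (invRadius_pos (Λ := Λ) y).ne'
  have hT := (deltaTheta_pos hΛ a (omega b 2 y)).ne'
  have hZ := (deltaZero_pos hΛ a).ne'
  have hr0 : ∀ {μ : Fin 4}, μ ≠ 0 → pd μ (radius Λ) y = 0 := fun {μ} hμ => by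
    rw [pd_radius]
    obtain ⟨j, rfl⟩ := Fin.exists_succ_eq.mpr hμ
    fin_cases j <;> rfl
  have hW : ∀ c, 1 + a ^ 2 * c ^ 2 * invRadius Λ y ^ 2 ≠ 0 := fun c => by positivity
  have hrho : ∀ c, rhoSq a (invRadius Λ y)⁻¹ c
      = (invRadius Λ y)⁻¹ ^ 2 * (1 + a ^ 2 * c ^ 2 * invRadius Λ y ^ 2) := fun c => by
    rw [rhoSq]
    field_simp
  have hR := deltaR_eq (Λ := Λ) a m (invRadius Λ y) hx
  have hround0 : ∀ ν, roundMetric b 0 ν y = 0 := fun ν => by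
    simp [roundMetric, pd_omega_eq_zero b _ (Or.inl rfl : (0 : Fin 4) = 0 ∨ (0 : Fin 4) = 1)]
  have heta0 : eta b 0 y = 0 := eta_eq_zero b (Or.inl rfl) y
  have hpr0 : pd 0 (radius Λ) y = hubble Λ * (invRadius Λ y)⁻¹ := by
    rw [pd_radius, ← radius_eq_inv]
    rfl
  have hr := radius_eq_inv (Λ := Λ) y
  ext μ ν
  simp only [kerrDeSitter, conformalMetric, Matrix.of_apply]
  by_cases hμ : μ = 0
  · subst hμ
    by_cases hν : ν = 0
    · subst hν
      simp only [hround0, heta0, dt, hpr0, hr, hrho, hR, lapseProfile, ← hubble_sq hΛ]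
      simp
      field_simp
    · simp [hν, hround0, heta0, hr0 hν, dt]
  · by_cases hν : ν = 0
    · subst hν
      simp [hμ, roundMetric_comm b μ 0, hround0, heta0, hr0 hμ, dt]
    · simp only [hμ, hν, or_self, if_false, hr0 hμ, hr, hrho, hR, spatialProfile,
        axisCoeff, exp_two_eq]
      generalize roundMetric b μ ν y = N at *
      generalize eta b μ y = e at *
      generalize eta b ν y = e' at *
      generalize dt μ = t at *
      generalize dt ν = t' at *
      have hWc := hW (omega b 2 y)
      generalize omega b 2 y = c at *
      generalize deltaX Λ a m (invRadius Λ y) = D at *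
      generalize invRadius Λ y = x at *
      generalize deltaTheta Λ a c = T at *
      generalize deltaZero Λ a = Z at *
      field_simp
      ring

/-- The spatial form as a sum of squares, away from the axis. -/
theorem spatialProfile_eq_sum_sq (hΛ : 0 < Λ) (a m x c N e t : ℝ) (hc : c ^ 2 < 1) :
    spatialProfile Λ a m x c N e e t t
      = (1 + a ^ 2 * c ^ 2 * x ^ 2) * (deltaTheta Λ a c)⁻¹ * (N - e ^ 2 / (1 - c ^ 2))
        + deltaTheta Λ a c * (1 + a ^ 2 * c ^ 2 * x ^ 2)⁻¹
          * ((a * (1 - c ^ 2) * x ^ 2 * t - (1 + a ^ 2 * x ^ 2) / deltaZero Λ a * e) ^ 2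
            / (1 - c ^ 2))
        + deltaX Λ a m x * (1 + a ^ 2 * c ^ 2 * x ^ 2)⁻¹
          * (t - a / deltaZero Λ a * e) ^ 2 := by
  have hT := (deltaTheta_pos hΛ a c).ne'
  have hZ := (deltaZero_pos hΛ a).ne'
  have hW : 1 + a ^ 2 * c ^ 2 * x ^ 2 ≠ 0 := by positivity
  obtain ⟨S, rfl⟩ : ∃ S, S = 1 - c ^ 2 := ⟨_, rfl⟩
  have hS : 1 - c ^ 2 ≠ 0 := by linarith
  have hT' : deltaTheta Λ a c = 1 + Λ / 3 * a ^ 2 * c ^ 2 := rfl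
  have hZ' : deltaZero Λ a = 1 + Λ / 3 * a ^ 2 := rfl
  simp only [spatialProfile]
  generalize deltaX Λ a m x = D
  generalize deltaTheta Λ a c = T at *
  generalize deltaZero Λ a = Z at *
  field_simp
  rw [hT', hZ']
  ring

/-- The one-forms in `spatialProfile_eq_sum_sq` control `t` and `e`. -/
theorem sq_add_sq_div_le {a x S W Z K Z₀ A X e t P q : ℝ} (hS0 : 0 < S) (hS1 : S ≤ 1)
    (hx2 : x ^ 2 ≤ X ^ 2) (ha2 : a ^ 2 ≤ A ^ 2) (hK : 1 + A ^ 2 * X ^ 2 ≤ K)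
    (hW : W = 1 + a ^ 2 * (1 - S) * x ^ 2) (hZ1 : 1 ≤ Z) (hZZ : Z ≤ Z₀)
    (hP : P = a * S * x ^ 2 * t - (1 + a ^ 2 * x ^ 2) / Z * e) (hq : q = t - a / Z * e) :
    t ^ 2 + e ^ 2 / S
      ≤ 2 * (A ^ 2 + K ^ 2 + 1 + A ^ 2 * X ^ 4) * Z₀ ^ 2 * (P ^ 2 / S + q ^ 2) := by
  have hZ0 : 0 < Z := by linarith
  have hW1 : 1 ≤ W := by
    have : 0 ≤ a ^ 2 * (1 - S) * x ^ 2 :=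
      mul_nonneg (mul_nonneg (sq_nonneg a) (by linarith)) (sq_nonneg x)
    linarith
  obtain ⟨k, hk⟩ : ∃ k, k = (1 + a ^ 2 * x ^ 2) / Z := ⟨_, rfl⟩
  have hk1 : k ^ 2 ≤ K ^ 2 := by
    have h0 : 0 ≤ k := hk ▸ by positivity
    refine pow_le_pow_left₀ h0 ?_ 2
    rw [hk]
    refine (div_le_self (by positivity) hZ1).trans ?_
    have := mul_le_mul ha2 hx2 (sq_nonneg x) (sq_nonneg A)
    linarith
  have haZ : (a / Z) ^ 2 ≤ A ^ 2 := by
    rw [div_pow]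
    exact (div_le_self (sq_nonneg a) (one_le_pow₀ hZ1)).trans ha2
  have hPS : P ^ 2 ≤ P ^ 2 / S := le_div_self (sq_nonneg P) hS0 hS1
  -- solve for `t` and `e` in terms of `P` and `q`
  have et : t * (W / Z) = k * q - a / Z * P := by
    rw [hq, hP, hk, hW]
    field_simp
    ring
  have ee : e * (W / Z) = a * S * x ^ 2 * q - P := by
    rw [hq, hP, hW]
    field_simp
    ring
  have two : ∀ u v : ℝ, (u - v) ^ 2 ≤ 2 * (u ^ 2 + v ^ 2) := fun u v => by
    linarith [sq_nonneg (u + v), sub_sq u v, add_sq u v]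
  have bt : t ^ 2 * (W / Z) ^ 2 ≤ 2 * (K ^ 2 * q ^ 2 + A ^ 2 * (P ^ 2 / S)) := by
    rw [← mul_pow, et]
    refine (two _ _).trans (mul_le_mul_of_nonneg_left (add_le_add ?_ ?_) two_pos.le)
    · rw [mul_pow]
      exact mul_le_mul_of_nonneg_right hk1 (sq_nonneg q)
    · rw [mul_pow]
      exact mul_le_mul haZ hPS (sq_nonneg P) (sq_nonneg A)
  have be : e ^ 2 / S * (W / Z) ^ 2 ≤ 2 * (A ^ 2 * X ^ 4 * q ^ 2 + P ^ 2 / S) := by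
    have i2 : (a * S * x ^ 2 * q) ^ 2 / S ≤ A ^ 2 * X ^ 4 * q ^ 2 := by
      have j1 : (a * S * x ^ 2 * q) ^ 2 / S = a ^ 2 * (S * (x ^ 2) ^ 2) * q ^ 2 := by
        field_simp
      have j2 : S * (x ^ 2) ^ 2 ≤ X ^ 4 := by
        have : (x ^ 2) ^ 2 ≤ (X ^ 2) ^ 2 := pow_le_pow_left₀ (sq_nonneg x) hx2 2
        calc S * (x ^ 2) ^ 2 ≤ 1 * (X ^ 2) ^ 2 := mul_le_mul hS1 this (by positivity) one_pos.le
          _ = X ^ 4 := by ring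
      rw [j1]
      exact mul_le_mul_of_nonneg_right (mul_le_mul ha2 j2 (by positivity) (sq_nonneg A))
        (sq_nonneg q)
    calc e ^ 2 / S * (W / Z) ^ 2 = (e * (W / Z)) ^ 2 / S := by rw [mul_pow]; ring
      _ ≤ 2 * ((a * S * x ^ 2 * q) ^ 2 + P ^ 2) / S := by
          rw [ee]
          exact div_le_div_of_nonneg_right (two _ _) hS0.le
      _ = 2 * ((a * S * x ^ 2 * q) ^ 2 / S + P ^ 2 / S) := by rw [mul_div_assoc, add_div]
      _ ≤ _ := mul_le_mul_of_nonneg_left (by linarith) two_pos.le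
  have hWZ : (1 : ℝ) ≤ (W / Z) ^ 2 * Z₀ ^ 2 := by
    rw [← mul_pow]
    refine one_le_pow₀ ?_
    rw [div_mul_eq_mul_div, le_div_iff₀ hZ0, one_mul]
    exact hZZ.trans (le_mul_of_one_le_left (by linarith) hW1)
  have hPS0 : 0 ≤ P ^ 2 / S := by positivity
  have i0 : 0 ≤ t ^ 2 + e ^ 2 / S := by positivity
  calc t ^ 2 + e ^ 2 / S ≤ (t ^ 2 + e ^ 2 / S) * ((W / Z) ^ 2 * Z₀ ^ 2) :=
        le_mul_of_one_le_right i0 hWZ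
    _ = (t ^ 2 * (W / Z) ^ 2 + e ^ 2 / S * (W / Z) ^ 2) * Z₀ ^ 2 := by ring
    _ ≤ (2 * (A ^ 2 + K ^ 2 + 1 + A ^ 2 * X ^ 4) * (P ^ 2 / S + q ^ 2)) * Z₀ ^ 2 := by
        refine mul_le_mul_of_nonneg_right ?_ (sq_nonneg Z₀)
        have j1 : 0 ≤ A ^ 2 * q ^ 2 := by positivity
        have j2 : 0 ≤ (K ^ 2 + A ^ 2 * X ^ 4) * (P ^ 2 / S) := by positivity
        linarith [sq_nonneg q]
    _ = _ := by ring

/-- The quadratic form of `spatialProfile` is bounded below, uniformly in bounded parameters. -/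
theorem spatialProfile_coercive (hΛ : 0 < Λ) {A X d : ℝ} (hd : 0 < d) :
    ∃ κ > 0, ∀ a m x c N e f t : ℝ, |a| ≤ A → 0 ≤ x → x ≤ X → d ≤ deltaX Λ a m x → c ^ 2 ≤ 1 →
      (1 - c ^ 2) * N = f ^ 2 + e ^ 2 → 0 ≤ N →
        κ * (t ^ 2 + N) ≤ spatialProfile Λ a m x c N e e t t := by
  obtain ⟨Z₀, hZ₀⟩ : ∃ Z₀, Z₀ = 1 + Λ / 3 * A ^ 2 := ⟨_, rfl⟩
  obtain ⟨K, hK⟩ : ∃ K, K = 1 + A ^ 2 * X ^ 2 := ⟨_, rfl⟩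
  obtain ⟨κ₁, hκ₁⟩ : ∃ κ₁, κ₁ = min Z₀⁻¹ (min K⁻¹ (d * K⁻¹)) := ⟨_, rfl⟩
  obtain ⟨M, hM⟩ : ∃ M, M = 2 * (A ^ 2 + K ^ 2 + 1 + A ^ 2 * X ^ 4) * Z₀ ^ 2 := ⟨_, rfl⟩
  have hZ₀pos : 0 < Z₀ := hZ₀ ▸ by positivity
  have hKpos : 0 < K := hK ▸ by positivity
  have hM0 : 0 ≤ M := hM ▸ by positivity
  have hκ₁pos : 0 < κ₁ :=
    hκ₁ ▸ lt_min (by positivity) (lt_min (by positivity) (by positivity))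
  refine ⟨κ₁ / (M + 1), by positivity, fun a m x c N e f t ha hx0 hxX hD hc hN hN0 => ?_⟩
  have ha2 : a ^ 2 ≤ A ^ 2 := sq_le_sq' (by linarith [neg_abs_le a]) ((le_abs_self a).trans ha)
  have hx2 : x ^ 2 ≤ X ^ 2 := pow_le_pow_left₀ hx0 hxX 2
  have hΛ3 : 0 ≤ Λ / 3 := by positivity
  have hac : a ^ 2 * c ^ 2 ≤ A ^ 2 := by
    simpa using mul_le_mul ha2 hc (sq_nonneg c) (sq_nonneg A)
  have hac0 : 0 ≤ a ^ 2 * c ^ 2 := by positivity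
  have hT1 : 1 ≤ deltaTheta Λ a c := by
    have := mul_nonneg hΛ3 hac0
    rw [deltaTheta]
    linarith
  have hTZ : deltaTheta Λ a c ≤ Z₀ := by
    have := mul_le_mul_of_nonneg_left hac hΛ3
    rw [deltaTheta, hZ₀]
    linarith
  have hZ1 : 1 ≤ deltaZero Λ a := by
    have := mul_nonneg hΛ3 (sq_nonneg a)
    rw [deltaZero]
    linarith
  have hZZ : deltaZero Λ a ≤ Z₀ := by
    have := mul_le_mul_of_nonneg_left ha2 hΛ3
    rw [deltaZero, hZ₀]
    linarith
  obtain ⟨W, hW⟩ : ∃ W, W = 1 + a ^ 2 * c ^ 2 * x ^ 2 := ⟨_, rfl⟩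
  have hW1 : 1 ≤ W := by
    have := mul_nonneg hac0 (sq_nonneg x)
    linarith
  have hWK : W ≤ K := by
    have := mul_le_mul hac hx2 (sq_nonneg x) (sq_nonneg A)
    linarith
  have hT0 : 0 < deltaTheta Λ a c := by linarith
  have hW0 : 0 < W := by linarith
  -- the three coefficients of the diagonal form
  have h1 : κ₁ ≤ W * (deltaTheta Λ a c)⁻¹ := hκ₁ ▸ (min_le_left _ _).trans
    ((inv_anti₀ hT0 hTZ).trans (le_mul_of_one_le_left (by positivity) hW1))
  have h2 : κ₁ ≤ deltaTheta Λ a c * W⁻¹ := hκ₁ ▸ (min_le_right _ _).trans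
    ((min_le_left _ _).trans
      ((inv_anti₀ hW0 hWK).trans (le_mul_of_one_le_left (by positivity) hT1)))
  have h3 : κ₁ ≤ deltaX Λ a m x * W⁻¹ := hκ₁ ▸ (min_le_right _ _).trans
    ((min_le_right _ _).trans (mul_le_mul hD (inv_anti₀ hW0 hWK) (by positivity) (by linarith)))
  have hκ : κ₁ / (M + 1) ≤ κ₁ := div_le_self hκ₁pos.le (by linarith)
  rcases hc.eq_or_lt with hc1 | hc1
  · -- on the axis `η` vanishes
    have he : e = 0 := by
      rw [hc1, sub_self, zero_mul] at hN
      exact pow_eq_zero_iff two_ne_zero |>.mp (by linarith [sq_nonneg e, sq_nonneg f])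
    have hp : spatialProfile Λ a m x c N e e t t
        = W * (deltaTheta Λ a c)⁻¹ * N + deltaX Λ a m x * W⁻¹ * t ^ 2 := by
      simp only [spatialProfile, he, hc1, hW]
      ring
    rw [hp]
    have := mul_le_mul_of_nonneg_right h1 hN0
    have := mul_le_mul_of_nonneg_right h3 (sq_nonneg t)
    have := mul_le_mul_of_nonneg_right hκ (add_nonneg (sq_nonneg t) hN0)
    linarith
  · rw [spatialProfile_eq_sum_sq hΛ a m x c N e t hc1, ← hW]
    have hcS : c ^ 2 = 1 - (1 - c ^ 2) := by ring
    have hS0 : 0 < 1 - c ^ 2 := by linarith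
    have hS1 : 1 - c ^ 2 ≤ 1 := by linarith [sq_nonneg c]
    rw [hcS] at hW
    have key := sq_add_sq_div_le (a := a) (t := t) (e := e) hS0 hS1 hx2 ha2 hK.ge hW hZ1 hZZ rfl rfl
    rw [← hM] at key
    generalize 1 - c ^ 2 = S at *
    generalize a * S * x ^ 2 * t - (1 + a ^ 2 * x ^ 2) / deltaZero Λ a * e = P at *
    generalize t - a / deltaZero Λ a * e = q at *
    have hNe : 0 ≤ N - e ^ 2 / S := by
      have : N - e ^ 2 / S = f ^ 2 / S := by
        rw [sub_eq_iff_eq_add, ← add_div, eq_div_iff hS0.ne', mul_comm]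
        exact hN
      rw [this]
      positivity
    have hPS0 : 0 ≤ P ^ 2 / S := by positivity
    rw [div_mul_eq_mul_div, div_le_iff₀ (by linarith)]
    have g1 := mul_le_mul_of_nonneg_right h1 hNe
    have g2 := mul_le_mul_of_nonneg_right h2 hPS0
    have g3 := mul_le_mul_of_nonneg_right h3 (sq_nonneg q)
    calc κ₁ * (t ^ 2 + N) = κ₁ * ((t ^ 2 + e ^ 2 / S) + (N - e ^ 2 / S)) := by ring
      _ ≤ κ₁ * (((N - e ^ 2 / S) + P ^ 2 / S + q ^ 2) * (M + 1)) := by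
          refine mul_le_mul_of_nonneg_left ?_ hκ₁pos.le
          have := mul_nonneg hM0 hNe
          linarith [sq_nonneg q]
      _ = κ₁ * ((N - e ^ 2 / S) + P ^ 2 / S + q ^ 2) * (M + 1) := by ring
      _ ≤ _ := by
          refine mul_le_mul_of_nonneg_right ?_ (by linarith)
          linarith

end Profile

/-! ### Functions on the sphere and the cutoff -/

section Periodic

open TopologicalSpace

/-- The part `s > s₁`, `|t| < T` of the charts. -/
def chartRegion (s₁ T : ℝ) : Opens Coord :=
  ⟨{y | s₁ < y 0 ∧ |y 1| < T ∧ |y 2 - Real.pi / 2| < Real.pi / 3},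
    (isOpen_lt continuous_const (continuous_apply 0)).and
      ((isOpen_lt (continuous_apply 1).abs continuous_const).and
        (isOpen_lt ((continuous_apply 2).sub continuous_const).abs continuous_const))⟩

/-- Smooth functions of the coordinates which do not depend on `s` and are `2π`-periodic in `φ`. -/
structure StationaryPeriodic (f : Coord → ℝ) : Prop where
  smooth : ContDiff ℝ ∞ f
  shift : ∀ (y : Coord) (τ : ℝ) (n : ℤ), f (y + ![τ, 0, 0, n * (2 * Real.pi)]) = f y

namespace StationaryPeriodic

variable {f g : Coord → ℝ}

theorem pd (hf : StationaryPeriodic f) (μ : Fin 4) : StationaryPeriodic (pd μ f) := by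
  refine ⟨contDiff_pd hf.smooth μ, fun y τ n => ?_⟩
  have h : (fun z => f (z + ![τ, 0, 0, n * (2 * Real.pi)])) = f := funext fun z => hf.shift z τ n
  rw [KerrDeSitter.pd, ← fderiv_comp_add_right, h, KerrDeSitter.pd]

theorem mul (hf : StationaryPeriodic f) (hg : StationaryPeriodic g) :
    StationaryPeriodic fun y => f y * g y :=
  ⟨hf.smooth.mul hg.smooth, fun y τ n => by rw [hf.shift, hg.shift]⟩

theorem add (hf : StationaryPeriodic f) (hg : StationaryPeriodic g) :
    StationaryPeriodic fun y => f y + g y :=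
  ⟨hf.smooth.add hg.smooth, fun y τ n => by rw [hf.shift, hg.shift]⟩

theorem sub (hf : StationaryPeriodic f) (hg : StationaryPeriodic g) :
    StationaryPeriodic fun y => f y - g y :=
  ⟨hf.smooth.sub hg.smooth, fun y τ n => by rw [hf.shift, hg.shift]⟩

theorem stationary (hf : StationaryPeriodic f) (y : Coord) (τ : ℝ) :
    f (y + τ • Pi.single 0 1) = f y := by
  rw [← hf.shift y τ 0]
  congr 2
  ext μ
  fin_cases μ <;> simp

/-- A function which is stationary and periodic is bounded where `t` and `θ` are. -/
theorem exists_bound (hf : StationaryPeriodic f) (s₁ T : ℝ) :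
    ∃ C, ∀ y ∈ chartRegion s₁ T, |f y| ≤ C := by
  obtain ⟨C, hC⟩ := (isCompact_univ_pi (X := fun _ : Fin 4 => ℝ)
    (s := ![Set.Icc 0 0, Set.Icc (-T) T, Set.Icc (Real.pi / 2 - Real.pi / 3)
      (Real.pi / 2 + Real.pi / 3), Set.Icc 0 (2 * Real.pi)])
    fun μ => by fin_cases μ <;> exact isCompact_Icc).exists_bound_of_continuousOn
    hf.smooth.continuous.continuousOn
  refine ⟨C, fun y ⟨_, hy1, hy2⟩ => ?_⟩
  obtain ⟨n, hn, -⟩ := existsUnique_add_zsmul_mem_Ico Real.two_pi_pos (y 3) 0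
  rw [zero_add, zsmul_eq_mul] at hn
  rw [← hf.shift y (-y 0) n]
  rw [abs_lt] at hy1 hy2
  refine hC _ fun μ _ => ?_
  fin_cases μ
  · simp
  · simpa using ⟨hy1.1.le, hy1.2.le⟩
  · simp
    constructor <;> linarith [hy2.1, hy2.2]
  · simpa using ⟨hn.1, hn.2.le⟩

theorem expSymbol {ι : Type*} {H : ℝ} (hf : StationaryPeriodic f) (s₁ T : ℝ) :
    ExpSymbol (ι := ι) (chartRegion s₁ T) H 0 (fun _ => 1) fun _ => f := by
  refine ⟨fun _ => hf.smooth.contDiffOn, fun n => ?_⟩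
  have h0 : ∀ {f}, StationaryPeriodic f →
      ExpBound (ι := ι) (chartRegion s₁ T) H 0 (fun _ => 1) fun _ => f := fun hf => by
    obtain ⟨C, hC⟩ := hf.exists_bound s₁ T
    exact ⟨C, fun _ y hy => by simpa using hC y hy⟩
  induction n generalizing f with
  | zero => exact h0 hf
  | succ n ih => exact ⟨h0 hf, fun μ => ih (hf.pd μ)⟩

end StationaryPeriodic

theorem polarPoint_shift (b : Bool) (y : Coord) (τ : ℝ) (n : ℤ) :
    polarPoint b ((y + ![τ, 0, 0, n * (2 * Real.pi)]) 2)
      ((y + ![τ, 0, 0, n * (2 * Real.pi)]) 3) = polarPoint b (y 2) (y 3) := by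
  simp [polarPoint]

theorem stationaryPeriodic_omega (b : Bool) (k : Fin 3) : StationaryPeriodic (omega b k) :=
  ⟨contDiff_omega b k, fun y τ n => by rw [omega, polarPoint_shift, ← omega]⟩

theorem stationaryPeriodic_eta (b : Bool) (μ : Fin 4) : StationaryPeriodic (eta b μ) :=
  ((stationaryPeriodic_omega b 0).mul ((stationaryPeriodic_omega b 1).pd μ)).sub
    ((stationaryPeriodic_omega b 1).mul ((stationaryPeriodic_omega b 0).pd μ))

theorem stationaryPeriodic_roundMetric (b : Bool) (μ ν : Fin 4) :
    StationaryPeriodic (roundMetric b μ ν) := by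
  have h := fun k => ((stationaryPeriodic_omega b k).pd μ).mul ((stationaryPeriodic_omega b k).pd ν)
  have := ((h 0).add (h 1)).add (h 2)
  convert this using 2
  rw [roundMetric, Fin.sum_univ_three]

/-- A smooth function on `ℝ × 𝕊²` in the chart `b`. -/
def chartFunction (χ : ℝ × Sphere2 → ℝ) (b : Bool) (y : Coord) : ℝ := χ (y 1, polar b (y 2) (y 3))

theorem stationaryPeriodic_chartFunction {χ : ℝ × Sphere2 → ℝ}
    (hχ : ContMDiff (𝓘(ℝ, ℝ).prod (𝓡 2)) 𝓘(ℝ, ℝ) ∞ χ) (b : Bool) :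
    StationaryPeriodic (chartFunction χ b) := by
  refine ⟨?_, fun y τ n => ?_⟩
  · have hp : ContDiff ℝ ∞ fun y : Coord => polarPoint b (y 2) (y 3) := by
      rw [contDiff_piLp]
      exact fun k => contDiff_omega b k
    have h1 : ContMDiff 𝓘(ℝ, Coord) (𝓡 2) ∞ fun y : Coord => polar b (y 2) (y 3) :=
      ContMDiff.codRestrict_sphere hp.contMDiff fun y => polarPoint_mem b (y 2) (y 3)
    have h2 : ContMDiff 𝓘(ℝ, Coord) 𝓘(ℝ, ℝ) ∞ fun y : Coord => y 1 :=
      (contDiff_apply ℝ ℝ (1 : Fin 4)).contMDiff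
    exact contMDiff_iff_contDiff.mp (hχ.comp (h2.prodMk h1))
  · rw [chartFunction, chartFunction]
    congr 2
    · simp
    · exact Subtype.ext (polarPoint_shift b y τ n)

theorem half_le_sin {θ : ℝ} (h : |θ - Real.pi / 2| < Real.pi / 3) : 1 / 2 ≤ Real.sin θ := by
  rw [← Real.cos_sub_pi_div_two, ← Real.cos_pi_div_three, ← Real.cos_abs (θ - Real.pi / 2)]
  exact Real.cos_le_cos_of_nonneg_of_le_pi (abs_nonneg _) (by linarith [Real.pi_pos]) h.le

end Periodic

/-! ### The extended cosmological region -/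

section Margin

/-- For parameters in `P` and radii `r = x⁻¹ ≥ e^{Hs₁}`, `r = ∞` included, the quantity
`-r⁻⁴ Δ_r` takes values in `[c, D]` with `c > 0`; the parameters are bounded by `A`, the inverse
radii by `X`. -/
structure UniformlyCosmological (Λ s₁ X A D c : ℝ) (P : Set (ℝ × ℝ)) : Prop where
  pos : 0 < c
  invRadius_le : ∀ y : Coord, s₁ < y 0 → invRadius Λ y ≤ X
  abs_le : ∀ p ∈ P, |p.1| ≤ A ∧ |p.2| ≤ A
  delta : ∀ p ∈ P, ∀ x, 0 ≤ x → x ≤ X → c ≤ deltaX Λ p.1 p.2 x ∧ deltaX Λ p.1 p.2 x ≤ D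

/-- By compactness, a compact set of parameters in the cosmological region for `s ≥ s₀` is
uniformly so, even with some room below `s₀`. -/
theorem exists_cosmological_margin {Λ : ℝ} (hΛ : 0 < Λ) {s₀ : ℝ} {P : Set (ℝ × ℝ)}
    (hP : IsCompact P) (hcosmo : ∀ p ∈ P, ∀ r : ℝ, Real.exp (hubble Λ * s₀) ≤ r →
      deltaR Λ p.1 p.2 r < 0) :
    ∃ s₁ < s₀, ∃ X A D d : ℝ, UniformlyCosmological Λ s₁ X A D d P := by
  have hH := hubble_pos hΛ
  obtain ⟨x₀, hx₀⟩ : ∃ x₀, x₀ = Real.exp (-(hubble Λ * s₀)) := ⟨_, rfl⟩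
  have hx₀pos : 0 < x₀ := hx₀ ▸ Real.exp_pos _
  have hcont : Continuous fun q : (ℝ × ℝ) × ℝ => deltaX Λ q.1.1 q.1.2 q.2 := by
    unfold deltaX
    fun_prop
  have hpos : P ×ˢ Set.Icc 0 x₀ ⊆ {q : (ℝ × ℝ) × ℝ | 0 < deltaX Λ q.1.1 q.1.2 q.2} := by
    rintro ⟨p, x⟩ ⟨hp, hx⟩
    obtain ⟨hx0, hx1⟩ : 0 ≤ x ∧ x ≤ x₀ := hx
    change 0 < deltaX Λ p.1 p.2 x
    rcases hx0.eq_or_lt with h0 | h0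
    · rw [← h0, deltaX]
      simpa using hΛ
    · have h1 := hcosmo p hp x⁻¹ (by
        rw [← neg_neg (hubble Λ * s₀), Real.exp_neg, ← hx₀]
        exact inv_anti₀ h0 hx1)
      rw [deltaR_eq _ _ _ h0.ne', neg_lt_zero] at h1
      exact (mul_pos_iff_of_pos_left (by positivity)).mp h1
  obtain ⟨u, v, -, hv, hPu, hxv, huv⟩ := generalized_tube_lemma hP isCompact_Icc
    (isOpen_lt continuous_const hcont) hpos
  obtain ⟨ε, hε, hball⟩ := Metric.isOpen_iff.mp hv x₀ (hxv ⟨hx₀pos.le, le_rfl⟩)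
  obtain ⟨X, hX⟩ : ∃ X, X = x₀ + ε / 2 := ⟨_, rfl⟩
  have hXpos : 0 < X := by linarith
  have hpos' : ∀ q ∈ P ×ˢ Set.Icc 0 X, 0 < deltaX Λ q.1.1 q.1.2 q.2 := by
    rintro ⟨p, x⟩ ⟨hp, hx⟩
    obtain ⟨hx0, hx1⟩ : 0 ≤ x ∧ x ≤ X := hx
    refine huv (Set.mk_mem_prod (hPu hp) ?_)
    by_cases hx : x ≤ x₀
    · exact hxv ⟨hx0, hx⟩
    · refine hball ?_
      rw [Metric.mem_ball, Real.dist_eq, abs_of_pos (by linarith)]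
      linarith
  have hK := hP.prod (isCompact_Icc (a := (0 : ℝ)) (b := X))
  obtain ⟨d, hd, hdle⟩ := hK.exists_forall_le' hcont.continuousOn hpos'
  obtain ⟨D, hD⟩ := hK.exists_bound_of_continuousOn hcont.continuousOn
  obtain ⟨A, hA⟩ := hP.exists_bound_of_continuousOn (f := id) continuous_id.continuousOn
  refine ⟨-(Real.log X / hubble Λ), ?_, X, A, D, d, ⟨hd, fun y hy => ?_, fun p hp => ?_,
    fun p hp x h0 h1 => ?_⟩⟩
  · rw [neg_lt, lt_div_iff₀ hH, Real.lt_log_iff_exp_lt hXpos,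
      show -s₀ * hubble Λ = -(hubble Λ * s₀) by ring, ← hx₀]
    linarith
  · rw [invRadius, ← Real.le_log_iff_exp_le hXpos]
    rw [neg_lt, lt_div_iff₀ hH] at hy
    push_cast
    linarith
  · have := hA p hp
    exact ⟨(norm_fst_le p).trans this, (norm_snd_le p).trans this⟩
  · have hm : (p, x) ∈ P ×ˢ Set.Icc 0 X := Set.mk_mem_prod hp (Set.mem_Icc.mpr ⟨h0, h1⟩)
    exact ⟨hdle (p, x) hm, (le_abs_self _).trans (hD (p, x) hm)⟩

end Margin

/-! ### Interpolation of Kerr-de Sitter metrics -/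

namespace ExpClose

variable {ι : Type*} {Ω : TopologicalSpace.Opens Coord} {H : ℝ} {d : ℤ} {δ : ι → ℝ} {k : ℤ}
  {f f' g g' : ι → Coord → ℝ}

theorem mul_zero (hf : ExpClose Ω H d δ k f f') (hg : ExpClose Ω H d δ 0 g g') :
    ExpClose Ω H d δ k (fun i y => f i y * g i y) fun i y => f' i y * g' i y := by
  simpa using hf.mul hg

theorem pow (hf : ExpClose Ω H d δ 0 f f') (n : ℕ) :
    ExpClose Ω H d δ 0 (fun i y => f i y ^ n) fun i y => f' i y ^ n := by
  induction n with
  | zero => simpa using refl (ExpSymbol.const_one 1)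
  | succ n ih => simpa only [pow_succ] using ih.mul_zero hf

theorem const (c : ℝ) : ExpClose (ι := ι) Ω H d δ 0 (fun _ _ => c) fun _ _ => c :=
  refl (ExpSymbol.const_one c)

end ExpClose

section Close

variable {ι : Type*} {s₁ T : ℝ} {Λ : ℝ} {d : ℤ} {δ : ι → ℝ} {a a' m m' : ι → ℝ}
  {x x' : Coord → ℝ} {D : ℝ}

/-- The components of `conformalMetric` depend in a controlled way on the parameters and on
`x`. -/
theorem expClose_conformalMetric (hΛ : 0 < Λ) (b : Bool)
    (hx2 : ExpClose (ι := ι) (chartRegion s₁ T) (hubble Λ) d δ 0 (fun _ y => x y ^ 2)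
      fun _ y => x' y ^ 2)
    (hx3 : ExpClose (ι := ι) (chartRegion s₁ T) (hubble Λ) d δ 0 (fun _ y => x y ^ 3)
      fun _ y => x' y ^ 3)
    (ha : ExpClose (chartRegion s₁ T) (hubble Λ) d δ 0 (fun i _ => a i) fun i _ => a' i)
    (hm : ExpClose (chartRegion s₁ T) (hubble Λ) d δ 0 (fun i _ => m i) fun i _ => m' i)
    (hD : 0 < D) (hX : ∀ i, ∀ y ∈ chartRegion s₁ T, D ≤ deltaX Λ (a i) (m i) (x y))
    (hX' : ∀ i, ∀ y ∈ chartRegion s₁ T, D ≤ deltaX Λ (a' i) (m' i) (x' y)) (μ ν : Fin 4) :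
    ExpClose (chartRegion s₁ T) (hubble Λ) d δ (metricExp μ ν)
      (fun i y => conformalMetric Λ (a i) (m i) x b y μ ν)
      fun i y => conformalMetric Λ (a' i) (m' i) x' b y μ ν := by
  have one := ExpClose.const (ι := ι) (Ω := chartRegion s₁ T) (H := hubble Λ) (d := d) (δ := δ) 1
  have L := ExpClose.const (ι := ι) (Ω := chartRegion s₁ T) (H := hubble Λ) (d := d) (δ := δ)
    (Λ / 3)
  have two := ExpClose.const (ι := ι) (Ω := chartRegion s₁ T) (H := hubble Λ) (d := d) (δ := δ) 2
  have hc : ExpClose (ι := ι) (chartRegion s₁ T) (hubble Λ) d δ 0 (fun _ => omega b 2)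
    fun _ => omega b 2 := .refl ((stationaryPeriodic_omega b 2).expSymbol s₁ T)
  have he : ∀ μ, ExpClose (ι := ι) (chartRegion s₁ T) (hubble Λ) d δ 0 (fun _ => eta b μ)
    fun _ => eta b μ := fun μ => .refl ((stationaryPeriodic_eta b μ).expSymbol s₁ T)
  have hN : ExpClose (ι := ι) (chartRegion s₁ T) (hubble Λ) d δ 0 (fun _ => roundMetric b μ ν)
    fun _ => roundMetric b μ ν := .refl ((stationaryPeriodic_roundMetric b μ ν).expSymbol s₁ T)
  have hdt : ∀ μ, ExpClose (ι := ι) (chartRegion s₁ T) (hubble Λ) d δ 0 (fun _ _ => dt μ)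
    fun _ _ => dt μ := fun μ => .const (dt μ)
  have hx4 : ExpClose (ι := ι) (chartRegion s₁ T) (hubble Λ) d δ 0 (fun _ y => x y ^ 4)
      fun _ y => x' y ^ 4 := by
    simpa only [← pow_mul] using hx2.pow 2
  have a2 := ha.pow 2
  have hW := one.add ((a2.mul_zero (hc.pow 2)).mul_zero hx2)
  have hX2 := one.add (a2.mul_zero hx2)
  have hT : ExpClose (chartRegion s₁ T) (hubble Λ) d δ 0
      (fun i y => deltaTheta Λ (a i) (omega b 2 y)) fun i y => deltaTheta Λ (a' i) (omega b 2 y) :=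
    one.add ((L.mul_zero a2).mul_zero (hc.pow 2))
  have hZ : ExpClose (chartRegion s₁ T) (hubble Λ) d δ 0
      (fun i _ => deltaZero Λ (a i)) fun i _ => deltaZero Λ (a' i) :=
    one.add (L.mul_zero a2)
  have hDX : ExpClose (chartRegion s₁ T) (hubble Λ) d δ 0
      (fun i y => deltaX Λ (a i) (m i) (x y)) fun i y => deltaX Λ (a' i) (m' i) (x' y) :=
    ((L.sub ((one.sub (L.mul_zero a2)).mul_zero hx2)).add
      ((two.mul_zero hm).mul_zero hx3)).sub (a2.mul_zero hx4)
  have one_le : ∀ {u : ℝ}, 0 ≤ u → 1 ≤ |1 + u| := fun hu => by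
    rw [abs_of_nonneg (by linarith)]
    linarith
  have iW := hW.inv one_pos (fun i y _ => one_le (by positivity))
    (fun i y _ => one_le (by positivity))
  have iT := hT.inv one_pos (fun i y _ => one_le (by positivity))
    (fun i y _ => one_le (by positivity))
  have iZ := hZ.inv one_pos (fun i y _ => one_le (by positivity))
    (fun i y _ => one_le (by positivity))
  have iD := hDX.inv hD (fun i y hy => (hX i y hy).trans (le_abs_self _))
    (fun i y hy => (hX' i y hy).trans (le_abs_self _))
  by_cases h : μ = 0 ∨ ν = 0
  · simp only [metricExp, conformalMetric, Matrix.of_apply, if_pos h]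
    by_cases h' : μ = 0 ∧ ν = 0
    · simp only [if_pos h']
      exact ((L.mul_zero hW).mul_zero iD).neg
    · simp only [if_neg h']
      exact .const 0
  · simp only [metricExp, conformalMetric, Matrix.of_apply, if_neg h]
    refine ExpClose.mul_zero (.refl (ExpSymbol.exp (-2))) ?_
    have t1 := (hW.mul_zero iT).mul_zero hN
    have t2 := ((a2.mul_zero (hx2.sub L)).mul_zero ((hT.mul_zero hX2).add (hW.mul_zero hZ))
      |>.mul_zero ((iW.mul_zero (iZ.mul_zero iZ)).mul_zero iT)).mul_zero ((he μ).mul_zero (he ν))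
    have t3 := (hT.mul_zero iW).mul_zero
      ((((a2.mul_zero (one.sub (hc.pow 2))).mul_zero (hx2.mul_zero hx2)).mul_zero
        ((hdt μ).mul_zero (hdt ν))).sub
        ((((ha.mul_zero hX2).mul_zero hx2).mul_zero iZ).mul_zero
          (((hdt μ).mul_zero (he ν)).add ((he μ).mul_zero (hdt ν)))))
    have t4 := (hDX.mul_zero iW).mul_zero
      (((hdt μ).sub ((ha.mul_zero iZ).mul_zero (he μ))).mul_zero
        ((hdt ν).sub ((ha.mul_zero iZ).mul_zero (he ν))))
    exact ((t1.add t2).add t3).add t4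

end Close

section Coercive

variable {Λ : ℝ}

theorem spatialProfile_sum (a m x c : ℝ) (N : Fin 3 → Fin 3 → ℝ) (e t v : Fin 3 → ℝ) :
    ∑ p, ∑ q, v p * v q * spatialProfile Λ a m x c (N p q) (e p) (e q) (t p) (t q)
      = spatialProfile Λ a m x c (∑ p, ∑ q, v p * v q * N p q) (∑ p, v p * e p) (∑ p, v p * e p)
        (∑ p, v p * t p) (∑ p, v p * t p) := by
  simp only [spatialProfile, Fin.sum_univ_three]
  ring

theorem sum_roundMetric (b : Bool) (y : Coord) (v : Fin 3 → ℝ) :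
    ∑ p : Fin 3, ∑ q : Fin 3, v p * v q * roundMetric b p.succ q.succ y
      = v 1 ^ 2 + Real.sin (y 2) ^ 2 * v 2 ^ 2 := by
  simp only [roundMetric_eq_false b, roundMetric_false, Fin.sum_univ_three]
  simp
  ring

theorem sum_roundMetric_mul (b : Bool) (y : Coord) (v : Fin 3 → ℝ) :
    (1 - omega b 2 y ^ 2) * ∑ p : Fin 3, ∑ q : Fin 3, v p * v q * roundMetric b p.succ q.succ y
      = (∑ p : Fin 3, v p * pd p.succ (omega b 2) y) ^ 2
        + (∑ p : Fin 3, v p * eta b p.succ y) ^ 2 := by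
  have h : ∀ p q : Fin 3, (1 - omega b 2 y ^ 2) * (v p * v q * roundMetric b p.succ q.succ y)
      = v p * v q * (pd p.succ (omega b 2) y * pd q.succ (omega b 2) y
        + eta b p.succ y * eta b q.succ y) := fun p q => by
    rw [← roundMetric_mul]
    ring
  simp only [Finset.mul_sum, h]
  simp only [Fin.sum_univ_three]
  ring

theorem omega_sq_le_one (b : Bool) (y : Coord) : omega b 2 y ^ 2 ≤ 1 := by
  have := omega_sq_sum b y
  linarith [sq_nonneg (omega b 0 y), sq_nonneg (omega b 1 y)]

theorem exp_mul_conformalMetric (a m : ℝ) (x : Coord → ℝ) (b : Bool) (y : Coord) (p q : Fin 3) :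
    Real.exp (-(2 : ℤ) * hubble Λ * y 0) * conformalMetric Λ a m x b y p.succ q.succ
      = spatialProfile Λ a m (x y) (omega b 2 y) (roundMetric b p.succ q.succ y)
        (eta b p.succ y) (eta b q.succ y) (dt p.succ) (dt q.succ) := by
  simp only [conformalMetric, Matrix.of_apply, Fin.succ_ne_zero, or_self, if_false]
  rw [← mul_assoc, ← Real.exp_add]
  push_cast
  rw [show -2 * hubble Λ * y 0 + - -2 * hubble Λ * y 0 = 0 by ring, Real.exp_zero, one_mul]

theorem conformalMetric_zero_zero (a m : ℝ) (x : Coord → ℝ) (b : Bool) (y : Coord) :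
    conformalMetric Λ a m x b y 0 0 = -lapseProfile Λ a m (x y) (omega b 2 y) := by
  simp [conformalMetric]

theorem conformalMetric_zero_succ (a m : ℝ) (x : Coord → ℝ) (b : Bool) (y : Coord) (j : Fin 3) :
    conformalMetric Λ a m x b y 0 j.succ = 0 := by
  simp [conformalMetric]

theorem conformalMetric_symm (a m : ℝ) (x : Coord → ℝ) (b : Bool) (y : Coord) (μ ν : Fin 4) :
    conformalMetric Λ a m x b y μ ν = conformalMetric Λ a m x b y ν μ := by
  simp only [conformalMetric, Matrix.of_apply, or_comm (a := μ = 0), and_comm (a := μ = 0),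
    roundMetric_comm b μ ν, spatialProfile]
  congr 3 <;> ring

/-- Coercivity of the conformal metric, uniformly in bounded parameters, away from the
coordinate poles. -/
theorem conformalMetric_coercive (hΛ : 0 < Λ) {A X d : ℝ} (hd : 0 < d) :
    ∃ κ > 0, ∀ (a m : ℝ) (x : Coord → ℝ) (b : Bool) (y : Coord), |a| ≤ A → 0 ≤ x y → x y ≤ X →
      d ≤ deltaX Λ a m (x y) → |y 2 - Real.pi / 2| < Real.pi / 3 → ∀ v : Fin 3 → ℝ,
        κ * ∑ p, v p ^ 2 ≤ ∑ p, ∑ q, v p * v q *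
          (Real.exp (-(2 : ℤ) * hubble Λ * y 0) * conformalMetric Λ a m x b y p.succ q.succ) := by
  obtain ⟨κ, hκ, h⟩ := spatialProfile_coercive hΛ (A := A) (X := X) hd
  refine ⟨κ / 4, by positivity, fun a m x b y ha hx0 hxX hD hy v => ?_⟩
  simp only [exp_mul_conformalMetric]
  rw [spatialProfile_sum (N := fun p q => roundMetric b p.succ q.succ y)
    (e := fun p => eta b p.succ y) (t := fun p => dt p.succ)]
  have hsin := half_le_sin hy
  have hsin2 : 1 / 4 ≤ Real.sin (y 2) ^ 2 := by nlinarith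
  have hN := sum_roundMetric b y v
  have hN' : (v 1 ^ 2 + v 2 ^ 2) / 4 ≤
      ∑ p : Fin 3, ∑ q : Fin 3, v p * v q * roundMetric b p.succ q.succ y := by
    have := mul_le_mul_of_nonneg_right hsin2 (sq_nonneg (v 2))
    rw [hN]
    linarith [sq_nonneg (v 1)]
  have ht : ∑ p : Fin 3, v p * dt p.succ = v 0 := by
    simp [Fin.sum_univ_three, dt]
  refine le_trans ?_ (h a m (x y) (omega b 2 y) _ _ _ _ ha hx0 hxX hD (omega_sq_le_one b y)
    (sum_roundMetric_mul b y v) (le_trans (by positivity) hN'))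
  rw [ht, div_mul_eq_mul_div, mul_div_assoc]
  refine mul_le_mul_of_nonneg_left ?_ hκ.le
  rw [Fin.sum_univ_three]
  linarith [sq_nonneg (v 0)]

theorem le_lapseProfile (hΛ : 0 < Λ) {a m x c D : ℝ} (h0 : 0 < deltaX Λ a m x)
    (h : deltaX Λ a m x ≤ D) : Λ / 3 * D⁻¹ ≤ lapseProfile Λ a m x c := by
  have hW : 1 ≤ 1 + a ^ 2 * c ^ 2 * x ^ 2 := by
    have : 0 ≤ a ^ 2 * c ^ 2 * x ^ 2 := by positivity
    linarith
  have h1 := inv_anti₀ h0 h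
  rw [lapseProfile, mul_assoc]
  refine mul_le_mul_of_nonneg_left (h1.trans ?_) (by positivity)
  exact le_mul_of_one_le_left (inv_pos.mpr h0).le hW

end Coercive

section Mix

variable {Λ : ℝ}

/-- The interpolation `(1 - ψ) g₁ + ψ g₂` of the metrics `conformalMetric` with parameters `p₁`
and `p₂`. -/
def mixMetric (Λ : ℝ) (p₁ p₂ : ℝ × ℝ) (ψ x : Coord → ℝ) (b : Bool) (y : Coord) :
    Matrix (Fin 4) (Fin 4) ℝ :=
  (1 - ψ y) • conformalMetric Λ p₁.1 p₁.2 x b y + ψ y • conformalMetric Λ p₂.1 p₂.2 x b y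

theorem mixMetric_apply (p₁ p₂ : ℝ × ℝ) (ψ x : Coord → ℝ) (b : Bool) (y : Coord) (μ ν : Fin 4) :
    mixMetric Λ p₁ p₂ ψ x b y μ ν = (1 - ψ y) * conformalMetric Λ p₁.1 p₁.2 x b y μ ν
      + ψ y * conformalMetric Λ p₂.1 p₂.2 x b y μ ν := rfl

variable {ι : Type*} {s₁ T : ℝ} {d : ℤ} {δ : ι → ℝ} {p₁ p₂ p₁' p₂' : ι → ℝ × ℝ}
  {ψ x x' : Coord → ℝ} {D : ℝ}

/-- Bounds on the parameters `p i` and on `x`, which keep `conformalMetric` in the cosmological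
region. -/
structure Cosmological (Λ s₁ X A D c : ℝ) (p : ι → ℝ × ℝ) (x : Coord → ℝ) : Prop where
  fst_le : ∀ i, |(p i).1| ≤ A
  snd_le : ∀ i, |(p i).2| ≤ A
  nonneg : ∀ y, 0 ≤ x y
  le : ∀ y, s₁ < y 0 → x y ≤ X
  le_delta : ∀ i y, s₁ < y 0 → c ≤ deltaX Λ (p i).1 (p i).2 (x y)
  delta_le : ∀ i y, s₁ < y 0 → deltaX Λ (p i).1 (p i).2 (x y) ≤ D

/-- Interpolations of nearby parameters, or nearby values of `x`, are close. -/
theorem expClose_mixMetric (hΛ : 0 < Λ) (b : Bool) {X A c : ℝ} (hc : 0 < c)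
    (hψ : StationaryPeriodic ψ)
    (hx2 : ExpClose (ι := ι) (chartRegion s₁ T) (hubble Λ) d δ 0 (fun _ y => x y ^ 2)
      fun _ y => x' y ^ 2)
    (hx3 : ExpClose (ι := ι) (chartRegion s₁ T) (hubble Λ) d δ 0 (fun _ y => x y ^ 3)
      fun _ y => x' y ^ 3)
    (h₁ : Cosmological Λ s₁ X A D c p₁ x) (h₂ : Cosmological Λ s₁ X A D c p₂ x)
    (h₁' : Cosmological Λ s₁ X A D c p₁' x') (h₂' : Cosmological Λ s₁ X A D c p₂' x')
    (hp : ∀ i, |(p₁ i).1 - (p₁' i).1| ≤ δ i ∧ |(p₁ i).2 - (p₁' i).2| ≤ δ i ∧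
      |(p₂ i).1 - (p₂' i).1| ≤ δ i ∧ |(p₂ i).2 - (p₂' i).2| ≤ δ i)
    (hd : d = 0 ∨ p₁ = p₁' ∧ p₂ = p₂')
    (μ ν : Fin 4) :
    ExpClose (chartRegion s₁ T) (hubble Λ) d δ (metricExp μ ν)
      (fun i y => mixMetric Λ (p₁ i) (p₂ i) ψ x b y μ ν)
      fun i y => mixMetric Λ (p₁' i) (p₂' i) ψ x' b y μ ν := by
  have hpar : ∀ u u' : ι → ℝ, (∀ i, |u i| ≤ A) → (∀ i, |u' i| ≤ A) → (∀ i, |u i - u' i| ≤ δ i) →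
      (d = 0 ∨ u = u') →
      ExpClose (chartRegion s₁ T) (hubble Λ) d δ 0 (fun i _ => u i) fun i _ => u' i :=
    fun u u' hu hu' huu hd => by
      have l := ExpSymbol.const (Ω := chartRegion s₁ T) (H := hubble Λ) (δ := fun _ => (1 : ℝ))
        (c := u) ⟨A, fun i => by simpa using hu i⟩
      have r := ExpSymbol.const (Ω := chartRegion s₁ T) (H := hubble Λ) (δ := fun _ => (1 : ℝ))
        (c := u') ⟨A, fun i => by simpa using hu' i⟩
      rcases hd with rfl | rfl
      · exact ⟨l, r, ExpSymbol.const (c := fun i => u i - u' i) ⟨1, fun i => by simpa using huu i⟩⟩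
      · exact .refl l
  have e₁ := expClose_conformalMetric hΛ b hx2 hx3
    (hpar (fun i => (p₁ i).1) (fun i => (p₁' i).1) h₁.fst_le h₁'.fst_le (fun i => (hp i).1)
      (hd.imp_right fun h => by rw [h.1]))
    (hpar (fun i => (p₁ i).2) (fun i => (p₁' i).2) h₁.snd_le h₁'.snd_le (fun i => (hp i).2.1)
      (hd.imp_right fun h => by rw [h.1])) hc
    (fun i y hy => h₁.le_delta i y hy.1) (fun i y hy => h₁'.le_delta i y hy.1) μ ν
  have e₂ := expClose_conformalMetric hΛ b hx2 hx3
    (hpar (fun i => (p₂ i).1) (fun i => (p₂' i).1) h₂.fst_le h₂'.fst_le (fun i => (hp i).2.2.1)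
      (hd.imp_right fun h => by rw [h.2]))
    (hpar (fun i => (p₂ i).2) (fun i => (p₂' i).2) h₂.snd_le h₂'.snd_le (fun i => (hp i).2.2.2)
      (hd.imp_right fun h => by rw [h.2])) hc
    (fun i y hy => h₂.le_delta i y hy.1) (fun i y hy => h₂'.le_delta i y hy.1) μ ν
  have hψ' : ExpClose (ι := ι) (chartRegion s₁ T) (hubble Λ) d δ 0 (fun _ => ψ) fun _ => ψ :=
    .refl (hψ.expSymbol s₁ T)
  have := ((((ExpClose.const 1).sub hψ').mul e₁).add (hψ'.mul e₂))
  rw [zero_add] at this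
  exact this

theorem uniformSplit_mixMetric (hΛ : 0 < Λ) {X A D c : ℝ} (hc : 0 < c) :
    ∃ κ, ∀ {ι : Type} {s₁ T : ℝ} {p₁ p₂ : ι → ℝ × ℝ} {ψ x : Coord → ℝ} (b : Bool),
      (∀ μ ν, ExpSymbol (chartRegion s₁ T) (hubble Λ) (metricExp μ ν) (fun _ => 1)
        fun i y => mixMetric Λ (p₁ i) (p₂ i) ψ x b y μ ν) →
      (∀ y, ψ y ∈ Set.Icc (0 : ℝ) 1) → Cosmological Λ s₁ X A D c p₁ x →
      Cosmological Λ s₁ X A D c p₂ x →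
      UniformSplit (chartRegion s₁ T) (hubble Λ) κ fun i => mixMetric Λ (p₁ i) (p₂ i) ψ x b := by
  obtain ⟨κ₁, hκ₁, hcoer⟩ := conformalMetric_coercive hΛ (A := A) (X := X) hc
  have hmax : 0 < max D 1 := one_pos.trans_le (le_max_right D 1)
  obtain ⟨κ, hκ⟩ : ∃ κ, κ = min κ₁ (Λ / 3 * (max D 1)⁻¹) := ⟨_, rfl⟩
  refine ⟨κ, fun {ι s₁ T p₁ p₂ ψ x} b hE hψ h₁ h₂ => ⟨?_, hE, ?_, ?_, ?_, ?_⟩⟩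
  · rw [hκ]
    exact lt_min hκ₁ (by positivity)
  · intro i y _ μ ν
    simp only [mixMetric_apply, conformalMetric_symm _ _ x b y μ ν]
  · intro i y _ j
    simp only [mixMetric_apply, conformalMetric_zero_succ, mul_zero, add_zero]
  · intro i y hy
    have l : ∀ {p : ι → ℝ × ℝ}, Cosmological Λ s₁ X A D c p x →
        κ ≤ lapseProfile Λ (p i).1 (p i).2 (x y) (omega b 2 y) := fun h =>
      (hκ ▸ min_le_right _ _).trans (le_lapseProfile hΛ (hc.trans_le (h.le_delta i y hy.1))
        ((h.delta_le i y hy.1).trans (le_max_left D 1)))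
    obtain ⟨g0, g1⟩ := hψ y
    simp only [mixMetric_apply, conformalMetric_zero_zero]
    have k1 := mul_le_mul_of_nonneg_left (l h₁) (sub_nonneg.mpr g1)
    have k2 := mul_le_mul_of_nonneg_left (l h₂) g0
    linarith
  · intro i y hy v
    have l : ∀ {p : ι → ℝ × ℝ}, Cosmological Λ s₁ X A D c p x → κ * ∑ p, v p ^ 2
        ≤ ∑ r, ∑ q, v r * v q * (Real.exp (-(2 : ℤ) * hubble Λ * y 0)
          * conformalMetric Λ (p i).1 (p i).2 x b y r.succ q.succ) := fun h =>
      (mul_le_mul_of_nonneg_right (hκ ▸ min_le_left _ _)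
        (Finset.sum_nonneg fun p _ => sq_nonneg (v p))).trans
        (hcoer _ _ x b y (h.fst_le i) (h.nonneg y) (h.le y hy.1) (h.le_delta i y hy.1) hy.2.2 v)
    obtain ⟨g0, g1⟩ := hψ y
    have k1 := mul_le_mul_of_nonneg_left (l h₁) (sub_nonneg.mpr g1)
    have k2 := mul_le_mul_of_nonneg_left (l h₂) g0
    have e : ∑ r : Fin 3, ∑ q : Fin 3, v r * v q * (Real.exp (-(2 : ℤ) * hubble Λ * y 0)
          * mixMetric Λ (p₁ i) (p₂ i) ψ x b y r.succ q.succ)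
        = (1 - ψ y) * ∑ r : Fin 3, ∑ q : Fin 3, v r * v q * (Real.exp (-(2 : ℤ) * hubble Λ * y 0)
          * conformalMetric Λ (p₁ i).1 (p₁ i).2 x b y r.succ q.succ)
        + ψ y * ∑ r : Fin 3, ∑ q : Fin 3, v r * v q * (Real.exp (-(2 : ℤ) * hubble Λ * y 0)
          * conformalMetric Λ (p₂ i).1 (p₂ i).2 x b y r.succ q.succ) := by
      simp only [Finset.mul_sum, ← Finset.sum_add_distrib, mixMetric_apply]
      refine Finset.sum_congr rfl fun r _ => Finset.sum_congr rfl fun q _ => ?_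
      ring
    rw [e]
    linarith

end Mix

/-! ### Curvature of the interpolated metric -/

section Local

theorem christoffel_eqOn {V : Set Coord} (hV : IsOpen V)
    {g g' : Coord → Matrix (Fin 4) (Fin 4) ℝ} (h : Set.EqOn g g' V) (κ μ ν : Fin 4) :
    Set.EqOn (christoffel g κ μ ν) (christoffel g' κ μ ν) V := fun y hy => by
  have hpd : ∀ l μ ν, pd l (fun z => g z μ ν) y = pd l (fun z => g' z μ ν) y := fun l μ ν =>
    pd_eqOn hV (fun z hz => by simp only [h hz]) l hy
  simp only [christoffel, h hy, hpd]

theorem einstein_eqOn {V : Set Coord} (hV : IsOpen V)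
    {g g' : Coord → Matrix (Fin 4) (Fin 4) ℝ} (h : Set.EqOn g g' V) (Λ : ℝ) (μ ν : Fin 4) :
    Set.EqOn (einstein Λ g μ ν) (einstein Λ g' μ ν) V := fun y hy => by
  have hΓ := fun κ μ ν => christoffel_eqOn hV h κ μ ν
  have hpd : ∀ l κ μ ν, pd l (christoffel g κ μ ν) y = pd l (christoffel g' κ μ ν) y :=
    fun l κ μ ν => pd_eqOn hV (hΓ κ μ ν) l hy
  simp only [einstein, ricci, hpd, h hy, fun κ μ ν => hΓ κ μ ν hy]

theorem UniformSplit.congr {ι : Type*} {Ω : TopologicalSpace.Opens Coord} {H c : ℝ}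
    {g g' : ι → Coord → Matrix (Fin 4) (Fin 4) ℝ} (hg : UniformSplit Ω H c g)
    (h : ∀ i, Set.EqOn (g' i) (g i) Ω) : UniformSplit Ω H c g' :=
  ⟨hg.pos, fun μ ν => (hg.entry μ ν).congr fun i y hy => by simp only [h i hy],
    fun i y hy => by simpa only [h i hy] using hg.symm i y hy,
    fun i y hy => by simpa only [h i hy] using hg.zero_succ i y hy,
    fun i y hy => by simpa only [h i hy] using hg.lapse_le i y hy,
    fun i y hy => by simpa only [h i hy] using hg.coercive i y hy⟩

theorem UniformSplit.comp {ι ι' : Type*} {Ω : TopologicalSpace.Opens Coord} {H c : ℝ}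
    {g : ι → Coord → Matrix (Fin 4) (Fin 4) ℝ} (hg : UniformSplit Ω H c g) (r : ι' → ι) :
    UniformSplit Ω H c fun i => g (r i) :=
  ⟨hg.pos, fun μ ν => (hg.entry μ ν).comp r, fun i => hg.symm (r i), fun i => hg.zero_succ (r i),
    fun i => hg.lapse_le (r i), fun i => hg.coercive (r i)⟩

/-- `Ric - Λ g` depends continuously on the point. -/
theorem MetricFamily.continuousOn_einstein {ι : Type*} {s₁ T H : ℝ}
    {g : ι → Coord → Matrix (Fin 4) (Fin 4) ℝ} (hH : 0 ≤ H)
    (hg : MetricFamily (chartRegion s₁ T) H g) (Λ : ℝ) (i : ι) (μ ν : Fin 4) :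
    ContinuousOn (einstein Λ (g i) μ ν) (chartRegion s₁ T) :=
  (((hg.refl (d := 0) (δ := fun _ => 1)).einstein Λ hH (fun _ hy => hy.1.le)
    (fun _ => zero_le_one) μ ν).left.smooth i).continuousOn

end Local

section Model

variable {Λ s₁ T : ℝ}

/-- At `x = 0` the interpolation is an asymptotic model. -/
theorem isAsymptoticModel_mixMetric (hΛ : 0 < Λ) {ι : Type*} {κ : ℝ} {p₁ p₂ : ι → ℝ × ℝ}
    {ψ : Coord → ℝ} (hψ : StationaryPeriodic ψ) {b : Bool}
    (hU : UniformSplit (chartRegion s₁ T) (hubble Λ) κ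
      fun i => mixMetric Λ (p₁ i) (p₂ i) ψ (fun _ => 0) b) (i : ι) :
    IsAsymptoticModel (chartRegion s₁ T) (hubble Λ)
      (mixMetric Λ (p₁ i) (p₂ i) ψ (fun _ => 0) b) := by
  refine ⟨(chartRegion s₁ T).isOpen, fun y hy => ?_, hU.zero_succ i, hU.symm i,
    fun y hy k j => ?_, fun y hy => (hU.splitLorentz i hy).det_ne_zero⟩
  · have : Λ / 3 ≠ 0 := by positivity
    have h1 : ∀ a m c, lapseProfile Λ a m 0 c = 1 := fun a m c => by
      simp only [lapseProfile, deltaX]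
      simp only [ne_eq, OfNat.ofNat_ne_zero, not_false_eq_true, zero_pow, mul_zero, add_zero,
        sub_zero, mul_one]
      exact mul_inv_cancel₀ this
    simp only [mixMetric_apply, conformalMetric_zero_zero, h1]
    ring
  · have hshift : ∀ τ : ℝ, mixMetric Λ (p₁ i) (p₂ i) ψ (fun _ => 0) b (y + τ • Pi.single 0 1)
        k.succ j.succ = Real.exp (2 * hubble Λ * τ)
          * mixMetric Λ (p₁ i) (p₂ i) ψ (fun _ => 0) b y k.succ j.succ := fun τ => by
      simp only [mixMetric_apply, conformalMetric, Matrix.of_apply, Fin.succ_ne_zero, or_self,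
        if_false, hψ.stationary, (stationaryPeriodic_omega b 2).stationary,
        (stationaryPeriodic_eta b _).stationary, (stationaryPeriodic_roundMetric b _ _).stationary]
      have : Real.exp (-(-2 : ℤ) * hubble Λ * (y + τ • (Pi.single 0 1 : Coord)) 0)
          = Real.exp (2 * hubble Λ * τ) * Real.exp (-(-2 : ℤ) * hubble Λ * y 0) := by
        rw [← Real.exp_add]
        congr 1
        simp only [Pi.add_apply, Pi.smul_apply, Pi.single_eq_same, smul_eq_mul, mul_one]
        push_cast
        ring
      rw [this]
      ring
    have hd := (hU.entry k.succ j.succ).diffAt i hy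
    have h1 := hd.hasFDerivAt.hasLineDerivAt (Pi.single 0 1)
    have h2 : HasDerivAt (fun τ : ℝ => Real.exp (2 * hubble Λ * τ)
        * mixMetric Λ (p₁ i) (p₂ i) ψ (fun _ => 0) b y k.succ j.succ)
        (2 * hubble Λ * mixMetric Λ (p₁ i) (p₂ i) ψ (fun _ => 0) b y k.succ j.succ) 0 := by
      have := (((hasDerivAt_id (0 : ℝ)).const_mul (2 * hubble Λ)).exp).mul_const
        (mixMetric Λ (p₁ i) (p₂ i) ψ (fun _ => 0) b y k.succ j.succ)
      simpa using this
    unfold HasLineDerivAt at h1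
    simp only [hshift] at h1
    exact h1.unique h2

end Model

section Partition

variable {Λ s₁ T X A D c : ℝ} {P : Set (ℝ × ℝ)} {χ : ℝ × Sphere2 → ℝ}

theorem UniformlyCosmological.invRadius (hM : UniformlyCosmological Λ s₁ X A D c P) {ι : Type*}
    {p : ι → ℝ × ℝ} (hp : ∀ i, p i ∈ P) : Cosmological Λ s₁ X A D c p (invRadius Λ) :=
  ⟨fun i => (hM.abs_le _ (hp i)).1, fun i => (hM.abs_le _ (hp i)).2,
    fun y => (invRadius_pos y).le, hM.invRadius_le,
    fun i y hy => (hM.delta _ (hp i) _ (invRadius_pos y).le (hM.invRadius_le y hy)).1,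
    fun i y hy => (hM.delta _ (hp i) _ (invRadius_pos y).le (hM.invRadius_le y hy)).2⟩

theorem UniformlyCosmological.infinity (hM : UniformlyCosmological Λ s₁ X A D c P) {ι : Type*}
    {p : ι → ℝ × ℝ} (hp : ∀ i, p i ∈ P) : Cosmological Λ s₁ X A D c p fun _ => 0 := by
  have hX : ∀ y : Coord, s₁ < y 0 → 0 ≤ X := fun y hy =>
    (invRadius_pos y).le.trans (hM.invRadius_le y hy)
  exact ⟨fun i => (hM.abs_le _ (hp i)).1, fun i => (hM.abs_le _ (hp i)).2,
    fun y => le_rfl, hX, fun i y hy => (hM.delta _ (hp i) _ le_rfl (hX y hy)).1,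
    fun i y hy => (hM.delta _ (hp i) _ le_rfl (hX y hy)).2⟩

theorem partitionMetric_eqOn (hΛ : 0 < Λ) (hM : UniformlyCosmological Λ s₁ X A D c P)
    {p₁ p₂ : ℝ × ℝ} (h₁ : p₁ ∈ P) (h₂ : p₂ ∈ P) (χ : ℝ × Sphere2 → ℝ) (b : Bool) :
    Set.EqOn (partitionMetric Λ p₁ p₂ χ b)
      (mixMetric Λ p₁ p₂ (chartFunction χ b) (invRadius Λ) b) (chartRegion s₁ T) := by
  intro y hy
  have hne : ∀ p ∈ P, deltaX Λ p.1 p.2 (KerrDeSitter.invRadius Λ y) ≠ 0 := fun p hp =>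
    (hM.pos.trans_le (hM.delta p hp _ (invRadius_pos y).le (hM.invRadius_le y hy.1)).1).ne'
  rw [partitionMetric, mixMetric, kerrDeSitter_eq_conformalMetric hΛ _ _ b (hne p₁ h₁),
    kerrDeSitter_eq_conformalMetric hΛ _ _ b (hne p₂ h₂), chartFunction]

theorem partitionMetric_self (p : ℝ × ℝ) (χ : ℝ × Sphere2 → ℝ) (b : Bool) :
    partitionMetric Λ p p χ b = kerrDeSitter Λ p.1 p.2 b := by
  ext y μ ν
  simp only [partitionMetric, Matrix.add_apply, Matrix.smul_apply, smul_eq_mul]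
  ring

theorem expSymbol_invRadius_pow {ι : Type*} (Ω : TopologicalSpace.Opens Coord) (n : ℕ) :
    ExpSymbol (ι := ι) Ω (hubble Λ) n (fun _ => 1) fun _ y => invRadius Λ y ^ n := by
  refine (ExpSymbol.exp (n : ℤ)).congr fun i y _ => ?_
  simp only [invRadius]
  rw [← Real.exp_nat_mul]
  congr 1
  push_cast
  ring

theorem expClose_invRadius_pow (hΛ : 0 < Λ) {ι : Type*} {n : ℕ} (hn : 2 ≤ n) :
    ExpClose (ι := ι) (chartRegion s₁ T) (hubble Λ) 2 (fun _ => 1) 0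
      (fun _ y => invRadius Λ y ^ n) fun _ _ => (0 : ℝ) ^ n := by
  have h := expSymbol_invRadius_pow (Λ := Λ) (ι := ι) (chartRegion s₁ T) n
  have hm : ∀ k : ℤ, k ≤ n → ExpSymbol (ι := ι) (chartRegion s₁ T) (hubble Λ) k (fun _ => 1)
      fun _ y => invRadius Λ y ^ n := fun k hk =>
    h.mono (hubble_pos hΛ).le (fun _ hy => hy.1.le) (fun _ => zero_le_one) hk
  have h0 : (0 : ℝ) ^ n = 0 := zero_pow (by omega)
  refine ⟨hm 0 (by omega), .const_one _, ?_⟩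
  simpa [h0] using hm (0 + 2) (by omega)

/-- Closeness to a fixed Kerr-de Sitter metric, and to the asymptotic model. -/
theorem exists_closeMetrics (hΛ : 0 < Λ) (hM : UniformlyCosmological Λ s₁ X A D c P)
    (hχ : ContMDiff (𝓘(ℝ, ℝ).prod (𝓡 2)) 𝓘(ℝ, ℝ) ∞ χ) (hχ01 : ∀ q, χ q ∈ Set.Icc (0 : ℝ) 1)
    (T : ℝ) (b : Bool) :
    ∃ κ, UniformSplit (chartRegion s₁ T) (hubble Λ) κ
        (fun i : P × P => partitionMetric Λ i.1 i.2 χ b) ∧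
      UniformSplit (chartRegion s₁ T) (hubble Λ) κ
        (fun i : P × P => mixMetric Λ i.1 i.2 (chartFunction χ b) (fun _ => 0) b) ∧
      CloseMetrics (chartRegion s₁ T) (hubble Λ) 0
        (fun i : P × P => |i.1.1.1 - i.2.1.1| + |i.1.1.2 - i.2.1.2|)
        (fun i => partitionMetric Λ i.1 i.2 χ b) (fun i => partitionMetric Λ i.1 i.1 χ b) ∧
      CloseMetrics (chartRegion s₁ T) (hubble Λ) 2 (fun _ => 1)
        (fun i : P × P => partitionMetric Λ i.1 i.2 χ b)
        (fun i => mixMetric Λ i.1 i.2 (chartFunction χ b) (fun _ => 0) b) := by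
  have hψ := stationaryPeriodic_chartFunction hχ b
  have hψ01 : ∀ y, chartFunction χ b y ∈ Set.Icc (0 : ℝ) 1 := fun y => hχ01 _
  obtain ⟨κ, hκ⟩ := uniformSplit_mixMetric hΛ (X := X) (A := A) (D := D) hM.pos
  have c₁ := hM.invRadius (p := fun i : P × P => i.1.1) fun i => i.1.2
  have c₂ := hM.invRadius (p := fun i : P × P => i.2.1) fun i => i.2.2
  have z₁ := hM.infinity (p := fun i : P × P => i.1.1) fun i => i.1.2
  have z₂ := hM.infinity (p := fun i : P × P => i.2.1) fun i => i.2.2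
  have hH := (hubble_pos hΛ).le
  have hpow : ∀ n : ℕ, ExpClose (ι := P × P) (chartRegion s₁ T) (hubble Λ) 0
      (fun i => |i.1.1.1 - i.2.1.1| + |i.1.1.2 - i.2.1.2|) 0
      (fun _ y => KerrDeSitter.invRadius Λ y ^ n) fun _ y => KerrDeSitter.invRadius Λ y ^ n :=
    fun n => .refl ((expSymbol_invRadius_pow _ n).mono hH (fun _ hy => hy.1.le)
      (fun _ => zero_le_one) (by omega))
  have e₀ := fun μ ν => expClose_mixMetric hΛ b hM.pos hψ (hpow 2) (hpow 3) c₁ c₂ c₁ c₁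
    (fun i => by
      have h1 := abs_nonneg (i.1.1.1 - i.2.1.1)
      have h2 := abs_nonneg (i.1.1.2 - i.2.1.2)
      refine ⟨?_, ?_, ?_, ?_⟩
      · simpa using add_nonneg h1 h2
      · simpa using add_nonneg h1 h2
      · rw [abs_sub_comm]
        linarith
      · rw [abs_sub_comm]
        linarith) (Or.inl rfl) μ ν
  have e₂ := fun μ ν => expClose_mixMetric (ι := P × P) (T := T) hΛ b hM.pos hψ
    (expClose_invRadius_pow hΛ le_rfl) (expClose_invRadius_pow hΛ (by norm_num)) c₁ c₂ z₁ z₂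
    (fun i => by simp) (Or.inr ⟨rfl, rfl⟩) μ ν
  have eq : ∀ i j : P, Set.EqOn (partitionMetric Λ i j χ b)
      (mixMetric Λ i j (chartFunction χ b) (KerrDeSitter.invRadius Λ) b) (chartRegion s₁ T) :=
    fun i j => partitionMetric_eqOn hΛ hM i.2 j.2 χ b
  have u₀ := (hκ b (fun μ ν => (e₀ μ ν).left) hψ01 c₁ c₂).congr
    (g' := fun i : P × P => partitionMetric Λ i.1 i.2 χ b) fun i => eq i.1 i.2
  have u₁ := (hκ b (fun μ ν => (e₀ μ ν).right) hψ01 c₁ c₁).congr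
    (g' := fun i : P × P => partitionMetric Λ i.1 i.1 χ b) fun i => eq i.1 i.1
  have u₂ := hκ b (fun μ ν => (e₂ μ ν).right) hψ01 z₁ z₂
  exact ⟨κ, u₀, u₂, ⟨u₀.metricFamily, u₁.metricFamily, fun μ ν => (e₀ μ ν).diff.congr fun i y hy =>
    by simp only [eq i.1 i.2 hy, eq i.1 i.1 hy]⟩,
    ⟨u₀.metricFamily, u₂.metricFamily, fun μ ν => (e₂ μ ν).diff.congr fun i y hy =>
    by simp only [eq i.1 i.2 hy]⟩⟩

theorem omega_sq_lt_one (b : Bool) {y : Coord} (hy : |y 2 - Real.pi / 2| < Real.pi / 3)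
    (hne : y 2 ≠ Real.pi / 2) : omega b 2 y ^ 2 < 1 := by
  have hs := half_le_sin hy
  have hc : 0 < Real.cos (y 2) ^ 2 := by
    rw [← Real.sin_pi_div_two_sub]
    have hpi := Real.pi_pos
    rw [abs_lt] at hy
    refine sq_pos_of_ne_zero fun h0 => hne ?_
    rw [Real.sin_eq_zero_iff_of_lt_of_lt (by linarith) (by linarith)] at h0
    linarith
  have h := Real.sin_sq_add_cos_sq (y 2)
  cases b
  · have : omega false 2 y = Real.cos (y 2) := by simp [omega, polarPoint]
    rw [this]
    nlinarith
  · have : omega true 2 y = Real.sin (y 2) * Real.sin (y 3) := by simp [omega, polarPoint]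
    rw [this, mul_pow]
    have := mul_le_mul_of_nonneg_left (Real.sin_sq_le_one (y 3)) (sq_nonneg (Real.sin (y 2)))
    linarith

/-- Kerr-de Sitter solves the Einstein equation, on the axis by continuity. -/
theorem einstein_kerrDeSitter (hΛ : 0 < Λ) (hM : UniformlyCosmological Λ s₁ X A D c P) {p : ℝ × ℝ}
    (hp : p ∈ P) (b : Bool) (μ ν : Fin 4) :
    Set.EqOn (einstein Λ (kerrDeSitter Λ p.1 p.2 b) μ ν) (fun _ => 0) (chartRegion s₁ T) := by
  obtain ⟨κ, u, -⟩ := exists_closeMetrics hΛ hM (χ := fun _ => 0) contMDiff_const (by simp) T b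
  have u' : UniformSplit (chartRegion s₁ T) (hubble Λ) κ
      fun _ : Unit => kerrDeSitter Λ p.1 p.2 b := by
    refine (u.comp fun _ : Unit => ((⟨p, hp⟩, ⟨p, hp⟩) : P × P)).congr fun _ y _ => ?_
    rw [partitionMetric_self p]
  have hdense : Dense {y : Coord | y 2 ≠ Real.pi / 2} :=
    (dense_compl_singleton (Real.pi / 2)).preimage (isOpenMap_eval 2)
  have hopen : IsOpen {y : Coord | y 2 ≠ Real.pi / 2} :=
    isOpen_ne_fun (continuous_apply 2) continuous_const
  have hΩ := (chartRegion s₁ T).isOpen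
  have hcont := u'.metricFamily.continuousOn_einstein (hubble_pos hΛ).le Λ () μ ν
  refine Set.EqOn.of_subset_closure
    (s := (chartRegion s₁ T : Set Coord) ∩ {y | y 2 ≠ Real.pi / 2}) (fun y hy => ?_) hcont
    continuousOn_const Set.inter_subset_left (hdense.open_subset_closure_inter hΩ)
  rw [einstein, ricci_kerrDeSitter_of_offAxis hΛ p.1 p.2 b (hΩ.inter hopen) (fun z hz => ?_)
    (fun z hz => (u'.splitLorentz () hz.1).det_ne_zero) hy, sub_self]
  refine ⟨?_, omega_sq_lt_one b hz.1.2.2 hz.2⟩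
  have hx := invRadius_pos (Λ := Λ) z
  have := (hM.delta p hp _ hx.le (hM.invRadius_le z hz.1.1)).1
  have hD := hM.pos.trans_le this
  rw [radius_eq_inv, deltaR_eq _ _ _ hx.ne', neg_lt_zero]
  positivity

/-- `Ric - Λ g` is small for close parameters, and decays as `s → ∞`. -/
theorem expSymbol_einstein_partitionMetric (hΛ : 0 < Λ)
    (hM : UniformlyCosmological Λ s₁ X A D c P)
    (hχ : ContMDiff (𝓘(ℝ, ℝ).prod (𝓡 2)) 𝓘(ℝ, ℝ) ∞ χ) (hχ01 : ∀ q, χ q ∈ Set.Icc (0 : ℝ) 1)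
    (T : ℝ) (b : Bool) (μ ν : Fin 4) (hμν : μ = 0 ∨ ν ≠ 0) :
    (ExpSymbol (chartRegion s₁ T) (hubble Λ) (metricExp μ ν + 0)
      (fun i : P × P => |i.1.1.1 - i.2.1.1| + |i.1.1.2 - i.2.1.2|)
      fun i => einstein Λ (partitionMetric Λ i.1 i.2 χ b) μ ν) ∧
    ExpSymbol (chartRegion s₁ T) (hubble Λ) (metricExp μ ν + 2) (fun _ => 1)
      fun i : P × P => einstein Λ (partitionMetric Λ i.1 i.2 χ b) μ ν := by
  obtain ⟨κ, u₀, u₂, c₀, c₂⟩ := exists_closeMetrics hΛ hM hχ hχ01 T b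
  have hH := (hubble_pos hΛ).le
  constructor
  · refine (c₀.einstein Λ hH (fun y (hy : y ∈ chartRegion s₁ T) => hy.1.le)
      (fun i => add_nonneg (abs_nonneg _) (abs_nonneg _)) μ ν).diff.congr fun i y hy => ?_
    simp only [partitionMetric_self, einstein_kerrDeSitter hΛ hM i.1.2 b μ ν hy, sub_zero]
  · have h1 := (c₂.einstein Λ hH (fun y (hy : y ∈ chartRegion s₁ T) => hy.1.le)
      (fun _ => zero_le_one) μ ν).diff
    have h2 := einstein_asymptoticModel hH (fun y (hy : y ∈ chartRegion s₁ T) => hy.1.le) c₂.right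
      (isAsymptoticModel_mixMetric hΛ (stationaryPeriodic_chartFunction hχ b) u₂) μ ν hμν
    rw [hubble_sq hΛ, mul_div_cancel₀ Λ three_ne_zero] at h2
    exact (h1.add h2).congr fun i y _ => by simp

theorem einstein_partitionMetric_eq_zero (hΛ : 0 < Λ) (hM : UniformlyCosmological Λ s₁ X A D c P)
    (hχ : ContMDiff (𝓘(ℝ, ℝ).prod (𝓡 2)) 𝓘(ℝ, ℝ) ∞ χ) (hχ01 : ∀ q, χ q ∈ Set.Icc (0 : ℝ) 1)
    (hχ0 : ∀ (t : ℝ) (q : Sphere2), t ≤ -1 → χ (t, q) = 0)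
    (hχ1 : ∀ (t : ℝ) (q : Sphere2), 1 ≤ t → χ (t, q) = 1) {p₁ p₂ : ℝ × ℝ} (h₁ : p₁ ∈ P)
    (h₂ : p₂ ∈ P) (b : Bool) {y : Coord} (hy : y ∈ chartRegion s₁ T) (hy1 : 1 ≤ |y 1|)
    (μ ν : Fin 4) : einstein Λ (partitionMetric Λ p₁ p₂ χ b) μ ν y = 0 := by
  obtain ⟨κ, u, -⟩ := exists_closeMetrics hΛ hM hχ hχ01 T b
  have hΩ := (chartRegion s₁ T).isOpen
  have hcont := u.metricFamily.continuousOn_einstein (hubble_pos hΛ).le Λ (⟨p₁, h₁⟩, ⟨p₂, h₂⟩) μ ν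
  have hsub : {y : Coord | 1 ≤ |y 1|} ⊆ closure {y : Coord | 1 < |y 1|} := by
    have hA : closure {t : ℝ | 1 < |t|} = {t : ℝ | 1 ≤ |t|} := by
      have : {t : ℝ | 1 < |t|} = (Metric.closedBall 0 1)ᶜ := by
        ext t
        simp
      rw [this, closure_compl, interior_closedBall _ one_ne_zero]
      ext t
      simp
    have := (isOpenMap_eval (X := fun _ : Fin 4 => ℝ) 1).preimage_closure_subset_closure_preimage
      (s := {t : ℝ | 1 < |t|})
    rw [hA] at this
    exact this
  have hpos : IsOpen {y : Coord | 1 < y 1} := isOpen_lt continuous_const (continuous_apply 1)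
  have hneg : IsOpen {y : Coord | y 1 < -1} := isOpen_lt (continuous_apply 1) continuous_const
  refine Set.EqOn.of_subset_closure (s := (chartRegion s₁ T : Set Coord) ∩ {y | 1 < |y 1|})
    (t := (chartRegion s₁ T : Set Coord) ∩ {y | 1 ≤ |y 1|}) (g := fun _ => 0) (fun z hz => ?_)
    (hcont.mono Set.inter_subset_left) continuousOn_const
    (Set.inter_subset_inter_right _ fun z (hz : 1 < |z 1|) => hz.le)
    ((Set.inter_subset_inter_right _ hsub).trans hΩ.inter_closure) ⟨hy, hy1⟩
  rcases lt_abs.mp (show 1 < |z 1| from hz.2) with h | h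
  · have he : Set.EqOn (partitionMetric Λ p₁ p₂ χ b) (kerrDeSitter Λ p₂.1 p₂.2 b)
        {y : Coord | 1 < y 1} := fun w (hw : 1 < w 1) => by
      rw [partitionMetric, hχ1 _ _ hw.le, sub_self, zero_smul, one_smul, zero_add]
    exact (einstein_eqOn hpos he Λ μ ν h).trans (einstein_kerrDeSitter hΛ hM h₂ b μ ν hz.1)
  · have he : Set.EqOn (partitionMetric Λ p₁ p₂ χ b) (kerrDeSitter Λ p₁.1 p₁.2 b)
        {y : Coord | y 1 < -1} := fun w (hw : w 1 < -1) => by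
      rw [partitionMetric, hχ0 _ _ hw.le, sub_zero, zero_smul, one_smul, add_zero]
    exact (einstein_eqOn hneg he Λ μ ν (lt_neg.mp h)).trans
      (einstein_kerrDeSitter hΛ hM h₁ b μ ν hz.1)

end Partition

section Interpolation

variable {ι : Type*} {Ω : TopologicalSpace.Opens Coord} {H : ℝ} {k : ℤ} {δ : ι → ℝ}
  {f : ι → Coord → ℝ}

/-- The bound of the derivative `∂_x^α` of a family by the minimum of `e^{-kHs}` and `δ`. -/
def MinBound (Ω : TopologicalSpace.Opens Coord) (H : ℝ) (k : ℤ) (δ : ι → ℝ) (α : Fin 3 → ℕ)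
    (f : ι → Coord → ℝ) (C : ℝ) : Prop :=
  ∀ i, ∀ ε, δ i < ε → ∀ y ∈ Ω, |spatialD α (f i) y| ≤ C * min (Real.exp (-k * H * y 0)) ε

theorem MinBound.mono {α : Fin 3 → ℕ} {C C' : ℝ} (hδ : ∀ i, 0 ≤ δ i)
    (h : MinBound Ω H k δ α f C) (hC : C ≤ C') : MinBound Ω H k δ α f C' := fun i ε hε y hy =>
  (h i ε hε y hy).trans (mul_le_mul_of_nonneg_right hC
    (le_min (Real.exp_pos _).le ((hδ i).trans hε.le)))

/-- Families which decay, and which are small with `δ`, are bounded by the minimum of the two. -/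
theorem ExpSymbol.exists_minBound {s₁ : ℝ} (hH : 0 ≤ H) (hs : ∀ y ∈ Ω, s₁ ≤ y 0)
    (hδ : ∀ i, 0 ≤ δ i) {l : ℤ} (hl : 0 ≤ l) (h1 : ExpSymbol Ω H k (fun _ => 1) f)
    (h2 : ExpSymbol Ω H l δ f) (α : Fin 3 → ℕ) : ∃ C, MinBound Ω H k δ α f C := by
  obtain ⟨C₁, hC₁⟩ := (h1.spatialD α).bounds 0
  obtain ⟨C₂, hC₂⟩ := ((h2.mono hH hs hδ hl).spatialD α).bounds 0
  refine ⟨max |C₁| |C₂|, fun i ε hε y hy => ?_⟩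
  rw [mul_min_of_nonneg _ _ ((abs_nonneg _).trans (le_max_left _ _))]
  refine le_min ((hC₁ i y hy).trans ?_) ((hC₂ i y hy).trans ?_)
  · rw [mul_one]
    exact mul_le_mul_of_nonneg_right ((le_abs_self _).trans (le_max_left _ _))
      (Real.exp_pos _).le
  · simp only [Int.cast_zero, neg_zero, zero_mul, Real.exp_zero, one_mul]
    exact mul_le_mul ((le_abs_self _).trans (le_max_right _ _)) hε.le (hδ i)
      ((abs_nonneg _).trans (le_max_left _ _))

/-- A common bound for finitely many monotone conditions. -/
theorem exists_common_bound {κ : Type*} [Finite κ] {Q : κ → ℝ → Prop}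
    (hQ : ∀ k C C', C ≤ C' → Q k C → Q k C') (h : ∀ k, ∃ C, Q k C) : ∃ C, ∀ k, Q k C := by
  choose C hC using h
  obtain ⟨M, hM⟩ := Finite.exists_le C
  exact ⟨M, fun k => hQ k _ _ (hM k) (hC k)⟩

end Interpolation

end KerrDeSitter

end

open KerrDeSitter

theorem mainTheorem3 (Λ : ℝ) (hΛ : 0 < Λ) (s₀ : ℝ)
    (P : Set (ℝ × ℝ)) (hP : IsCompact P)
    (hcosmo : ∀ p ∈ P, ∀ r : ℝ, Real.exp (KerrDeSitter.hubble Λ * s₀) ≤ r →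
      KerrDeSitter.deltaR Λ p.1 p.2 r < 0)
    (χ : ℝ × KerrDeSitter.Sphere2 → ℝ)
    (hχ : ContMDiff (𝓘(ℝ, ℝ).prod (𝓡 2)) 𝓘(ℝ, ℝ) ∞ χ)
    (hχ01 : ∀ q, χ q ∈ Set.Icc (0 : ℝ) 1)
    (hχ0 : ∀ (t : ℝ) (q : KerrDeSitter.Sphere2), t ≤ -1 → χ (t, q) = 0)
    (hχ1 : ∀ (t : ℝ) (q : KerrDeSitter.Sphere2), 1 ≤ t → χ (t, q) = 1) :
    (∀ p₁ ∈ P, ∀ p₂ ∈ P, ∀ b : Bool, ∀ y ∈ KerrDeSitter.chartDomain s₀,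
      (∀ μ ν : Fin 4,
        ContDiffAt ℝ ∞ (fun z => KerrDeSitter.partitionMetric Λ p₁ p₂ χ b z μ ν) y) ∧
      KerrDeSitter.partitionMetric Λ p₁ p₂ χ b y 0 0 < 0 ∧
      (∀ i : Fin 3, KerrDeSitter.partitionMetric Λ p₁ p₂ χ b y 0 i.succ = 0 ∧
        KerrDeSitter.partitionMetric Λ p₁ p₂ χ b y i.succ 0 = 0) ∧
      (KerrDeSitter.spatial (KerrDeSitter.partitionMetric Λ p₁ p₂ χ b) y).PosDef) ∧
    (∀ α : Fin 3 → ℕ, ∃ C : ℝ, ∀ p₁ ∈ P, ∀ p₂ ∈ P, ∀ ε : ℝ,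
      |p₁.1 - p₂.1| + |p₁.2 - p₂.2| < ε →
      ∀ b : Bool, ∀ y ∈ KerrDeSitter.chartDomain s₀, |y 1| < 1 →
        |KerrDeSitter.spatialD α
            (KerrDeSitter.err00 Λ (KerrDeSitter.partitionMetric Λ p₁ p₂ χ b)) y|
          ≤ C * min (Real.exp (-2 * KerrDeSitter.hubble Λ * y 0)) ε ∧
        (∀ j : Fin 3,
          |KerrDeSitter.spatialD α
              (KerrDeSitter.err0 (KerrDeSitter.partitionMetric Λ p₁ p₂ χ b) j) y|
            ≤ C * min (Real.exp (-4 * KerrDeSitter.hubble Λ * y 0)) ε) ∧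
        ∀ i j : Fin 3,
          |KerrDeSitter.spatialD α
              (KerrDeSitter.errSpatial Λ (KerrDeSitter.partitionMetric Λ p₁ p₂ χ b) i j) y|
            ≤ C * min (Real.exp (-2 * KerrDeSitter.hubble Λ * y 0)) ε) ∧
    (∀ p₁ ∈ P, ∀ p₂ ∈ P, ∀ b : Bool, ∀ y ∈ KerrDeSitter.chartDomain s₀, 1 ≤ |y 1| →
      KerrDeSitter.err00 Λ (KerrDeSitter.partitionMetric Λ p₁ p₂ χ b) y = 0 ∧
      (∀ j : Fin 3, KerrDeSitter.err0 (KerrDeSitter.partitionMetric Λ p₁ p₂ χ b) j y = 0) ∧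
      ∀ i j : Fin 3,
        KerrDeSitter.errSpatial Λ (KerrDeSitter.partitionMetric Λ p₁ p₂ χ b) i j y = 0) := by
  obtain ⟨s₁, hs₁, X, A, D, c, hM⟩ := exists_cosmological_margin hΛ hP hcosmo
  have hH := (hubble_pos hΛ).le
  have hmem : ∀ {y : Coord} {T : ℝ}, y ∈ chartDomain s₀ → |y 1| < T → y ∈ chartRegion s₁ T :=
    fun hy hT => ⟨hs₁.trans_le hy.1, hT, hy.2⟩
  refine ⟨fun p₁ h₁ p₂ h₂ b y hy => ?_, fun α => ?_, fun p₁ h₁ p₂ h₂ b y hy hy1 => ?_⟩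
  · obtain ⟨κ, u, -⟩ := exists_closeMetrics hΛ hM hχ hχ01 (|y 1| + 1) b
    have hy' := hmem hy (lt_add_one |y 1|)
    have hS := u.splitLorentz (⟨p₁, h₁⟩, ⟨p₂, h₂⟩) hy'
    exact ⟨fun μ ν => ((u.entry μ ν).smooth (⟨p₁, h₁⟩, ⟨p₂, h₂⟩)).contDiffAt
      ((chartRegion s₁ _).isOpen.mem_nhds hy'), hS.zero_zero,
      fun i => ⟨hS.zero_succ i, hS.succ_zero i⟩, hS.posDef⟩
  · have hs : ∀ y ∈ chartRegion s₁ 1, s₁ ≤ y 0 := fun y hy => hy.1.le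
    have herr := fun b => (exists_closeMetrics hΛ hM hχ hχ01 1 b).elim fun κ u =>
      And.intro
        (u.1.errors fun μ ν h => (expSymbol_einstein_partitionMetric hΛ hM hχ hχ01 1 b μ ν h).1)
        (u.1.errors fun μ ν h => (expSymbol_einstein_partitionMetric hΛ hM hχ hχ01 1 b μ ν h).2)
    obtain ⟨δ, hδ'⟩ : ∃ δ : P × P → ℝ, δ = fun i => |i.1.1.1 - i.2.1.1| + |i.1.1.2 - i.2.1.2| :=
      ⟨_, rfl⟩
    rw [← hδ'] at herr
    have hδ : ∀ i, 0 ≤ δ i := fun i => hδ' ▸ add_nonneg (abs_nonneg _) (abs_nonneg _)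
    obtain ⟨C₁, h₁⟩ : ∃ C, ∀ b, MinBound (chartRegion s₁ 1) (hubble Λ) 2 δ α
        (fun i : P × P => err00 Λ (partitionMetric Λ i.1 i.2 χ b)) C :=
      exists_common_bound (fun _ _ _ hC h => h.mono hδ hC) fun b =>
        (herr b).2.1.exists_minBound hH hs hδ le_rfl (herr b).1.1 α
    obtain ⟨C₂, h₂⟩ : ∃ C, ∀ k : Bool × Fin 3, MinBound (chartRegion s₁ 1) (hubble Λ) 4 δ α
        (fun i : P × P => err0 (partitionMetric Λ i.1 i.2 χ k.1) k.2) C :=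
      exists_common_bound (fun _ _ _ hC h => h.mono hδ hC) fun k =>
        ((herr k.1).2.2.1 k.2).exists_minBound hH hs hδ (by norm_num) ((herr k.1).1.2.1 k.2) α
    obtain ⟨C₃, h₃⟩ : ∃ C, ∀ k : Bool × Fin 3 × Fin 3, MinBound (chartRegion s₁ 1) (hubble Λ) 2 δ α
        (fun i : P × P => errSpatial Λ (partitionMetric Λ i.1 i.2 χ k.1) k.2.1 k.2.2) C :=
      exists_common_bound (fun _ _ _ hC h => h.mono hδ hC) fun k =>
        ((herr k.1).2.2.2 k.2.1 k.2.2).exists_minBound hH hs hδ le_rfl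
          ((herr k.1).1.2.2 k.2.1 k.2.2) α
    subst hδ'
    refine ⟨max C₁ (max C₂ C₃), fun p₁ hp₁ p₂ hp₂ ε hε b y hy hy1 => ⟨?_, fun j => ?_,
      fun i j => ?_⟩⟩
    · simpa using ((h₁ b).mono hδ (le_max_left C₁ (max C₂ C₃))) (⟨p₁, hp₁⟩, ⟨p₂, hp₂⟩) ε hε y
        (hmem hy hy1)
    · have := ((h₂ (b, j)).mono hδ ((le_max_left C₂ C₃).trans (le_max_right C₁ _)))
        (⟨p₁, hp₁⟩, ⟨p₂, hp₂⟩) ε hε y (hmem hy hy1)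
      norm_num at this
      simpa using this
    · simpa using ((h₃ (b, i, j)).mono hδ ((le_max_right C₂ C₃).trans (le_max_right C₁ _)))
        (⟨p₁, hp₁⟩, ⟨p₂, hp₂⟩) ε hε y (hmem hy hy1)
  · have hy' := hmem hy (lt_add_one |y 1|)
    obtain ⟨κ, u, -⟩ := exists_closeMetrics hΛ hM hχ hχ01 (|y 1| + 1) b
    exact errors_eq_zero (u.splitLorentz (⟨p₁, h₁⟩, ⟨p₂, h₂⟩) hy')
      (einstein_partitionMetric_eq_zero hΛ hM hχ hχ01 hχ0 hχ1 h₁ h₂ b hy' hy1)
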